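/- Notation. Functions on $\mathbb T^3$ are real, $2\pi$-periodic in each variable; $\hat f_k=(2\pi)^{-3}\int_{(-\pi,\pi)^3} f(x)e^{-ik\cdot x}\,dx$ for $k\in\mathbb Z^3$. For $s\ge 1$, $\tau>0$ and $r\ge1$, the Gevrey space $\mathcal G^s_{r,\tau}(\mathbb T^3)$ consists of the vector fields $v\in L^2(\mathbb T^3;\mathbb R^3)$ with $\hat v_0=0$, $k\cdot\hat v_k=0$ for all $k$ (i.e. $\nabla\cdot v=0$), $\sum_k(1+|k|^2)^r|\hat v_k|^2<\infty$ and $$\|v\|_{\mathcal G^s_{r,\tau}}^2=\sum_{k\in\mathbb Z^3}|k|^{2r}e^{2\tau|k|^{1/s}}|\hat v_k|^2<\infty .$$ For scalar functions (pressures) the same notation is used, without the condition $k\cdot\hat v_k=0$. For a function $\tau:[0,T]\to(0,\infty)$, $u\in L^\infty([0,T];\mathcal G^s_{r,\tau(\cdot)})$ means that $u$ is measurable in time, $u(t)\in\mathcal G^s_{r,\tau(t)}$ for every $t\in[0,T]$, and $\sup_{t\in[0,T]}\|u(t)\|_{\mathcal G^s_{r,\tau(t)}}<\infty$. For $\nu\ge0$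 consider on $\mathbb T^3$ $$\partial_t u-\nu\Delta u+(u\cdot\nabla)u+\nabla p=0,\qquad \nabla\cdot u=0,\qquad u|_{t=0}=a, \qquad (1)_\nu$$ which is the Navier–Stokes system for $\nu>0$ and the Euler system for $\nu=0$; solutions on $[0,T]$ are classical ones, satisfying the equations at every $x$ and every $t\in[0,T]$ (with one-sided time derivatives at $t=0,T$). Theorem. Let $r>\frac92$, $s\ge1$, $\tau_0>0$ and $a\in\mathcal G^s_{r,\tau_0}(\mathbb T^3)$. Then there exist $\nu_0>0$, $T>0$, constants $C_1,C_2>0$ and a positive, strictly decreasing function $\tau$ on $[0,T]$, given by $$\tau(t)=\frac{1}{e^{C_1t}\frac1{\tau_0}+\frac{C_2}{C_1}\left(e^{C_1t}-1\right)},$$ such that the Euler system $(1)_0$ admits a solution $(u,p)$ with $$u\in L^\infty([0,T];\mathcal G^s_{r,\tau(\cdot)}),\qquad p\in L^\infty([0,T];\mathcal G^s_{r+1,\tau(\cdot)}),$$ and, for every $0<\nu\le\nu_0$, the Navier–Stokes system $(1)_\nu$ admits a solution $(u^\nu,p^\nu)$ with $$u^\nu\in L^\infty([0,T];\mathcal G^s_{r,\tau(\cdot)}),\qquad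 p^\nu\in L^\infty([0,T];\mathcal G^s_{r+1,\tau(\cdot)}).$$ Moreover there is a constant $C$, independent of $\nu$ and $t$, such that for all $0<\nu\le\nu_0$ and all $0<t\le T$ $$\|u^\nu(t)-u(t)\|_{\mathcal G^s_{r-1,\tau(t)}}\le C\sqrt\nu,\qquad \|p^\nu(t)-p(t)\|_{\mathcal G^s_{r,\tau(t)}}\le C\sqrt\nu .$$ -/

import Mathlib

open Real Set MeasureTheory

noncomputable section

namespace GevreyNS

/-- Euclidean three-space. Functions on the torus are `2π`-periodic functions on it. -/
abbrev E3 : Type := EuclideanSpace ℝ (Fin 3)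

/-- The cube `(-π, π)³`, a fundamental domain of the torus. -/
def cube : Set E3 := {x | ∀ i, x i ∈ Ioo (-π) π}

/-- `2π`-periodicity in each coordinate direction. -/
def IsPeriodic {F : Type*} (f : E3 → F) : Prop :=
  ∀ (i : Fin 3) (x : E3), f (x + EuclideanSpace.single i (2 * π)) = f x

/-- The phase `k · x` of the mode `k ∈ ℤ³`. -/
def phase (k : Fin 3 → ℤ) (x : E3) : ℝ := ∑ i, (k i : ℝ) * x i

/-- The Euclidean length `|k|` of `k ∈ ℤ³`. -/
def freqNorm (k : Fin 3 → ℤ) : ℝ := √(∑ i, (k i : ℝ) ^ 2)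

/-- The Fourier coefficient `(2π)⁻³ ∫ f(x) e^{-i k·x} dx` of a real function. -/
def fourierCoef (f : E3 → ℝ) (k : Fin 3 → ℤ) : ℂ :=
  ((1 / (2 * π) ^ 3 : ℝ) : ℂ) *
    ∫ x in cube, (f x : ℂ) * Complex.exp (-(Complex.I * (phase k x : ℂ)))

/-- The (componentwise) Fourier coefficient of a real vector field. -/
def vecFourierCoef (v : E3 → E3) (k : Fin 3 → ℤ) : Fin 3 → ℂ :=
  fun i => fourierCoef (fun x => v x i) k

/-- The weight `(1 + |k|²)^r`. -/
def sobolevWeight (r : ℝ) (k : Fin 3 → ℤ) : ℝ := (1 + freqNorm k ^ 2) ^ r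

/-- The weight `|k|^{2r} e^{2 τ |k|^{1/s}}`. -/
def gevreyWeight (s r τ : ℝ) (k : Fin 3 → ℤ) : ℝ :=
  freqNorm k ^ (2 * r) * Real.exp (2 * τ * freqNorm k ^ (1 / s))

/-- The norm `(∑ₖ w(k) |cₖ|²)^{1/2} ∈ [0, ∞]`, where the sequence `A` is `k ↦ |cₖ|²`. -/
def weightedNorm (w A : (Fin 3 → ℤ) → ℝ) : ENNReal :=
  (∑' k, ENNReal.ofReal (w k * A k)) ^ (1 / 2 : ℝ)

/-- The `H^r` norm of a vector field. -/
def sobolevNorm (r : ℝ) (v : E3 → E3) : ENNReal :=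
  weightedNorm (sobolevWeight r) (fun k => ∑ i, ‖vecFourierCoef v k i‖ ^ 2)

/-- The Gevrey norm of a vector field. -/
def gevreyNorm (s r τ : ℝ) (v : E3 → E3) : ENNReal :=
  weightedNorm (gevreyWeight s r τ) (fun k => ∑ i, ‖vecFourierCoef v k i‖ ^ 2)

/-- The `H^r` norm of a scalar function. -/
def sobolevNormScalar (r : ℝ) (q : E3 → ℝ) : ENNReal :=
  weightedNorm (sobolevWeight r) (fun k => ‖fourierCoef q k‖ ^ 2)

/-- The Gevrey norm of a scalar function. -/
def gevreyNormScalar (s r τ : ℝ) (q : E3 → ℝ) : ENNReal :=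
  weightedNorm (gevreyWeight s r τ) (fun k => ‖fourierCoef q k‖ ^ 2)

/-- The space of real, periodic, mean-free, divergence-free `H^r` vector fields. As usual the
elements are square integrable functions, and the divergence is taken in the weak sense. -/
structure MemSobolev (r : ℝ) (v : E3 → E3) : Prop where
  periodic : IsPeriodic v
  memLp : MemLp v 2 (volume.restrict cube)
  mean_zero : vecFourierCoef v 0 = 0
  div_free : ∀ k, ∑ i, ((k i : ℤ) : ℂ) * vecFourierCoef v k i = 0
  finite : sobolevNorm r v < ⊤

/-- The vector Gevrey space `G^s_{r,τ}`, a subspace of the space of divergence-free `H^r` fields. -/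
structure MemGevrey (s r τ : ℝ) (v : E3 → E3) : Prop where
  sobolev : MemSobolev r v
  finite : gevreyNorm s r τ v < ⊤

/-- The scalar Gevrey space `G^s_{r,τ}` (mean-free functions), to which pressures belong. -/
structure MemGevreyScalar (s r τ : ℝ) (q : E3 → ℝ) : Prop where
  periodic : IsPeriodic q
  memLp : MemLp q 2 (volume.restrict cube)
  mean_zero : fourierCoef q 0 = 0
  sobolev : sobolevNormScalar r q < ⊤
  finite : gevreyNormScalar s r τ q < ⊤

/-- `u ∈ L^∞([0,T]; G^s_{r,τ(·)})`: the field is (weakly) measurable in time, and lies at each time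
`t` in the space of radius `τ(t)`, with bounded norm. Weak measurability is measurability of the
Fourier coefficients; as the spaces are separable it is the same as strong measurability. -/
structure MemLinftyGevrey (s r T : ℝ) (τ : ℝ → ℝ) (u : ℝ → E3 → E3) : Prop where
  measurable : ∀ k i,
    AEStronglyMeasurable (fun t => vecFourierCoef (u t) k i) (volume.restrict (Icc 0 T))
  mem : ∀ t ∈ Icc 0 T, MemGevrey s r (τ t) (u t)
  bounded : ∃ M : ℝ, ∀ t ∈ Icc 0 T, gevreyNorm s r (τ t) (u t) ≤ ENNReal.ofReal M

/-- `p ∈ L^∞([0,T]; G^s_{r,τ(·)})` for scalar functions. -/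
structure MemLinftyGevreyScalar (s r T : ℝ) (τ : ℝ → ℝ) (p : ℝ → E3 → ℝ) : Prop where
  measurable : ∀ k,
    AEStronglyMeasurable (fun t => fourierCoef (p t) k) (volume.restrict (Icc 0 T))
  mem : ∀ t ∈ Icc 0 T, MemGevreyScalar s r (τ t) (p t)
  bounded : ∃ M : ℝ, ∀ t ∈ Icc 0 T, gevreyNormScalar s r (τ t) (p t) ≤ ENNReal.ofReal M

/-- `(u, p)` is a classical periodic solution on `[0,T]` of
`∂ₜu - ν Δu + (u·∇)u + ∇p = 0`, `∇·u = 0`, `u(0) = a`.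
The equations hold at every point and every `t ∈ [0,T]`, with one-sided time derivatives at the
end points. The initial datum is an `L²` function, so it is attained almost everywhere. -/
structure IsNavierStokesSolution (ν T : ℝ) (a : E3 → E3) (u : ℝ → E3 → E3) (p : ℝ → E3 → ℝ) :
    Prop where
  periodic_u : ∀ t ∈ Icc 0 T, IsPeriodic (u t)
  periodic_p : ∀ t ∈ Icc 0 T, IsPeriodic (p t)
  contDiff_u : ∀ t ∈ Icc 0 T, ContDiff ℝ 2 (u t)
  contDiff_p : ∀ t ∈ Icc 0 T, ContDiff ℝ 1 (p t)
  momentum : ∀ t ∈ Icc 0 T, ∀ x, ∃ dtu : E3,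
    HasDerivWithinAt (fun t' => u t' x) dtu (Icc 0 T) t ∧
      dtu - ν • Laplacian.laplacian (u t) x + fderiv ℝ (u t) x (u t x) + gradient (p t) x = 0
  incompressible : ∀ t ∈ Icc 0 T, ∀ x,
    ∑ i, (fderiv ℝ (u t) x (EuclideanSpace.single i 1)) i = 0
  initial : u 0 =ᵐ[volume] a

/-- The Euler equations are the case of zero viscosity. -/
def IsEulerSolution (T : ℝ) (a : E3 → E3) (u : ℝ → E3 → E3) (p : ℝ → E3 → ℝ) : Prop :=
  IsNavierStokesSolution 0 T a u p

end GevreyNS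

end

/-!
The Gevrey norm is monitored in Fourier variables, where the system reads
`u̇ₖ = -ν |k|² uₖ - i Pₖ ∑ₗ (l · uₖ₋ₗ) uₗ` with the Leray projection `Pₖ`. All norms are those of
finite truncations (the Galerkin systems on symmetric boxes of frequencies), so that no question of
convergence interferes with the estimates.

*Uniform bounds.* Since `u` is real and divergence-free, transport is skew-symmetric, and in the
Gevrey energy balance only the commutator of the weight `W(x) = x^q e^{τ x^σ}`, `σ = 1/s`, with the
transport operator survives. By the mean value theorem (`mul_abs_gevW_sub_le`) the commutator gains
one derivative, up to a remainder with the factor `τ |k|^{σ/2} |l|^{σ/2} |k-l|^{σ/2}`, as the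
largest two lengths of a triad are comparable. The remainder is a multiple of `τ` times the square
of the norm of order `q + σ/2`, which is the norm gained when the radius shrinks; choosing
`τ' ≤ -C₁ τ` with `C₁` large absorbs it. This bounds the norm of order `r` on a time interval that
does not depend on `ν ≥ 0` or on the truncation (`galerkin_gnorm_le`). The viscous term only helps.

*Rate.* For the difference `w` of the Navier-Stokes and the Euler approximation the same argument
is run with the weight of order `r - 1` (`galerkin_sub_gnorm_le`). The stretching term `w · ∇u⁰`
costs one derivative of `u⁰`, and after completing the square the viscous term contributes at most
`ν |u⁰|²/4` measured in the norm of order `r`, which is bounded. Gronwall's inequality gives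
`|w|² ≤ C ν`, hence the rate `√ν`. The pressure is `-|k|⁻² k · (convection)` and, because both
factors are divergence-free, it is one derivative smoother than the velocity (`pres_conv_le`).

*Passage to the limit.* The bounds force the coefficients to decay like `e^{-τ(T) |k|^σ}`, uniformly
in time and in the truncation. The limit is taken along an ultrafilter, mode by mode; the
convolutions converge by dominated convergence, and a uniform second order Taylor estimate in time
gives the differential equation for the limit (`isSpectralSol_of_tendsto`). The rapid decay makes
the Fourier series classical solutions (`IsSpectralSol.isNavierStokesSolution`), and completeness of
the trigonometric system identifies the initial value with the given datum.
-/

noncomputable section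

namespace GevreyNS

/-! ### Frequencies and rapidly decaying families -/

/-- Frequencies `k ∈ ℤ³`. -/
abbrev Freq : Type := Fin 3 → ℤ

/-- Complex vectors with the Hermitian norm, in which vector Fourier coefficients take values. -/
abbrev C3 : Type := EuclideanSpace ℂ (Fin 3)

/-- A frequency as a vector of Euclidean space. -/
def freqVec (k : Freq) : E3 := WithLp.toLp 2 fun i => (k i : ℝ)

lemma freqNorm_eq (k : Freq) : freqNorm k = ‖freqVec k‖ := by
  simp [freqNorm, freqVec, EuclideanSpace.norm_eq]

lemma freqVec_add (k l : Freq) : freqVec (k + l) = freqVec k + freqVec l := by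
  ext i; simp [freqVec]

lemma freqVec_injective : Function.Injective freqVec := by
  intro k l h
  ext i
  have := congrArg (fun v : E3 => v i) h
  simpa [freqVec] using this

lemma freqNorm_nonneg (k : Freq) : 0 ≤ freqNorm k := Real.sqrt_nonneg _

@[simp] lemma freqNorm_zero : freqNorm 0 = 0 := by simp [freqNorm]

@[simp] lemma freqNorm_neg (k : Freq) : freqNorm (-k) = freqNorm k := by simp [freqNorm]

lemma freqNorm_sq (k : Freq) : freqNorm k ^ 2 = ∑ i, (k i : ℝ) ^ 2 :=
  Real.sq_sqrt (Finset.sum_nonneg fun _ _ => sq_nonneg _)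

lemma freqNorm_add_le (k l : Freq) : freqNorm (k + l) ≤ freqNorm k + freqNorm l := by
  simpa only [freqNorm_eq, freqVec_add] using norm_add_le _ _

lemma freqNorm_sub_comm (k l : Freq) : freqNorm (k - l) = freqNorm (l - k) := by
  rw [← freqNorm_neg, neg_sub]

lemma freqNorm_le_sub_add (k l : Freq) : freqNorm k ≤ freqNorm (k - l) + freqNorm l := by
  simpa using freqNorm_add_le (k - l) l

lemma freqNorm_le_sub_add' (k l : Freq) : freqNorm l ≤ freqNorm (k - l) + freqNorm k := by
  rw [freqNorm_sub_comm]; exact freqNorm_le_sub_add l k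

lemma abs_coe_le_freqNorm (k : Freq) (i : Fin 3) : |(k i : ℝ)| ≤ freqNorm k := by
  rw [← Real.sqrt_sq_eq_abs]
  exact Real.sqrt_le_sqrt
    (Finset.single_le_sum (f := fun i => (k i : ℝ) ^ 2) (fun _ _ => sq_nonneg _)
      (Finset.mem_univ i))

lemma one_le_freqNorm {k : Freq} (hk : k ≠ 0) : 1 ≤ freqNorm k := by
  obtain ⟨i, hi⟩ := Function.ne_iff.mp hk
  refine le_trans ?_ (abs_coe_le_freqNorm k i)
  exact_mod_cast Int.one_le_abs (by simpa using hi)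

lemma freqNorm_pos {k : Freq} (hk : k ≠ 0) : 0 < freqNorm k :=
  zero_lt_one.trans_le (one_le_freqNorm hk)

/-- The lattice sum `∑ₖ |k|^p` converges for `p < -3`, the mode `k = 0` contributing zero. -/
lemma summable_freqNorm_rpow {p : ℝ} (hp : p < -3) : Summable fun k : Freq => freqNorm k ^ p := by
  let b := (EuclideanSpace.basisFun (Fin 3) ℝ).toBasis
  let L := Submodule.span ℤ (Set.range b)
  have hfr : Module.finrank ℤ L = 3 := by
    rw [ZLattice.rank ℝ L]; simp
  have hs := ZLattice.summable_norm_rpow L p (by rw [hfr]; exact_mod_cast hp)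
  have hmem : ∀ k : Freq, freqVec k ∈ L := by
    intro k
    have : freqVec k = ∑ i, k i • b i := by
      ext j
      simp [b, freqVec, Finset.sum_apply, Pi.single_apply]
    rw [this]
    exact Submodule.sum_mem _ fun i _ =>
      Submodule.smul_mem _ _ (Submodule.subset_span ⟨i, rfl⟩)
  have hinj : Function.Injective fun k : Freq => (⟨freqVec k, hmem k⟩ : L) := fun k l h =>
    freqVec_injective (congrArg Subtype.val h)
  have := hs.comp_injective hinj
  simpa [Function.comp_def, freqNorm_eq] using this

/-- A family indexed by `ℤ³` which decays faster than every power of the frequency. -/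
def Rapid {F : Type*} [Norm F] (c : Freq → F) : Prop :=
  ∀ m : ℕ, Summable fun k => (1 + freqNorm k) ^ m * ‖c k‖

section Rapid
variable {F G : Type*} [NormedAddCommGroup F] [NormedAddCommGroup G]

lemma Rapid.of_le {c : Freq → F} {d : Freq → G} (hd : Rapid d) (A : ℝ) (n : ℕ)
    (h : ∀ k, ‖c k‖ ≤ A * (1 + freqNorm k) ^ n * ‖d k‖) : Rapid c := by
  intro m
  refine Summable.of_nonneg_of_le (fun k => ?_) (fun k => ?_) ((hd (m + n)).mul_left A)
  · have := freqNorm_nonneg k; positivity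
  · have := freqNorm_nonneg k
    calc _ ≤ (1 + freqNorm k) ^ m * (A * (1 + freqNorm k) ^ n * ‖d k‖) := by gcongr; exact h k
      _ = _ := by rw [pow_add]; ring

lemma Rapid.mono {c : Freq → F} {d : Freq → G} (hd : Rapid d) (h : ∀ k, ‖c k‖ ≤ ‖d k‖) :
    Rapid c := hd.of_le 1 0 (by simpa using h)

lemma Rapid.summable_norm {c : Freq → F} (h : Rapid c) : Summable fun k => ‖c k‖ := by
  simpa using h 0

lemma Rapid.summable [CompleteSpace F] {c : Freq → F} (h : Rapid c) : Summable c :=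
  h.summable_norm.of_norm

lemma Rapid.add {c d : Freq → F} (hc : Rapid c) (hd : Rapid d) : Rapid fun k => c k + d k := by
  intro m
  refine Summable.of_nonneg_of_le (fun k => ?_) (fun k => ?_) ((hc m).add (hd m))
  · have := freqNorm_nonneg k; positivity
  · have := freqNorm_nonneg k
    rw [← mul_add]; gcongr; exact norm_add_le _ _

end Rapid

/-- The change of variables `(k, l) ↦ (k - l, l)` of pairs of frequencies. -/
def addPairEquiv : Freq × Freq ≃ Freq × Freq where
  toFun p := (p.1 - p.2, p.2)
  invFun p := (p.1 + p.2, p.2)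
  left_inv p := by simp
  right_inv p := by simp

lemma summable_prod_conv {R : Type*} [NormedRing R] [CompleteSpace R] {b d : Freq → R}
    (hb : Summable fun k => ‖b k‖) (hd : Summable fun k => ‖d k‖) :
    Summable fun p : Freq × Freq => b (p.1 - p.2) * d p.2 :=
  addPairEquiv.summable_iff.mpr (summable_mul_of_summable_norm hb hd)

lemma summable_conv {R : Type*} [NormedRing R] [CompleteSpace R] {b d : Freq → R}
    (hb : Summable fun k => ‖b k‖) (hd : Summable fun k => ‖d k‖) (k : Freq) :
    Summable fun l => b (k - l) * d l :=
  (summable_prod_conv hb hd).prod_factor k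

lemma summable_tsum_conv {R : Type*} [NormedRing R] [CompleteSpace R] {b d : Freq → R}
    (hb : Summable fun k => ‖b k‖) (hd : Summable fun k => ‖d k‖) :
    Summable fun k => ∑' l, b (k - l) * d l :=
  (summable_prod_conv hb hd).prod

/-- The Cauchy product of two families indexed by `ℤ³`. -/
lemma tsum_mul_tsum_conv {R : Type*} [NormedRing R] [CompleteSpace R] {b d : Freq → R}
    (hb : Summable fun k => ‖b k‖) (hd : Summable fun k => ‖d k‖) :
    (∑' k, b k) * ∑' k, d k = ∑' k, ∑' l, b (k - l) * d l := by
  rw [tsum_mul_tsum_of_summable_norm hb hd, ← (summable_prod_conv hb hd).tsum_prod,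
    ← addPairEquiv.tsum_eq]
  rfl

/-- Rapid decay is inherited by convolutions. -/
lemma Rapid.conv {b d : Freq → ℝ} (hb : Rapid b) (hd : Rapid d) :
    Rapid fun k => ∑' l, |b (k - l)| * |d l| := by
  intro m
  have hb' : Summable fun k => ‖(1 + freqNorm k) ^ m * |b k|‖ := by
    refine (hb m).congr fun k => ?_
    have := freqNorm_nonneg k
    simp [abs_of_nonneg (show 0 ≤ 1 + freqNorm k by linarith)]
  have hd' : Summable fun k => ‖(1 + freqNorm k) ^ m * |d k|‖ := by
    refine (hd m).congr fun k => ?_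
    have := freqNorm_nonneg k
    simp [abs_of_nonneg (show 0 ≤ 1 + freqNorm k by linarith)]
  refine Summable.of_nonneg_of_le (fun k => ?_) (fun k => ?_) (summable_tsum_conv hb' hd')
  · have := freqNorm_nonneg k; positivity
  · have hk := freqNorm_nonneg k
    rw [Real.norm_of_nonneg (tsum_nonneg fun l => by positivity), ← tsum_mul_left]
    refine Summable.tsum_le_tsum (fun l => ?_) ?_ (summable_conv hb' hd' k)
    · have h1 := freqNorm_nonneg l
      have h2 := freqNorm_nonneg (k - l)
      have h3 : (1 + freqNorm k) ^ m ≤ (1 + freqNorm (k - l)) ^ m * (1 + freqNorm l) ^ m := by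
        rw [← mul_pow]
        gcongr
        nlinarith [freqNorm_le_sub_add k l, mul_nonneg h1 h2]
      calc _ ≤ ((1 + freqNorm (k - l)) ^ m * (1 + freqNorm l) ^ m) *
            (|b (k - l)| * |d l|) := by gcongr
        _ = _ := by ring
    · exact (summable_conv (b := fun k => |b k|) (d := fun k => |d k|)
        (by simpa using hb.summable_norm) (by simpa using hd.summable_norm) k).mul_left _

lemma rapid_exp {τ σ : ℝ} (hτ : 0 < τ) (hσ : 0 < σ) :
    Rapid fun k => Real.exp (-(τ * freqNorm k ^ σ)) := by
  intro m
  -- `n` is so large that `|k| ^ (n σ)` beats `|k| ^ (m + 4)`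
  obtain ⟨n, hn⟩ := exists_nat_ge ((m + 4 : ℝ) / σ)
  rw [div_le_iff₀ hσ] at hn
  have hs := (summable_freqNorm_rpow (p := -4) (by norm_num)).mul_left
    (2 ^ m * (n.factorial / τ ^ n))
  refine Summable.of_norm_bounded_eventually hs ?_
  rw [Filter.eventually_cofinite]
  refine (Set.finite_singleton (0 : Freq)).subset fun k hk => ?_
  by_contra hk0
  refine hk ?_
  have hx := one_le_freqNorm hk0
  set x := freqNorm k
  have hx0 : 0 < x := by linarith
  have hexp : Real.exp (-(τ * x ^ σ)) ≤ n.factorial / τ ^ n * x ^ (-(m + 4 : ℝ)) := by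
    have h1 := Real.pow_div_factorial_le_exp (τ * x ^ σ) (by positivity) n
    have h2 : x ^ (m + 4 : ℝ) ≤ (x ^ σ) ^ n := by
      rw [← Real.rpow_natCast, ← Real.rpow_mul hx0.le, mul_comm]
      exact Real.rpow_le_rpow_of_exponent_le hx hn
    rw [Real.exp_neg, Real.rpow_neg hx0.le]
    have h3 : τ ^ n * x ^ (m + 4 : ℝ) / n.factorial ≤ Real.exp (τ * x ^ σ) := by
      refine le_trans ?_ h1
      rw [mul_pow]; gcongr
    calc _ ≤ (τ ^ n * x ^ (m + 4 : ℝ) / n.factorial)⁻¹ := by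
          gcongr
      _ = _ := by field_simp
  rw [Real.norm_of_nonneg (by positivity), Real.norm_of_nonneg (Real.exp_pos _).le]
  have h4 : x ^ (-(m + 4 : ℝ)) = x ^ (-4 : ℝ) / x ^ m := by
    rw [neg_add, Real.rpow_add hx0, Real.rpow_neg hx0.le, Real.rpow_natCast]; field_simp
  calc _ ≤ (2 * x) ^ m * (n.factorial / τ ^ n * x ^ (-(m + 4 : ℝ))) := by gcongr; linarith
    _ = _ := by rw [h4, mul_pow]; field_simp

/-- The bilinear product `k · z` of a frequency and a complex vector. -/
def dot (k : Freq) (z : C3) : ℂ := ∑ i, (k i : ℂ) * z i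

/-- A frequency as a complex vector. -/
def freqVecC (k : Freq) : C3 := WithLp.toLp 2 fun i => (k i : ℂ)

lemma freqVecC_apply (k : Freq) (i : Fin 3) : freqVecC k i = k i := rfl

lemma norm_freqVecC (k : Freq) : ‖freqVecC k‖ = freqNorm k := by
  simp [freqNorm, freqVecC, EuclideanSpace.norm_eq]

lemma inner_freqVecC (k : Freq) (z : C3) : inner ℂ (freqVecC k) z = dot k z := by
  simp [dot, freqVecC, PiLp.inner_apply, mul_comm]

lemma norm_dot_le (k : Freq) (z : C3) : ‖dot k z‖ ≤ freqNorm k * ‖z‖ := by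
  rw [← inner_freqVecC, ← norm_freqVecC]; exact norm_inner_le_norm _ _

@[simp] lemma dot_zero (k : Freq) : dot k 0 = 0 := by simp [dot]
lemma dot_add (k : Freq) (z w : C3) : dot k (z + w) = dot k z + dot k w := by
  simp [dot, mul_add, Finset.sum_add_distrib]
lemma dot_sub (k : Freq) (z w : C3) : dot k (z - w) = dot k z - dot k w := by
  simp [dot, mul_sub, Finset.sum_sub_distrib]
lemma dot_neg (k : Freq) (z : C3) : dot k (-z) = -dot k z := by
  simp [dot]
lemma dot_smul (k : Freq) (a : ℂ) (z : C3) : dot k (a • z) = a * dot k z := by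
  simp only [dot, Finset.mul_sum, PiLp.smul_apply, smul_eq_mul]
  exact Finset.sum_congr rfl fun i _ => by ring
lemma dot_sum {ι : Type*} (s : Finset ι) (k : Freq) (z : ι → C3) :
    dot k (∑ i ∈ s, z i) = ∑ i ∈ s, dot k (z i) := by
  simp_rw [← inner_freqVecC]; rw [inner_sum]
lemma sub_dot (k l : Freq) (z : C3) : dot (k - l) z = dot k z - dot l z := by
  simp [dot, sub_mul, Finset.sum_sub_distrib]
lemma neg_dot (k : Freq) (z : C3) : dot (-k) z = -dot k z := by
  simp [dot]
lemma dot_freqVecC (k : Freq) : dot k (freqVecC k) = (freqNorm k : ℂ) ^ 2 := by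
  rw [← Complex.ofReal_pow, freqNorm_sq]; simp [dot, freqVecC, pow_two]

lemma continuous_dot (k : Freq) : Continuous (dot k) := by unfold dot; fun_prop

/-! ### Gevrey weights -/

/-- The Gevrey weight `x ^ q * exp (τ x ^ σ)` of a mode of length `x`; here `σ = 1 / s`. -/
def gevW (q σ τ x : ℝ) : ℝ := x ^ q * Real.exp (τ * x ^ σ)

lemma gevW_nonneg {q σ τ x : ℝ} (hx : 0 ≤ x) : 0 ≤ gevW q σ τ x := by
  unfold gevW; positivity

lemma gevW_mono {q q' σ τ x : ℝ} (hx : 1 ≤ x) (h : q ≤ q') : gevW q σ τ x ≤ gevW q' σ τ x := by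
  unfold gevW; gcongr

lemma rpow_mul_gevW {p q σ τ x : ℝ} (hx : 0 < x) : x ^ p * gevW q σ τ x = gevW (q + p) σ τ x := by
  unfold gevW; rw [Real.rpow_add hx]; ring

lemma mul_gevW {q σ τ x : ℝ} (hx : 0 < x) : x * gevW q σ τ x = gevW (q + 1) σ τ x := by
  simpa using rpow_mul_gevW (p := 1) (q := q) (σ := σ) (τ := τ) hx

/-- Mean value estimate for the Gevrey weight. -/
lemma abs_gevW_sub_le {q σ τ x y ρ : ℝ} (hq : 1 ≤ q) (hσ0 : 0 ≤ σ) (hσ : σ ≤ 1) (hτ : 0 ≤ τ)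
    (hx : 1 ≤ x) (hy : 1 ≤ y) (hxρ : x ≤ ρ) (hyρ : y ≤ ρ) :
    |gevW q σ τ x - gevW q σ τ y| ≤
      q * ρ ^ (q - 1) * (1 + τ * ρ ^ σ) * Real.exp (τ * ρ ^ σ) * |x - y| := by
  have hd : ∀ z ∈ Icc 1 ρ, HasDerivWithinAt (gevW q σ τ)
      (q * z ^ (q - 1) * Real.exp (τ * z ^ σ)
        + z ^ q * (Real.exp (τ * z ^ σ) * (τ * (σ * z ^ (σ - 1))))) (Icc 1 ρ) z := by
    intro z hz
    have hz0 : z ≠ 0 := by linarith [hz.1]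
    have h1 := Real.hasDerivAt_rpow_const (x := z) (p := q) (Or.inl hz0)
    have h2 := ((Real.hasDerivAt_rpow_const (x := z) (p := σ) (Or.inl hz0)).const_mul τ).exp
    exact (h1.mul h2).hasDerivWithinAt
  have := Convex.norm_image_sub_le_of_norm_hasDerivWithin_le hd (C :=
    q * ρ ^ (q - 1) * (1 + τ * ρ ^ σ) * Real.exp (τ * ρ ^ σ)) ?_ (convex_Icc 1 ρ)
    (x := y) (y := x) ⟨hy, hyρ⟩ ⟨hx, hxρ⟩
  · simpa [Real.norm_eq_abs] using this
  · intro z hz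
    have hz0 : 0 < z := by linarith [hz.1]
    have e1 : z ^ q * z ^ (σ - 1) = z ^ (q - 1) * z ^ σ := by
      rw [← Real.rpow_add hz0, ← Real.rpow_add hz0]; congr 1; ring
    have e2 : q * z ^ (q - 1) * Real.exp (τ * z ^ σ)
        + z ^ q * (Real.exp (τ * z ^ σ) * (τ * (σ * z ^ (σ - 1))))
        = z ^ (q - 1) * (q + σ * (τ * z ^ σ)) * Real.exp (τ * z ^ σ) := by
      linear_combination (Real.exp (τ * z ^ σ) * τ * σ) * e1
    have hq0 : 0 ≤ q := by linarith
    rw [e2, Real.norm_of_nonneg (by positivity)]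
    have hzp : 0 ≤ τ * z ^ σ := by positivity
    calc z ^ (q - 1) * (q + σ * (τ * z ^ σ)) * Real.exp (τ * z ^ σ)
        ≤ z ^ (q - 1) * (q * (1 + τ * z ^ σ)) * Real.exp (τ * z ^ σ) := by
          gcongr; nlinarith
      _ = q * z ^ (q - 1) * (1 + τ * z ^ σ) * Real.exp (τ * z ^ σ) := by ring
      _ ≤ _ := by
          have h3 := hz.2
          have hρ0 : 0 ≤ ρ := by linarith
          gcongr

lemma exp_add_le {σ τ y z : ℝ} (hσ0 : 0 ≤ σ) (hσ : σ ≤ 1) (hτ : 0 ≤ τ) (hy : 0 ≤ y)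
    (hz : 0 ≤ z) :
    Real.exp (τ * (y + z) ^ σ) ≤ Real.exp (τ * y ^ σ) * Real.exp (τ * z ^ σ) := by
  rw [← Real.exp_add, ← mul_add]
  gcongr
  exact Real.rpow_add_le_add_rpow hy hz hσ0 hσ

lemma add_rpow_le_two_rpow {p y z : ℝ} (hp : 0 ≤ p) (hy : 0 ≤ y) (hz : 0 ≤ z) :
    (y + z) ^ p ≤ 2 ^ p * (y ^ p + z ^ p) := by
  have h1 : (y + z) ^ p ≤ (2 * max y z) ^ p := by
    gcongr; linarith [le_max_left y z, le_max_right y z]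
  rw [Real.mul_rpow zero_le_two (le_max_of_le_left hy)] at h1
  refine h1.trans ?_
  gcongr
  rcases max_cases y z with ⟨h, -⟩ | ⟨h, -⟩ <;> rw [h]
  · have : 0 ≤ z ^ p := by positivity
    linarith
  · have : 0 ≤ y ^ p := by positivity
    linarith

/-- The constant of the commutator estimate. -/
def commConst (q : ℝ) : ℝ := 2 * q * 2 ^ q

/-- Commutator estimate for the weights at the three lengths of a triad: the difference of two
weights gains one derivative, up to the loss of the fraction `σ` of a derivative with the small
factor `τ`, which is spread evenly over the three modes. -/
lemma mul_abs_gevW_sub_le {q σ τ x y z : ℝ} (hq : 1 ≤ q) (hσ0 : 0 ≤ σ) (hσ : σ ≤ 1)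
    (hτ : 0 ≤ τ) (hx : 1 ≤ x) (hy : 1 ≤ y) (hz : 1 ≤ z) (hxyz : x ≤ z + y) (hyxz : y ≤ z + x) :
    y * |gevW q σ τ x - gevW q σ τ y| ≤
      commConst q * ((1 + τ * (x ^ (σ / 2) * y ^ (σ / 2) * z ^ (σ / 2))) *
        (gevW 1 σ τ z * gevW q σ τ y + gevW q σ τ z * gevW 1 σ τ y)) := by
  have hq0 : 0 ≤ q := by linarith
  set ρ := max x y with hρ
  have hρx : x ≤ ρ := le_max_left _ _
  have hρy : y ≤ ρ := le_max_right _ _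
  have hρ1 : 1 ≤ ρ := hx.trans hρx
  have hρyz : ρ ≤ y + z := max_le (by linarith) (by linarith)
  have hρ2 : ρ ^ 2 ≤ 2 * (x * y * z) := by
    rcases max_cases x y with ⟨h, h'⟩ | ⟨h, h'⟩ <;> rw [hρ, h]
    · have : x ≤ 2 * (y * z) := by nlinarith
      nlinarith
    · have : y ≤ 2 * (x * z) := by nlinarith
      nlinarith
  have hρσ : ρ ^ σ ≤ 2 * (x ^ (σ / 2) * y ^ (σ / 2) * z ^ (σ / 2)) := by
    have e1 : ρ ^ σ = (ρ ^ 2) ^ (σ / 2) := by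
      rw [← Real.rpow_natCast, ← Real.rpow_mul (by linarith)]; congr 1; push_cast; ring
    have e2 : (2 : ℝ) ^ (σ / 2) ≤ 2 := by
      calc (2 : ℝ) ^ (σ / 2) ≤ 2 ^ (1 : ℝ) := by gcongr; exacts [one_le_two, by linarith]
        _ = 2 := by simp
    calc ρ ^ σ ≤ (2 * (x * y * z)) ^ (σ / 2) := by rw [e1]; gcongr
      _ = 2 ^ (σ / 2) * (x ^ (σ / 2) * y ^ (σ / 2) * z ^ (σ / 2)) := by
        rw [Real.mul_rpow (by norm_num) (by positivity), Real.mul_rpow (by positivity)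
          (by positivity), Real.mul_rpow (by positivity) (by positivity)]
      _ ≤ _ := by gcongr
  have h1 := abs_gevW_sub_le (q := q) (σ := σ) (τ := τ) hq hσ0 hσ hτ hx hy hρx hρy
  have hxy : |x - y| ≤ z := abs_le.mpr ⟨by linarith, by linarith⟩
  set X := x ^ (σ / 2) * y ^ (σ / 2) * z ^ (σ / 2) with hX
  have hX0 : 0 ≤ X := by positivity
  have hp : ρ ^ (q - 1) ≤ 2 ^ q * (y ^ (q - 1) + z ^ (q - 1)) := by
    calc ρ ^ (q - 1) ≤ (y + z) ^ (q - 1) := by gcongr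
      _ ≤ 2 ^ (q - 1) * (y ^ (q - 1) + z ^ (q - 1)) :=
        add_rpow_le_two_rpow (by linarith) (by linarith) (by linarith)
      _ ≤ _ := by gcongr <;> linarith
  have he : Real.exp (τ * ρ ^ σ) ≤ Real.exp (τ * y ^ σ) * Real.exp (τ * z ^ σ) := by
    refine le_trans ?_ (exp_add_le hσ0 hσ hτ (by linarith) (by linarith))
    gcongr
  have ey : y ^ q = y * y ^ (q - 1) := by
    rw [Real.rpow_sub_one (by linarith)]; field_simp
  have ez : z ^ q = z * z ^ (q - 1) := by
    rw [Real.rpow_sub_one (by linarith)]; field_simp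
  calc y * |gevW q σ τ x - gevW q σ τ y|
      ≤ y * (q * ρ ^ (q - 1) * (1 + τ * ρ ^ σ) * Real.exp (τ * ρ ^ σ) * |x - y|) := by gcongr
    _ ≤ y * (q * (2 ^ q * (y ^ (q - 1) + z ^ (q - 1))) * (1 + τ * (2 * X)) *
          (Real.exp (τ * y ^ σ) * Real.exp (τ * z ^ σ)) * z) := by gcongr
    _ ≤ y * (q * (2 ^ q * (y ^ (q - 1) + z ^ (q - 1))) * (2 * (1 + τ * X)) *
          (Real.exp (τ * y ^ σ) * Real.exp (τ * z ^ σ)) * z) := by gcongr; nlinarith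
    _ = _ := by
        unfold commConst gevW
        rw [ey, ez, Real.rpow_one, Real.rpow_one]; ring

lemma gevW_le {q σ τ x y z : ℝ} (hq : 0 ≤ q) (hσ0 : 0 ≤ σ) (hσ : σ ≤ 1) (hτ : 0 ≤ τ)
    (hx : 0 ≤ x) (hy : 0 ≤ y) (hz : 0 ≤ z) (hxyz : x ≤ z + y) :
    gevW q σ τ x ≤ 2 ^ q *
      (gevW 0 σ τ z * gevW q σ τ y + gevW q σ τ z * gevW 0 σ τ y) := by
  calc gevW q σ τ x ≤ (y + z) ^ q * Real.exp (τ * (y + z) ^ σ) := by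
        unfold gevW; rw [add_comm] at hxyz; gcongr
    _ ≤ 2 ^ q * (y ^ q + z ^ q) * (Real.exp (τ * y ^ σ) * Real.exp (τ * z ^ σ)) := by
        gcongr
        · exact add_rpow_le_two_rpow hq hy hz
        · exact exp_add_le hσ0 hσ hτ hy hz
    _ = _ := by unfold gevW; simp only [Real.rpow_zero]; ring

/-! ### Trilinear sums over triads -/

lemma sum_comp_le_sum {S : Finset Freq} {f : Freq → ℝ} (hf : ∀ k, 0 ≤ f k)
    (hS : ∀ k ∉ S, f k = 0) {φ : Freq → Freq} (hφ : Function.Injective φ) :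
    ∑ k ∈ S, f (φ k) ≤ ∑ k ∈ S, f k := by
  rw [← Finset.sum_image (f := f) (fun _ _ _ _ h => hφ h),
    ← Finset.sum_filter_of_ne (p := (· ∈ S)) (fun k _ hk => by_contra fun h => hk (hS k h))]
  exact Finset.sum_le_sum_of_subset_of_nonneg
    (fun k hk => (Finset.mem_filter.mp hk).2) fun k _ _ => hf k

lemma trilinear_le_left {S : Finset Freq} {f g h : Freq → ℝ} (hf : ∀ k, 0 ≤ f k)
    (hS : ∀ k ∉ S, f k = 0) :
    ∑ k ∈ S, ∑ l ∈ S, f (k - l) * g l * h k ≤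
      (∑ k ∈ S, f k) * √(∑ k ∈ S, g k ^ 2) * √(∑ k ∈ S, h k ^ 2) := by
  have hF : 0 ≤ ∑ k ∈ S, f k := Finset.sum_nonneg fun k _ => hf k
  rw [← Finset.sum_product']
  have h1 : ∑ p ∈ S ×ˢ S, f (p.1 - p.2) * g p.2 * h p.1 ≤
      √(∑ p ∈ S ×ˢ S, (√(f (p.1 - p.2)) * g p.2) ^ 2) *
      √(∑ p ∈ S ×ˢ S, (√(f (p.1 - p.2)) * h p.1) ^ 2) := by
    refine le_trans (le_of_eq ?_) (Real.sum_mul_le_sqrt_mul_sqrt _ _ _)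
    refine Finset.sum_congr rfl fun p _ => ?_
    linear_combination (-g p.2 * h p.1) * Real.mul_self_sqrt (hf (p.1 - p.2))
  have h2 : ∑ p ∈ S ×ˢ S, (√(f (p.1 - p.2)) * g p.2) ^ 2 ≤
      (∑ k ∈ S, f k) * ∑ k ∈ S, g k ^ 2 := by
    simp only [mul_pow, Real.sq_sqrt (hf _)]
    rw [Finset.sum_product_right, Finset.mul_sum]
    refine Finset.sum_le_sum fun l _ => ?_
    dsimp only
    rw [← Finset.sum_mul]
    refine mul_le_mul_of_nonneg_right ?_ (sq_nonneg _)
    exact sum_comp_le_sum hf hS (sub_left_injective (b := l))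
  have h3 : ∑ p ∈ S ×ˢ S, (√(f (p.1 - p.2)) * h p.1) ^ 2 ≤
      (∑ k ∈ S, f k) * ∑ k ∈ S, h k ^ 2 := by
    simp only [mul_pow, Real.sq_sqrt (hf _)]
    rw [Finset.sum_product, Finset.mul_sum]
    refine Finset.sum_le_sum fun k _ => ?_
    dsimp only
    rw [← Finset.sum_mul]
    refine mul_le_mul_of_nonneg_right ?_ (sq_nonneg _)
    exact sum_comp_le_sum hf hS (sub_right_injective (b := k))
  calc _ ≤ _ := h1
    _ ≤ √((∑ k ∈ S, f k) * ∑ k ∈ S, g k ^ 2) * √((∑ k ∈ S, f k) * ∑ k ∈ S, h k ^ 2) := by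
        gcongr
    _ = _ := by
        rw [Real.sqrt_mul hF, Real.sqrt_mul hF]
        linear_combination (√(∑ k ∈ S, g k ^ 2) * √(∑ k ∈ S, h k ^ 2)) * Real.mul_self_sqrt hF

lemma trilinear_le_right {S : Finset Freq} {f g h : Freq → ℝ} (hg : ∀ k, 0 ≤ g k)
    (hS : ∀ k ∉ S, f k = 0) :
    ∑ k ∈ S, ∑ l ∈ S, f (k - l) * g l * h k ≤
      (∑ k ∈ S, g k) * √(∑ k ∈ S, f k ^ 2) * √(∑ k ∈ S, h k ^ 2) := by
  rw [Finset.sum_comm, Finset.sum_mul, Finset.sum_mul]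
  refine Finset.sum_le_sum fun l _ => ?_
  have h1 : ∑ k ∈ S, f (k - l) * h k ≤ √(∑ k ∈ S, f k ^ 2) * √(∑ k ∈ S, h k ^ 2) := by
    refine (Real.sum_mul_le_sqrt_mul_sqrt S (fun k => f (k - l)) h).trans ?_
    refine mul_le_mul_of_nonneg_right (Real.sqrt_le_sqrt ?_) (Real.sqrt_nonneg _)
    exact sum_comp_le_sum (f := fun k => f k ^ 2) (fun _ => sq_nonneg _)
      (fun k hk => by simp [hS k hk]) (sub_left_injective (b := l))
  calc _ = g l * ∑ k ∈ S, f (k - l) * h k := by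
        rw [Finset.mul_sum]; exact Finset.sum_congr rfl fun k _ => by ring
    _ ≤ _ := by rw [mul_assoc]; gcongr; exact hg l

/-! ### Gevrey norms of trigonometric polynomials and the nonlinear estimates -/

/-- The Gevrey norm of the part of a family of Fourier coefficients with frequencies in `S`. -/
def gnorm (S : Finset Freq) (q σ τ : ℝ) (v : Freq → C3) : ℝ :=
  √(∑ k ∈ S, (gevW q σ τ (freqNorm k) * ‖v k‖) ^ 2)

lemma gnorm_nonneg (S : Finset Freq) (q σ τ : ℝ) (v : Freq → C3) : 0 ≤ gnorm S q σ τ v :=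
  Real.sqrt_nonneg _

lemma gnorm_sq (S : Finset Freq) (q σ τ : ℝ) (v : Freq → C3) :
    gnorm S q σ τ v ^ 2 = ∑ k ∈ S, (gevW q σ τ (freqNorm k) * ‖v k‖) ^ 2 :=
  Real.sq_sqrt (Finset.sum_nonneg fun _ _ => sq_nonneg _)

lemma gnorm_mono {S : Finset Freq} (h0 : (0 : Freq) ∉ S) {q q' σ τ : ℝ} (h : q ≤ q')
    (v : Freq → C3) : gnorm S q σ τ v ≤ gnorm S q' σ τ v := by
  unfold gnorm
  gcongr with k hk
  · exact mul_nonneg (gevW_nonneg (freqNorm_nonneg k)) (norm_nonneg _)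
  · exact gevW_mono (one_le_freqNorm fun h => h0 (h ▸ hk)) h

/-- The embedding constant `(∑ₖ |k|⁻⁴)^{1/2}`. -/
def embConst : ℝ := √(∑' k : Freq, freqNorm k ^ (-4 : ℝ))

lemma embConst_nonneg : 0 ≤ embConst := Real.sqrt_nonneg _

/-- Sobolev embedding: lower order weighted `ℓ¹` sums are controlled by the Gevrey norm. -/
lemma sum_gevW_le {S : Finset Freq} (h0 : (0 : Freq) ∉ S) {p q σ τ : ℝ} (hpq : p + 2 ≤ q)
    (v : Freq → C3) :
    ∑ k ∈ S, gevW p σ τ (freqNorm k) * ‖v k‖ ≤ embConst * gnorm S q σ τ v := by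
  have h1 : ∑ k ∈ S, gevW p σ τ (freqNorm k) * ‖v k‖ ≤
      ∑ k ∈ S, freqNorm k ^ (-2 : ℝ) * (gevW q σ τ (freqNorm k) * ‖v k‖) := by
    refine Finset.sum_le_sum fun k hk => ?_
    have hk1 : 1 ≤ freqNorm k := one_le_freqNorm fun h => h0 (h ▸ hk)
    rw [← mul_assoc, rpow_mul_gevW (by linarith)]
    gcongr
    exact gevW_mono hk1 (by linarith)
  refine (h1.trans (Real.sum_mul_le_sqrt_mul_sqrt _ _ _)).trans ?_
  unfold embConst gnorm
  gcongr
  have h2 : ∀ k : Freq, (freqNorm k ^ (-2 : ℝ)) ^ 2 = freqNorm k ^ (-4 : ℝ) := fun k => by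
    rw [← Real.rpow_natCast, ← Real.rpow_mul (freqNorm_nonneg k)]; norm_num
  simp_rw [h2]
  exact (summable_freqNorm_rpow (by norm_num)).sum_le_tsum S
    fun k _ => Real.rpow_nonneg (freqNorm_nonneg k) _

lemma commConst_nonneg {q : ℝ} (hq : 0 ≤ q) : 0 ≤ commConst q := by
  unfold commConst; positivity

/-- The commutator of the Gevrey weight and the transport operator `v · ∇`, tested with `w`. -/
lemma commutator_sum_le {S : Finset Freq} (h0 : (0 : Freq) ∉ S) {q σ τ : ℝ} (hq : 7 / 2 ≤ q)
    (hσ0 : 0 ≤ σ) (hσ : σ ≤ 1) (hτ : 0 ≤ τ) {v w : Freq → C3} (hv : ∀ k ∉ S, v k = 0) :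
    ∑ k ∈ S, ∑ l ∈ S, ‖v (k - l)‖ * (freqNorm l *
        |gevW q σ τ (freqNorm k) - gevW q σ τ (freqNorm l)|) * ‖w l‖ *
        (gevW q σ τ (freqNorm k) * ‖w k‖) ≤
      commConst q * embConst *
       (gnorm S q σ τ v * (gnorm S q σ τ w ^ 2 + τ * gnorm S (q + σ / 2) σ τ w ^ 2) +
        gnorm S q σ τ w * (gnorm S q σ τ v * gnorm S q σ τ w +
          τ * (gnorm S (q + σ / 2) σ τ v * gnorm S (q + σ / 2) σ τ w))) := by
  set n : Freq → ℝ := freqNorm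
  let A : ℝ → (Freq → C3) → Freq → ℝ := fun p v k => gevW p σ τ (n k) * ‖v k‖
  have hA0 : ∀ p v k, 0 ≤ A p v k := fun p v k =>
    mul_nonneg (gevW_nonneg (freqNorm_nonneg k)) (norm_nonneg _)
  have hAS : ∀ p, ∀ k ∉ S, A p v k = 0 := fun p k hk => by simp [A, hv k hk]
  have key : ∀ k ∈ S, ∀ l ∈ S, ‖v (k - l)‖ * (n l *
        |gevW q σ τ (n k) - gevW q σ τ (n l)|) * ‖w l‖ * (gevW q σ τ (n k) * ‖w k‖) ≤
      commConst q * (A (1 + σ / 2) v (k - l) * A q w l * A q w k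
        + τ * (A (1 + σ / 2) v (k - l) * A (q + σ / 2) w l * A (q + σ / 2) w k)
        + A q v (k - l) * A (1 + σ / 2) w l * A q w k
        + τ * (A (q + σ / 2) v (k - l) * A (1 + σ / 2) w l * A (q + σ / 2) w k)) := by
    intro k hk l hl
    have hc : 0 ≤ commConst q := commConst_nonneg (by linarith)
    by_cases hj : k - l ∈ S
    swap
    · rw [hv _ hj, norm_zero]
      simp only [zero_mul]
      have h1 := hA0
      refine mul_nonneg hc ?_
      have := hA0 (1 + σ / 2) v (k - l)
      have := hA0 (q + σ / 2) v (k - l)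
      have := hA0 q v (k - l)
      have := hA0 q w l
      have := hA0 (q + σ / 2) w l
      have := hA0 (1 + σ / 2) w l
      have := hA0 q w k
      have := hA0 (q + σ / 2) w k
      positivity
    have hx : 1 ≤ n k := one_le_freqNorm fun h => h0 (h ▸ hk)
    have hy : 1 ≤ n l := one_le_freqNorm fun h => h0 (h ▸ hl)
    have hz : 1 ≤ n (k - l) := one_le_freqNorm fun h => h0 (h ▸ hj)
    have h1 := mul_abs_gevW_sub_le (q := q) (σ := σ) (τ := τ) (by linarith) hσ0 hσ hτ hx hy hz
      (freqNorm_le_sub_add k l) (freqNorm_le_sub_add' k l)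
    have hx0 : 0 < n k := by linarith
    have hy0 : 0 < n l := by linarith
    have hz0 : 0 < n (k - l) := by linarith
    -- multiplication by `|j| ^ (σ/2)` raises the order of the weight by `σ/2`
    have e : ∀ (p : ℝ) (u : Freq → C3) (j : Freq), 0 < n j →
        n j ^ (σ / 2) * gevW p σ τ (n j) * ‖u j‖ = A (p + σ / 2) u j := fun p u j h => by
      simp only [A]; rw [rpow_mul_gevW h]
    have le1 : ∀ (u : Freq → C3) (j : Freq), 1 ≤ n j → A 1 u j ≤ A (1 + σ / 2) u j :=
      fun u j h => mul_le_mul_of_nonneg_right (gevW_mono h (by linarith)) (norm_nonneg _)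
    calc _ ≤ ‖v (k - l)‖ * (commConst q * ((1 + τ * (n k ^ (σ / 2) * n l ^ (σ / 2) *
            n (k - l) ^ (σ / 2))) * (gevW 1 σ τ (n (k - l)) * gevW q σ τ (n l) +
            gevW q σ τ (n (k - l)) * gevW 1 σ τ (n l)))) * ‖w l‖ *
            (gevW q σ τ (n k) * ‖w k‖) := by
          have := hA0 q w k
          gcongr
      _ = commConst q * (A 1 v (k - l) * A q w l * A q w k
          + τ * ((n (k - l) ^ (σ / 2) * gevW 1 σ τ (n (k - l)) * ‖v (k - l)‖) *
            (n l ^ (σ / 2) * gevW q σ τ (n l) * ‖w l‖) *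
            (n k ^ (σ / 2) * gevW q σ τ (n k) * ‖w k‖))
          + A q v (k - l) * A 1 w l * A q w k
          + τ * ((n (k - l) ^ (σ / 2) * gevW q σ τ (n (k - l)) * ‖v (k - l)‖) *
            (n l ^ (σ / 2) * gevW 1 σ τ (n l) * ‖w l‖) *
            (n k ^ (σ / 2) * gevW q σ τ (n k) * ‖w k‖))) := by
          simp only [A]; ring
      _ ≤ _ := by
          rw [e _ _ _ hx0, e _ _ _ hy0, e _ _ _ hz0, e _ _ _ hz0, e _ _ _ hy0]
          have a1 := le1 v _ hz
          have a2 := le1 w _ hy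
          have b1 := hA0 q w l
          have b2 := hA0 q w k
          have b3 := hA0 q v (k - l)
          gcongr
  refine (Finset.sum_le_sum fun k hk => Finset.sum_le_sum (key k hk)).trans ?_
  simp_rw [← Finset.mul_sum, Finset.sum_add_distrib, ← Finset.mul_sum]
  rw [mul_assoc (commConst q)]
  refine mul_le_mul_of_nonneg_left ?_ (commConst_nonneg (by linarith))
  have L1v := sum_gevW_le h0 (p := 1 + σ / 2) (q := q) (σ := σ) (τ := τ) (by linarith) v
  have L1w := sum_gevW_le h0 (p := 1 + σ / 2) (q := q) (σ := σ) (τ := τ) (by linarith) w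
  have t1 := trilinear_le_left (S := S) (g := A q w) (h := A q w)
    (hA0 (1 + σ / 2) v) (hAS _)
  have t2 := trilinear_le_left (S := S) (g := A (q + σ / 2) w) (h := A (q + σ / 2) w)
    (hA0 (1 + σ / 2) v) (hAS _)
  have t3 := trilinear_le_right (S := S) (f := A q v) (h := A q w)
    (hA0 (1 + σ / 2) w) (hAS _)
  have t4 := trilinear_le_right (S := S) (f := A (q + σ / 2) v) (h := A (q + σ / 2) w)
    (hA0 (1 + σ / 2) w) (hAS _)
  have hg : ∀ p u, √(∑ k ∈ S, A p u k ^ 2) = gnorm S p σ τ u := fun _ _ => rfl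
  simp only [hg] at t1 t2 t3 t4
  have g1 := gnorm_nonneg S q σ τ w
  have g2 := gnorm_nonneg S (q + σ / 2) σ τ w
  have g3 := gnorm_nonneg S q σ τ v
  have g4 := gnorm_nonneg S (q + σ / 2) σ τ v
  have t1' := t1.trans (mul_le_mul_of_nonneg_right (mul_le_mul_of_nonneg_right L1v g1) g1)
  have t2' := t2.trans (mul_le_mul_of_nonneg_right (mul_le_mul_of_nonneg_right L1v g2) g2)
  have t3' := t3.trans (mul_le_mul_of_nonneg_right (mul_le_mul_of_nonneg_right L1w g3) g1)
  have t4' := t4.trans (mul_le_mul_of_nonneg_right (mul_le_mul_of_nonneg_right L1w g4) g2)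
  have t2'' := mul_le_mul_of_nonneg_left t2' hτ
  have t4'' := mul_le_mul_of_nonneg_left t4' hτ
  refine (add_le_add (add_le_add (add_le_add t1' t2'') t3') t4'').trans (le_of_eq ?_)
  ring

/-- The stretching term `w · ∇u`, tested with `w`; it costs one derivative of `u`. -/
lemma stretching_sum_le {S : Finset Freq} (h0 : (0 : Freq) ∉ S) {q σ τ : ℝ} (hq : 7 / 2 ≤ q)
    (hσ0 : 0 ≤ σ) (hσ : σ ≤ 1) (hτ : 0 ≤ τ) {u w : Freq → C3} (hw : ∀ k ∉ S, w k = 0) :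
    ∑ k ∈ S, ∑ l ∈ S, ‖w (k - l)‖ * (freqNorm l * gevW q σ τ (freqNorm k)) * ‖u l‖ *
        (gevW q σ τ (freqNorm k) * ‖w k‖) ≤
      2 ^ q * embConst * (2 * gnorm S (q + 1) σ τ u * gnorm S q σ τ w ^ 2) := by
  set n : Freq → ℝ := freqNorm
  let A : ℝ → (Freq → C3) → Freq → ℝ := fun p v k => gevW p σ τ (n k) * ‖v k‖
  have hA0 : ∀ p v k, 0 ≤ A p v k := fun p v k =>
    mul_nonneg (gevW_nonneg (freqNorm_nonneg k)) (norm_nonneg _)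
  have hAS : ∀ p, ∀ k ∉ S, A p w k = 0 := fun p k hk => by simp [A, hw k hk]
  have key : ∀ k ∈ S, ∀ l ∈ S, ‖w (k - l)‖ * (n l * gevW q σ τ (n k)) * ‖u l‖ *
        (gevW q σ τ (n k) * ‖w k‖) ≤
      2 ^ q * (A 0 w (k - l) * A (q + 1) u l * A q w k
        + A q w (k - l) * A 1 u l * A q w k) := by
    intro k hk l hl
    have hy0 : 0 < n l := freqNorm_pos fun h => h0 (h ▸ hl)
    have h1 := gevW_le (q := q) (σ := σ) (τ := τ) (by linarith) hσ0 hσ hτ (freqNorm_nonneg k)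
      hy0.le (freqNorm_nonneg _) (freqNorm_le_sub_add k l)
    calc _ ≤ ‖w (k - l)‖ * (n l * (2 ^ q * (gevW 0 σ τ (n (k - l)) * gevW q σ τ (n l) +
            gevW q σ τ (n (k - l)) * gevW 0 σ τ (n l)))) * ‖u l‖ *
            (gevW q σ τ (n k) * ‖w k‖) := by
          have := hA0 q w k
          gcongr
      _ = 2 ^ q * (A 0 w (k - l) * ((n l * gevW q σ τ (n l)) * ‖u l‖) * A q w k
          + A q w (k - l) * ((n l * gevW 0 σ τ (n l)) * ‖u l‖) * A q w k) := by
          simp only [A]; ring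
      _ = _ := by rw [mul_gevW hy0, mul_gevW hy0, zero_add]
  refine (Finset.sum_le_sum fun k hk => Finset.sum_le_sum (key k hk)).trans ?_
  simp_rw [← Finset.mul_sum, Finset.sum_add_distrib]
  rw [mul_assoc (2 ^ q)]
  refine mul_le_mul_of_nonneg_left ?_ (by positivity)
  have L1w := sum_gevW_le h0 (p := 0) (q := q) (σ := σ) (τ := τ) (by linarith) w
  have L1u := sum_gevW_le h0 (p := 1) (q := q + 1) (σ := σ) (τ := τ) (by linarith) u
  have t1 := trilinear_le_left (S := S) (g := A (q + 1) u) (h := A q w) (hA0 0 w) (hAS _)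
  have t2 := trilinear_le_right (S := S) (f := A q w) (h := A q w) (hA0 1 u) (hAS _)
  have hg : ∀ p u, √(∑ k ∈ S, A p u k ^ 2) = gnorm S p σ τ u := fun _ _ => rfl
  simp only [hg] at t1 t2
  have g1 := gnorm_nonneg S q σ τ w
  have g2 := gnorm_nonneg S (q + 1) σ τ u
  have t1' := t1.trans (mul_le_mul_of_nonneg_right (mul_le_mul_of_nonneg_right L1w g2) g1)
  have t2' := t2.trans (mul_le_mul_of_nonneg_right (mul_le_mul_of_nonneg_right L1u g1) g1)
  refine (add_le_add t1' t2').trans (le_of_eq ?_)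
  ring

/-- The estimate behind the pressure bound: a product of two first derivatives. -/
lemma product_sum_le {S : Finset Freq} (h0 : (0 : Freq) ∉ S) {q σ τ : ℝ} (hq : 7 / 2 ≤ q)
    (hσ0 : 0 ≤ σ) (hσ : σ ≤ 1) (hτ : 0 ≤ τ) {v w : Freq → C3} (hv : ∀ k ∉ S, v k = 0) :
    √(∑ k ∈ S, (gevW (q - 1) σ τ (freqNorm k) *
        ∑ l ∈ S, freqNorm (k - l) * ‖v (k - l)‖ * (freqNorm l * ‖w l‖)) ^ 2) ≤
      2 ^ q * embConst * (2 * gnorm S q σ τ v * gnorm S q σ τ w) := by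
  set n : Freq → ℝ := freqNorm
  let A : ℝ → (Freq → C3) → Freq → ℝ := fun p v k => gevW p σ τ (n k) * ‖v k‖
  have hA0 : ∀ p v k, 0 ≤ A p v k := fun p v k =>
    mul_nonneg (gevW_nonneg (freqNorm_nonneg k)) (norm_nonneg _)
  have hAS : ∀ p, ∀ k ∉ S, A p v k = 0 := fun p k hk => by simp [A, hv k hk]
  set H : Freq → ℝ := fun k => gevW (q - 1) σ τ (n k) *
    ∑ l ∈ S, n (k - l) * ‖v (k - l)‖ * (n l * ‖w l‖) with hH
  have hH0 : ∀ k, 0 ≤ H k := fun k => mul_nonneg (gevW_nonneg (freqNorm_nonneg k))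
    (Finset.sum_nonneg fun l _ => by
      have h1 : 0 ≤ n (k - l) := freqNorm_nonneg _
      have h2 : 0 ≤ n l := freqNorm_nonneg _
      positivity)
  have key : ∀ k ∈ S, H k ^ 2 ≤ ∑ l ∈ S, 2 ^ q *
      (A 1 v (k - l) * A q w l * H k + A q v (k - l) * A 1 w l * H k) := by
    intro k hk
    have e : H k ^ 2 = ∑ l ∈ S, gevW (q - 1) σ τ (n k) *
        (n (k - l) * ‖v (k - l)‖ * (n l * ‖w l‖)) * H k := by
      rw [← Finset.sum_mul, ← Finset.mul_sum, pow_two]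
    rw [e]
    refine Finset.sum_le_sum fun l hl => ?_
    by_cases hj : k - l ∈ S
    swap
    · simp [hv _ hj, hAS _ _ hj]
    have hy0 : 0 < n l := freqNorm_pos fun h => h0 (h ▸ hl)
    have hz0 : 0 < n (k - l) := freqNorm_pos fun h => h0 (h ▸ hj)
    have h1 := gevW_le (q := q - 1) (σ := σ) (τ := τ) (by linarith) hσ0 hσ hτ (freqNorm_nonneg k)
      hy0.le (freqNorm_nonneg _) (freqNorm_le_sub_add k l)
    have h2 : (2 : ℝ) ^ (q - 1) ≤ 2 ^ q := by gcongr <;> linarith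
    have hHk := hH0 k
    have w1 : ∀ p x, 0 ≤ x → 0 ≤ gevW p σ τ x := fun p x hx => gevW_nonneg hx
    have w2 := w1 0 _ hz0.le
    have w3 := w1 (q - 1) _ hz0.le
    have w4 := w1 0 _ hy0.le
    have w5 := w1 (q - 1) _ hy0.le
    calc _ ≤ 2 ^ (q - 1) * (gevW 0 σ τ (n (k - l)) * gevW (q - 1) σ τ (n l) +
            gevW (q - 1) σ τ (n (k - l)) * gevW 0 σ τ (n l)) *
            (n (k - l) * ‖v (k - l)‖ * (n l * ‖w l‖)) * H k := by gcongr
      _ ≤ 2 ^ q * (gevW 0 σ τ (n (k - l)) * gevW (q - 1) σ τ (n l) +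
            gevW (q - 1) σ τ (n (k - l)) * gevW 0 σ τ (n l)) *
            (n (k - l) * ‖v (k - l)‖ * (n l * ‖w l‖)) * H k := by gcongr
      _ = 2 ^ q * ((n (k - l) * gevW 0 σ τ (n (k - l))) * ‖v (k - l)‖ *
            ((n l * gevW (q - 1) σ τ (n l)) * ‖w l‖) * H k
          + (n (k - l) * gevW (q - 1) σ τ (n (k - l))) * ‖v (k - l)‖ *
            ((n l * gevW 0 σ τ (n l)) * ‖w l‖) * H k) := by ring
      _ = _ := by
          rw [mul_gevW hy0, mul_gevW hy0, mul_gevW hz0, mul_gevW hz0, zero_add,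
            sub_add_cancel]
  have hsum : ∑ k ∈ S, H k ^ 2 ≤ 2 ^ q * embConst * (2 * gnorm S q σ τ v * gnorm S q σ τ w) *
      √(∑ k ∈ S, H k ^ 2) := by
    refine (Finset.sum_le_sum key).trans ?_
    simp_rw [← Finset.mul_sum, Finset.sum_add_distrib]
    rw [mul_assoc (2 ^ q), mul_assoc (2 ^ q)]
    refine mul_le_mul_of_nonneg_left ?_ (by positivity)
    have L1v := sum_gevW_le h0 (p := 1) (q := q) (σ := σ) (τ := τ) (by linarith) v
    have L1w := sum_gevW_le h0 (p := 1) (q := q) (σ := σ) (τ := τ) (by linarith) w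
    have t1 := trilinear_le_left (S := S) (g := A q w) (h := H) (hA0 1 v) (hAS _)
    have t2 := trilinear_le_right (S := S) (f := A q v) (h := H) (hA0 1 w) (hAS _)
    have hg : ∀ p u, √(∑ k ∈ S, A p u k ^ 2) = gnorm S p σ τ u := fun _ _ => rfl
    simp only [hg] at t1 t2
    have g1 := gnorm_nonneg S q σ τ w
    have g2 := gnorm_nonneg S q σ τ v
    have g3 := Real.sqrt_nonneg (∑ k ∈ S, H k ^ 2)
    have t1' := t1.trans (mul_le_mul_of_nonneg_right (mul_le_mul_of_nonneg_right L1v g1) g3)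
    have t2' := t2.trans (mul_le_mul_of_nonneg_right (mul_le_mul_of_nonneg_right L1w g2) g3)
    refine (add_le_add t1' t2').trans (le_of_eq ?_)
    ring
  have hS0 : 0 ≤ ∑ k ∈ S, H k ^ 2 := Finset.sum_nonneg fun _ _ => sq_nonneg _
  rcases (Real.sqrt_nonneg (∑ k ∈ S, H k ^ 2)).eq_or_lt with h | h
  · rw [← h]
    have := gnorm_nonneg S q σ τ w
    have := gnorm_nonneg S q σ τ v
    have := embConst_nonneg
    positivity
  · refine le_of_mul_le_mul_right ?_ h
    rwa [Real.mul_self_sqrt hS0]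

/-! ### The Galerkin system -/

/-- The Leray projection of a vector onto the orthogonal complement of the frequency `k`. For
`k = 0` it is the identity, by the convention for division by zero. -/
def leray (k : Freq) (z : C3) : C3 := z - (dot k z / (freqNorm k : ℂ) ^ 2) • freqVecC k

lemma dot_leray {k : Freq} (hk : k ≠ 0) (z : C3) : dot k (leray k z) = 0 := by
  have : (freqNorm k : ℂ) ≠ 0 := by exact_mod_cast (freqNorm_pos hk).ne'
  rw [leray, dot_sub, dot_smul, dot_freqVecC]; field_simp; ring

lemma leray_sub (k : Freq) (z w : C3) : leray k (z - w) = leray k z - leray k w := by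
  simp only [leray, dot_sub, sub_div, sub_smul]; abel

lemma norm_leray_le (k : Freq) (z : C3) : ‖leray k z‖ ≤ 2 * ‖z‖ := by
  have h : ‖(dot k z / (freqNorm k : ℂ) ^ 2) • freqVecC k‖ ≤ ‖z‖ := by
    rw [norm_smul, norm_div, norm_freqVecC, norm_pow, Complex.norm_real,
      Real.norm_of_nonneg (freqNorm_nonneg k)]
    rcases (freqNorm_nonneg k).eq_or_lt with h | h
    · rw [← h]; simp
    · rw [div_mul_eq_mul_div, div_le_iff₀ (by positivity)]
      calc ‖dot k z‖ * freqNorm k ≤ (freqNorm k * ‖z‖) * freqNorm k := by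
            gcongr; exact norm_dot_le k z
        _ = _ := by ring
  calc _ ≤ _ := norm_sub_le _ _
    _ ≤ _ := by linarith

lemma inner_leray {k : Freq} {z : C3} (hz : dot k z = 0) (y : C3) :
    inner ℂ z (leray k y) = inner ℂ z y := by
  have : inner ℂ z (freqVecC k) = 0 := by
    rw [← inner_conj_symm, inner_freqVecC, hz, map_zero]
  rw [leray, inner_sub_right, inner_smul_right, this]; simp

lemma continuous_leray (k : Freq) : Continuous (leray k) := by
  unfold leray
  have := continuous_dot k
  fun_prop

/-- The Fourier coefficient of `(v · ∇) w` at `k`, up to the factor `i`, for coefficients with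
frequencies in `S`. -/
def conv (S : Finset Freq) (v w : Freq → C3) (k : Freq) : C3 := ∑ l ∈ S, dot l (v (k - l)) • w l

/-- The right-hand side of the Galerkin system: viscosity and the projected convection term. -/
def nsRhs (ν : ℝ) (S : Finset Freq) (v : Freq → C3) (k : Freq) : C3 :=
  -(((ν * freqNorm k ^ 2 : ℝ) : ℂ) • v k) - Complex.I • leray k (conv S v v k)

/-- Fourier coefficients, supported in `S`, of a real divergence-free field. -/
structure IsField (S : Finset Freq) (v : Freq → C3) : Prop where
  supp : ∀ k ∉ S, v k = 0
  div : ∀ k, dot k (v k) = 0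
  real : ∀ k i, v (-k) i = (starRingEnd ℂ) (v k i)

/-- A solution on `[0, T]` of the Galerkin system with frequencies in `S` and datum `a`. -/
structure IsGalerkin (ν T : ℝ) (S : Finset Freq) (a : Freq → C3) (u : ℝ → Freq → C3) :
    Prop where
  field : ∀ t ∈ Icc 0 T, IsField S (u t)
  ode : ∀ t ∈ Icc 0 T, ∀ k ∈ S,
    HasDerivWithinAt (fun t' => u t' k) (nsRhs ν S (u t) k) (Icc 0 T) t
  init : ∀ k ∈ S, u 0 k = a k

lemma conj_dot {v : Freq → C3} (hv : ∀ k i, v (-k) i = (starRingEnd ℂ) (v k i)) (l k : Freq) :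
    (starRingEnd ℂ) (dot l (v k)) = dot l (v (-k)) := by
  simp [dot, hv]

/-- Transport by a real divergence-free field is skew-symmetric. -/
lemma im_transport_eq_zero (S : Finset Freq) {v : Freq → C3} (hdiv : ∀ k, dot k (v k) = 0)
    (hreal : ∀ k i, v (-k) i = (starRingEnd ℂ) (v k i)) (z : Freq → C3) :
    (∑ k ∈ S, ∑ l ∈ S, dot l (v (k - l)) * inner ℂ (z k) (z l)).im = 0 := by
  rw [← Complex.conj_eq_iff_im]
  simp only [map_sum, map_mul, inner_conj_symm, conj_dot hreal, neg_sub]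
  rw [Finset.sum_comm]
  refine Finset.sum_congr rfl fun k _ => Finset.sum_congr rfl fun l _ => ?_
  have := sub_dot k l (v (k - l))
  rw [hdiv] at this
  rw [← sub_eq_zero.mp this.symm]

/-- Only the commutator with the weights `ω` contributes to the weighted transport term. -/
lemma abs_re_transport_le (S : Finset Freq) {v : Freq → C3} (hdiv : ∀ k, dot k (v k) = 0)
    (hreal : ∀ k i, v (-k) i = (starRingEnd ℂ) (v k i)) (w : Freq → C3) (ω : Freq → ℝ)
    (hω : ∀ k, 0 ≤ ω k) :
    |∑ k ∈ S, ω k ^ 2 * (Complex.I * inner ℂ (w k) (conv S v w k)).re| ≤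
      ∑ k ∈ S, ∑ l ∈ S, ‖v (k - l)‖ * (freqNorm l * |ω k - ω l|) * ‖w l‖ *
        (ω k * ‖w k‖) := by
  set m : Freq → Freq → ℝ := fun k l => (dot l (v (k - l)) * inner ℂ (w k) (w l)).im with hm
  have h0 : ∑ k ∈ S, ∑ l ∈ S, ω k * ω l * m k l = 0 := by
    rw [← im_transport_eq_zero S hdiv hreal fun k => (ω k : ℂ) • w k]
    simp only [Complex.im_sum]
    refine Finset.sum_congr rfl fun k _ => Finset.sum_congr rfl fun l _ => ?_
    rw [inner_smul_left, inner_smul_right, Complex.conj_ofReal, hm]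
    have : dot l (v (k - l)) * ((ω k : ℂ) * ((ω l : ℂ) * inner ℂ (w k) (w l))) =
        ((ω k * ω l : ℝ) : ℂ) * (dot l (v (k - l)) * inner ℂ (w k) (w l)) := by
      push_cast; ring
    rw [this, Complex.im_ofReal_mul]
  have h1 : ∑ k ∈ S, ω k ^ 2 * (Complex.I * inner ℂ (w k) (conv S v w k)).re =
      ∑ k ∈ S, ∑ l ∈ S, -(ω k ^ 2 * m k l) := by
    refine Finset.sum_congr rfl fun k _ => ?_
    have : (Complex.I * inner ℂ (w k) (conv S v w k)).re = -(inner ℂ (w k) (conv S v w k)).im := by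
      simp
    rw [this, conv, inner_sum, Complex.im_sum, Finset.sum_neg_distrib, ← Finset.mul_sum, mul_neg]
    simp only [inner_smul_right, hm]
  have h2 : ∑ k ∈ S, ω k ^ 2 * (Complex.I * inner ℂ (w k) (conv S v w k)).re =
      ∑ k ∈ S, ∑ l ∈ S, -(ω k * (ω k - ω l) * m k l) := by
    rw [h1, ← sub_zero (∑ k ∈ S, ∑ l ∈ S, -(ω k * (ω k - ω l) * m k l)), ← h0]
    simp only [← Finset.sum_sub_distrib]
    exact Finset.sum_congr rfl fun k _ => Finset.sum_congr rfl fun l _ => by ring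
  rw [h2]
  refine (Finset.abs_sum_le_sum_abs _ _).trans (Finset.sum_le_sum fun k _ => ?_)
  refine (Finset.abs_sum_le_sum_abs _ _).trans (Finset.sum_le_sum fun l _ => ?_)
  have h3 : |m k l| ≤ freqNorm l * ‖v (k - l)‖ * (‖w k‖ * ‖w l‖) := by
    refine (Complex.abs_im_le_norm _).trans ?_
    rw [norm_mul]
    have := freqNorm_nonneg l
    gcongr
    · exact norm_dot_le _ _
    · exact norm_inner_le_norm _ _
  rw [abs_neg, abs_mul, abs_mul, abs_of_nonneg (hω k)]
  have := hω k
  calc _ ≤ ω k * |ω k - ω l| * (freqNorm l * ‖v (k - l)‖ * (‖w k‖ * ‖w l‖)) := by gcongr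
    _ = _ := by ring

/-- No cancellation is available in the stretching term. -/
lemma abs_re_stretching_le (S : Finset Freq) (u w : Freq → C3) (ω : Freq → ℝ) :
    |∑ k ∈ S, ω k ^ 2 * (Complex.I * inner ℂ (w k) (conv S w u k)).re| ≤
      ∑ k ∈ S, ∑ l ∈ S, ‖w (k - l)‖ * (freqNorm l * ω k) * ‖u l‖ * (ω k * ‖w k‖) := by
  refine (Finset.abs_sum_le_sum_abs _ _).trans (Finset.sum_le_sum fun k _ => ?_)
  have h1 : |(Complex.I * inner ℂ (w k) (conv S w u k)).re| ≤
      ∑ l ∈ S, ‖w k‖ * (freqNorm l * ‖w (k - l)‖ * ‖u l‖) := by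
    refine (Complex.abs_re_le_norm _).trans ?_
    rw [norm_mul, Complex.norm_I, one_mul]
    refine (norm_inner_le_norm _ _).trans ?_
    rw [← Finset.mul_sum]
    gcongr
    refine (norm_sum_le _ _).trans (Finset.sum_le_sum fun l _ => ?_)
    rw [norm_smul]
    gcongr
    exact norm_dot_le _ _
  rw [abs_mul, abs_of_nonneg (sq_nonneg _)]
  calc _ ≤ ω k ^ 2 * ∑ l ∈ S, ‖w k‖ * (freqNorm l * ‖w (k - l)‖ * ‖u l‖) := by gcongr
    _ = _ := by rw [Finset.mul_sum]; exact Finset.sum_congr rfl fun l _ => by ring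

lemma conv_sub_conv (S : Finset Freq) (u v : Freq → C3) (k : Freq) :
    conv S u u k - conv S v v k =
      conv S u (fun j => u j - v j) k + conv S (fun j => u j - v j) v k := by
  simp only [conv, ← Finset.sum_sub_distrib, ← Finset.sum_add_distrib, dot_sub]
  refine Finset.sum_congr rfl fun l _ => ?_
  rw [smul_sub, sub_smul]; abel

/-! ### Energy estimates -/

lemma hasDerivWithinAt_norm_sq {f : ℝ → C3} {f' : C3} {s : Set ℝ} {t : ℝ}
    (h : HasDerivWithinAt f f' s t) :
    HasDerivWithinAt (fun t => ‖f t‖ ^ 2) (2 * (inner ℂ (f t) f').re) s t := by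
  have h1 := Complex.reCLM.hasFDerivAt.comp_hasDerivWithinAt t (h.inner ℂ h)
  have h2 : (Complex.reCLM ∘ fun t => inner ℂ (f t) (f t)) = fun t => ‖f t‖ ^ 2 := by
    ext t
    simp only [Function.comp, Complex.reCLM_apply]
    exact (norm_sq_eq_re_inner (𝕜 := ℂ) (f t)).symm
  rw [h2] at h1
  refine h1.congr_deriv ?_
  rw [Complex.reCLM_apply, Complex.add_re, ← inner_conj_symm f' (f t), Complex.conj_re]
  ring

/-- The energy balance: a shrinking radius `τ' < 0` yields a dissipation of order `q + σ / 2`. -/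
lemma hasDerivWithinAt_gnorm_sq {S : Finset Freq} (h0 : (0 : Freq) ∉ S) {q σ : ℝ} {τ : ℝ → ℝ}
    {w : ℝ → Freq → C3} {w' : Freq → C3} {τ' : ℝ} {s : Set ℝ} {t : ℝ}
    (hτ : HasDerivWithinAt τ τ' s t)
    (hw : ∀ k ∈ S, HasDerivWithinAt (fun t' => w t' k) (w' k) s t) :
    HasDerivWithinAt (fun t => gnorm S q σ (τ t) (w t) ^ 2)
      (2 * τ' * gnorm S (q + σ / 2) σ (τ t) (w t) ^ 2 +
        2 * ∑ k ∈ S, gevW q σ (τ t) (freqNorm k) ^ 2 * (inner ℂ (w t k) (w' k)).re) s t := by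
  have h1 : ∀ k ∈ S, HasDerivWithinAt
      (fun t => (gevW q σ (τ t) (freqNorm k) * ‖w t k‖) ^ 2)
      (2 * τ' * (gevW (q + σ / 2) σ (τ t) (freqNorm k) * ‖w t k‖) ^ 2 +
        2 * (gevW q σ (τ t) (freqNorm k) ^ 2 * (inner ℂ (w t k) (w' k)).re)) s t := by
    intro k hk
    have hk0 : 0 < freqNorm k := freqNorm_pos fun h => h0 (h ▸ hk)
    have h2 : HasDerivWithinAt (fun t => gevW q σ (τ t) (freqNorm k))
        (freqNorm k ^ q * (Real.exp (τ t * freqNorm k ^ σ) * (τ' * freqNorm k ^ σ))) s t :=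
      ((hτ.mul_const _).exp).const_mul _
    have h3 := (h2.pow 2).mul (hasDerivWithinAt_norm_sq (hw k hk))
    have e1 : (fun t => (gevW q σ (τ t) (freqNorm k) * ‖w t k‖) ^ 2) =
        ((fun t => gevW q σ (τ t) (freqNorm k)) ^ 2) * fun t => ‖w t k‖ ^ 2 := by
      ext t; simp [mul_pow]
    rw [e1]
    refine h3.congr_deriv ?_
    have e2 : gevW (q + σ / 2) σ (τ t) (freqNorm k) ^ 2 =
        freqNorm k ^ σ * gevW q σ (τ t) (freqNorm k) ^ 2 := by
      rw [← rpow_mul_gevW hk0, mul_pow, ← Real.rpow_natCast (freqNorm k ^ (σ / 2)),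
        ← Real.rpow_mul hk0.le]
      norm_num
    rw [mul_pow, e2]
    simp only [gevW, Pi.pow_apply]
    push_cast
    ring
  have h4 := HasDerivWithinAt.fun_sum h1
  simp only [gnorm_sq]
  refine h4.congr_deriv ?_
  rw [Finset.sum_add_distrib, ← Finset.mul_sum, ← Finset.mul_sum]

lemma re_inner_nsRhs {S : Finset Freq} {ν : ℝ} {v w : Freq → C3} {k : Freq}
    (hw : dot k (w k) = 0) :
    (inner ℂ (w k) (nsRhs ν S v k)).re =
      -(ν * freqNorm k ^ 2 * (inner ℂ (w k) (v k)).re) -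
        (Complex.I * inner ℂ (w k) (conv S v v k)).re := by
  rw [nsRhs, inner_sub_right, inner_neg_right, inner_smul_right, inner_smul_right,
    inner_leray hw, Complex.sub_re, Complex.neg_re, Complex.re_ofReal_mul]

/-- The energy estimate: the loss of `σ` derivatives in the nonlinear term is compensated by the
shrinking radius as long as the Gevrey norm stays below `2 * M`. -/
theorem galerkin_gnorm_le {S : Finset Freq} (h0 : (0 : Freq) ∉ S) {q σ ν T M C₁ : ℝ}
    (hq : 7 / 2 ≤ q) (hσ0 : 0 ≤ σ) (hσ : σ ≤ 1) (hν : 0 ≤ ν) (hM : 0 < M) {τ τ' : ℝ → ℝ}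
    (hτ : ∀ t ∈ Icc 0 T, HasDerivAt τ (τ' t) t) (hτ0 : ∀ t ∈ Icc 0 T, 0 ≤ τ t)
    (hτ' : ∀ t ∈ Icc 0 T, τ' t ≤ -C₁ * τ t)
    (hC₁ : 2 * commConst q * embConst * (2 * M) ≤ C₁)
    (hT : (4 * commConst q * embConst * (2 * M) ^ 3 + 1) * T ≤ 3 * M ^ 2)
    {a : Freq → C3} {u : ℝ → Freq → C3} (hu : IsGalerkin ν T S a u)
    (ha : gnorm S q σ (τ 0) a ≤ M) :
    ∀ t ∈ Icc 0 T, gnorm S q σ (τ t) (u t) ≤ 2 * M := by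
  set c := commConst q * embConst with hc
  have hc0 : 0 ≤ c := mul_nonneg (commConst_nonneg (by linarith)) embConst_nonneg
  set D := 4 * commConst q * embConst * (2 * M) ^ 3 with hD
  have hD' : D = 4 * c * (2 * M) ^ 3 := by rw [hD, hc]; ring
  have hD0 : 0 ≤ D := by rw [hD']; positivity
  have hder := fun t (ht : t ∈ Icc 0 T) => hasDerivWithinAt_gnorm_sq h0 (q := q) (σ := σ)
    (hτ t ht).hasDerivWithinAt (hu.ode t ht)
  -- the slope `D + 1` is one more than the nonlinear term can produce, which makes the comparison
  -- with the boundary strict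
  have fence := image_le_of_deriv_right_lt_deriv_boundary
    (f := fun t => gnorm S q σ (τ t) (u t) ^ 2) (B := fun t => M ^ 2 + (D + 1) * t)
    (B' := fun _ => D + 1) (a := 0) (b := T)
    (fun t ht => (hder t ht).continuousWithinAt)
    (fun t ht => (hder t ⟨ht.1, ht.2.le⟩).mono_of_mem_nhdsWithin
      (Filter.mem_of_superset (Icc_mem_nhdsGE ht.2) (Icc_subset_Icc_left ht.1)))
    ?_ (fun t => by simpa using ((hasDerivAt_id t).const_mul (D + 1)).const_add (M ^ 2)) ?_
  · intro t ht
    have h1 : gnorm S q σ (τ t) (u t) ^ 2 ≤ M ^ 2 + (D + 1) * t := fence ht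
    have h2 : (D + 1) * t ≤ 3 * M ^ 2 := le_trans (by gcongr; exact ht.2) hT
    exact le_of_abs_le (abs_le_of_sq_le_sq (by nlinarith) (by linarith))
  · have : gnorm S q σ (τ 0) (u 0) = gnorm S q σ (τ 0) a := by
      unfold gnorm
      congr 1
      exact Finset.sum_congr rfl fun k hk => by rw [hu.init k hk]
    change gnorm S q σ (τ 0) (u 0) ^ 2 ≤ M ^ 2 + (D + 1) * 0
    rw [this, mul_zero, add_zero]
    have := gnorm_nonneg S q σ (τ 0) a
    gcongr
  · intro t ht hEB
    have htT : t ∈ Icc 0 T := ⟨ht.1, ht.2.le⟩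
    set G := gnorm S q σ (τ t) (u t) with hG
    set G' := gnorm S (q + σ / 2) σ (τ t) (u t) with hG'
    have hG0 : 0 ≤ G := gnorm_nonneg _ _ _ _ _
    have hGR : G ≤ 2 * M := by
      have h2 : (D + 1) * t ≤ 3 * M ^ 2 := le_trans (by gcongr; exact htT.2) hT
      have h1 : G ^ 2 = M ^ 2 + (D + 1) * t := hEB
      exact le_of_abs_le (abs_le_of_sq_le_sq (by nlinarith) (by linarith))
    have hfield := hu.field t htT
    have htr := (abs_re_transport_le S hfield.div hfield.real (u t)
      (fun k => gevW q σ (τ t) (freqNorm k)) (fun k => gevW_nonneg (freqNorm_nonneg k))).trans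
      (commutator_sum_le h0 hq hσ0 hσ (hτ0 t htT) (v := u t) (w := u t) hfield.supp)
    have hsum : ∑ k ∈ S, gevW q σ (τ t) (freqNorm k) ^ 2 *
        (inner ℂ (u t k) (nsRhs ν S (u t) k)).re ≤
        -∑ k ∈ S, gevW q σ (τ t) (freqNorm k) ^ 2 *
          (Complex.I * inner ℂ (u t k) (conv S (u t) (u t) k)).re := by
      rw [← Finset.sum_neg_distrib]
      refine Finset.sum_le_sum fun k _ => ?_
      rw [re_inner_nsRhs (hfield.div k)]
      have h1 : (0 : ℝ) ≤ (inner ℂ (u t k) (u t k)).re := by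
        simpa using inner_self_nonneg (𝕜 := ℂ) (x := u t k)
      have h2 : 0 ≤ gevW q σ (τ t) (freqNorm k) ^ 2 *
        (ν * freqNorm k ^ 2 * (inner ℂ (u t k) (u t k)).re) := by positivity
      linarith
    have hτt := hτ0 t htT
    have h3 := neg_abs_le (∑ k ∈ S, gevW q σ (τ t) (freqNorm k) ^ 2 *
          (Complex.I * inner ℂ (u t k) (conv S (u t) (u t) k)).re)
    rw [← hc, ← hG, ← hG'] at htr
    -- the dissipation from the shrinking radius absorbs the terms of order `q + σ / 2`
    have h4 : τ' t * G' ^ 2 + 2 * c * τ t * G * G' ^ 2 ≤ 0 := by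
      have h5 : τ' t + 2 * c * τ t * G ≤ 0 := by
        have e1 : 2 * c * τ t * G ≤ 2 * c * τ t * (2 * M) := by gcongr
        have e2 : 2 * commConst q * embConst * (2 * M) * τ t ≤ C₁ * τ t := by gcongr
        have e3 := hτ' t htT
        have e4 : 2 * commConst q * embConst * (2 * M) * τ t = 2 * c * τ t * (2 * M) := by
          rw [hc]; ring
        linarith
      nlinarith [sq_nonneg G']
    have h6 : 4 * c * G ^ 3 ≤ D := by rw [hD']; gcongr
    calc 2 * τ' t * G' ^ 2 + 2 * ∑ k ∈ S, gevW q σ (τ t) (freqNorm k) ^ 2 *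
          (inner ℂ (u t k) (nsRhs ν S (u t) k)).re
        ≤ 2 * τ' t * G' ^ 2 + 2 * (c * (G * (G ^ 2 + τ t * G' ^ 2) +
            G * (G * G + τ t * (G' * G')))) := by linarith
      _ = 2 * (τ' t * G' ^ 2 + 2 * c * τ t * G * G' ^ 2) + 4 * c * G ^ 3 := by ring
      _ < D + 1 := by linarith

/-- The growth rate in the estimate of the difference of two solutions. -/
def diffRate (q R : ℝ) : ℝ := 4 * (commConst q + 2 ^ q) * embConst * R

/-- Comparison of the Navier-Stokes and Euler approximations, with the loss of one derivative. -/
theorem galerkin_sub_gnorm_le {S : Finset Freq} (h0 : (0 : Freq) ∉ S) {q σ ν T R C₁ : ℝ}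
    (hq : 7 / 2 ≤ q) (hσ0 : 0 ≤ σ) (hσ : σ ≤ 1) (hν : 0 < ν) (hR : 0 < R) {τ τ' : ℝ → ℝ}
    (hτ : ∀ t ∈ Icc 0 T, HasDerivAt τ (τ' t) t) (hτ0 : ∀ t ∈ Icc 0 T, 0 ≤ τ t)
    (hτ' : ∀ t ∈ Icc 0 T, τ' t ≤ -C₁ * τ t)
    (hC₁ : 2 * commConst q * embConst * R ≤ C₁)
    {a : Freq → C3} {u v : ℝ → Freq → C3} (hu : IsGalerkin ν T S a u)
    (hv : IsGalerkin 0 T S a v)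
    (huR : ∀ t ∈ Icc 0 T, gnorm S (q + 1) σ (τ t) (u t) ≤ R)
    (hvR : ∀ t ∈ Icc 0 T, gnorm S (q + 1) σ (τ t) (v t) ≤ R) :
    ∀ t ∈ Icc 0 T, gnorm S q σ (τ t) (fun k => u t k - v t k) ^ 2 ≤
      ν * (R ^ 2 * Real.exp ((diffRate q R + 1) * t)) := by
  set c := commConst q * embConst with hc
  have hc0 : 0 ≤ c := mul_nonneg (commConst_nonneg (by linarith)) embConst_nonneg
  set A := diffRate q R with hA
  have hA' : A = 4 * c * R + 4 * (2 ^ q * embConst) * R := by rw [hA, hc, diffRate]; ring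
  have hder := fun t (ht : t ∈ Icc 0 T) => hasDerivWithinAt_gnorm_sq h0 (q := q) (σ := σ)
    (w := fun t k => u t k - v t k)
    (hτ t ht).hasDerivWithinAt (fun k hk => (hu.ode t ht k hk).sub (hv.ode t ht k hk))
  -- the exponential rate `A + 1` exceeds the Gronwall rate `A`, again for strictness, and the
  -- surplus also absorbs the viscous source term
  have fence := image_le_of_deriv_right_lt_deriv_boundary
    (f := fun t => gnorm S q σ (τ t) (fun k => u t k - v t k) ^ 2)
    (B := fun t => ν * (R ^ 2 * Real.exp ((A + 1) * t)))
    (B' := fun t => ν * (R ^ 2 * (Real.exp ((A + 1) * t) * (A + 1)))) (a := 0) (b := T)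
    (fun t ht => (hder t ht).continuousWithinAt)
    (fun t ht => (hder t ⟨ht.1, ht.2.le⟩).mono_of_mem_nhdsWithin
      (Filter.mem_of_superset (Icc_mem_nhdsGE ht.2) (Icc_subset_Icc_left ht.1)))
    ?_ (fun t => by
      simpa using ((((hasDerivAt_id t).const_mul (A + 1)).exp).const_mul (R ^ 2)).const_mul ν) ?_
  · exact fun t ht => fence ht
  · have : gnorm S q σ (τ 0) (fun k => u 0 k - v 0 k) = 0 := by
      unfold gnorm
      rw [Finset.sum_eq_zero fun k hk => by simp [hu.init k hk, hv.init k hk], Real.sqrt_zero]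
    change gnorm S q σ (τ 0) (fun k => u 0 k - v 0 k) ^ 2 ≤ _
    rw [this, zero_pow two_ne_zero]
    positivity
  · intro t ht hEB
    have htT : t ∈ Icc 0 T := ⟨ht.1, ht.2.le⟩
    set w : Freq → C3 := fun k => u t k - v t k with hw
    set G := gnorm S q σ (τ t) w with hG
    set G' := gnorm S (q + σ / 2) σ (τ t) w with hG'
    have hG0 : 0 ≤ G := gnorm_nonneg _ _ _ _ _
    have hGG' : G ≤ G' := gnorm_mono h0 (by linarith) _
    have hG0' : 0 ≤ G' := hG0.trans hGG'
    have fu := hu.field t htT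
    have fv := hv.field t htT
    have hwS : ∀ k ∉ S, w k = 0 := fun k hk => by simp [hw, fu.supp k hk, fv.supp k hk]
    have hwdiv : ∀ k, dot k (w k) = 0 := fun k => by
      simp [hw, dot_sub, fu.div k, fv.div k]
    have hτt := hτ0 t htT
    have htr := (abs_re_transport_le S fu.div fu.real w
      (fun k => gevW q σ (τ t) (freqNorm k)) (fun k => gevW_nonneg (freqNorm_nonneg k))).trans
      (commutator_sum_le h0 hq hσ0 hσ hτt (v := u t) (w := w) fu.supp)
    have hst := (abs_re_stretching_le S (v t) w
      (fun k => gevW q σ (τ t) (freqNorm k))).trans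
      (stretching_sum_le h0 hq hσ0 hσ hτt (u := v t) (w := w) hwS)
    set W : Freq → ℝ := fun k => gevW q σ (τ t) (freqNorm k) with hW
    -- the viscous term, by completing the square in `-⟨w, u⟩ = -|w|² - ⟨w, v⟩`
    have hvis : ∑ k ∈ S, W k ^ 2 * (-(ν * freqNorm k ^ 2 * (inner ℂ (w k) (u t k)).re)) ≤
        ν / 4 * gnorm S (q + 1) σ (τ t) (v t) ^ 2 := by
      rw [gnorm_sq, Finset.mul_sum]
      refine Finset.sum_le_sum fun k hk => ?_
      have hk0 : 0 < freqNorm k := freqNorm_pos fun h => h0 (h ▸ hk)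
      rw [← mul_gevW hk0]
      have e1 : (inner ℂ (w k) (u t k)).re = ‖w k‖ ^ 2 + (inner ℂ (w k) (v t k)).re := by
        have : u t k = w k + v t k := by simp [hw]
        rw [this, inner_add_right, Complex.add_re]
        congr 1
        exact (norm_sq_eq_re_inner (𝕜 := ℂ) (w k)).symm
      have e2 : |(inner ℂ (w k) (v t k)).re| ≤ ‖w k‖ * ‖v t k‖ :=
        (Complex.abs_re_le_norm _).trans (norm_inner_le_norm _ _)
      have e3 : -(inner ℂ (w k) (u t k)).re ≤ ‖v t k‖ ^ 2 / 4 := by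
        rw [e1]
        nlinarith [(abs_le.mp e2).1, sq_nonneg (‖w k‖ - ‖v t k‖ / 2)]
      calc W k ^ 2 * (-(ν * freqNorm k ^ 2 * (inner ℂ (w k) (u t k)).re))
          = W k ^ 2 * (ν * freqNorm k ^ 2) * (-(inner ℂ (w k) (u t k)).re) := by ring
        _ ≤ W k ^ 2 * (ν * freqNorm k ^ 2) * (‖v t k‖ ^ 2 / 4) := by gcongr
        _ = _ := by rw [hW]; ring
    have hsum : ∑ k ∈ S, W k ^ 2 *
        (inner ℂ (w k) (nsRhs ν S (u t) k - nsRhs 0 S (v t) k)).re =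
        ∑ k ∈ S, W k ^ 2 * (-(ν * freqNorm k ^ 2 * (inner ℂ (w k) (u t k)).re))
        - ∑ k ∈ S, W k ^ 2 * (Complex.I * inner ℂ (w k) (conv S (u t) w k)).re
        - ∑ k ∈ S, W k ^ 2 * (Complex.I * inner ℂ (w k) (conv S w (v t) k)).re := by
      simp only [← Finset.sum_sub_distrib]
      refine Finset.sum_congr rfl fun k _ => ?_
      rw [inner_sub_right, Complex.sub_re, re_inner_nsRhs (hwdiv k), re_inner_nsRhs (hwdiv k)]
      have e1 : (Complex.I * inner ℂ (w k) (conv S (u t) (u t) k)).re -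
          (Complex.I * inner ℂ (w k) (conv S (v t) (v t) k)).re =
          (Complex.I * inner ℂ (w k) (conv S (u t) w k)).re +
          (Complex.I * inner ℂ (w k) (conv S w (v t) k)).re := by
        rw [← Complex.sub_re, ← mul_sub, ← inner_sub_right, conv_sub_conv, inner_add_right,
          mul_add, Complex.add_re]
      linear_combination (-W k ^ 2) * e1
    have hu1 : gnorm S q σ (τ t) (u t) ≤ R :=
      (gnorm_mono h0 (by linarith) _).trans (huR t htT)
    have hu2 : gnorm S (q + σ / 2) σ (τ t) (u t) ≤ R :=
      (gnorm_mono h0 (by linarith) _).trans (huR t htT)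
    have hv1 := hvR t htT
    have hu3 := gnorm_nonneg S q σ (τ t) (u t)
    have hu4 := gnorm_nonneg S (q + σ / 2) σ (τ t) (u t)
    rw [← hc, ← hG, ← hG'] at htr
    have htr2 : c * (gnorm S q σ (τ t) (u t) * (G ^ 2 + τ t * G' ^ 2) +
        G * (gnorm S q σ (τ t) (u t) * G + τ t * (gnorm S (q + σ / 2) σ (τ t) (u t) * G'))) ≤
        c * (R * (G ^ 2 + τ t * G' ^ 2) + (R * G ^ 2 + τ t * (R * G' ^ 2))) := by
      have e1 : G * (gnorm S q σ (τ t) (u t) * G) ≤ R * G ^ 2 := by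
        calc _ ≤ G * (R * G) := by gcongr
          _ = _ := by ring
      have e2 : G * (τ t * (gnorm S (q + σ / 2) σ (τ t) (u t) * G')) ≤ τ t * (R * G' ^ 2) := by
        calc _ ≤ G' * (τ t * (R * G')) := by gcongr
          _ = _ := by ring
      rw [mul_add G]
      gcongr
    rw [← hG] at hst
    have hst2 : 2 ^ q * embConst * (2 * gnorm S (q + 1) σ (τ t) (v t) * G ^ 2) ≤
        2 ^ q * embConst * (2 * R * G ^ 2) := by
      have := embConst_nonneg
      gcongr
    have hvis2 : ν / 4 * gnorm S (q + 1) σ (τ t) (v t) ^ 2 ≤ ν / 4 * R ^ 2 := by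
      have := gnorm_nonneg S (q + 1) σ (τ t) (v t)
      gcongr
    -- the dissipation from the shrinking radius absorbs the terms of order `q + σ / 2`
    have h4 : τ' t * G' ^ 2 + 2 * c * τ t * R * G' ^ 2 ≤ 0 := by
      have h5 : τ' t + 2 * c * τ t * R ≤ 0 := by
        have e2 : 2 * commConst q * embConst * R * τ t ≤ C₁ * τ t := by gcongr
        have e3 := hτ' t htT
        have e4 : 2 * commConst q * embConst * R * τ t = 2 * c * τ t * R := by
          rw [hc]; ring
        linarith
      nlinarith [sq_nonneg G']
    have hB : G ^ 2 = ν * (R ^ 2 * Real.exp ((A + 1) * t)) := hEB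
    have hA0 : 0 ≤ A := by
      have := embConst_nonneg
      rw [hA']; positivity
    have hexp : 1 ≤ Real.exp ((A + 1) * t) := Real.one_le_exp (by have := ht.1; positivity)
    have hνR : ν * R ^ 2 ≤ G ^ 2 := by
      rw [hB]
      calc ν * R ^ 2 = ν * (R ^ 2 * 1) := by ring
        _ ≤ _ := by gcongr
    have hνR0 : 0 < ν * R ^ 2 := by positivity
    have n1 := neg_abs_le (∑ k ∈ S, W k ^ 2 * (Complex.I * inner ℂ (w k) (conv S (u t) w k)).re)
    have n2 := neg_abs_le (∑ k ∈ S, W k ^ 2 * (Complex.I * inner ℂ (w k) (conv S w (v t) k)).re)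
    change 2 * τ' t * G' ^ 2 + 2 * ∑ k ∈ S, W k ^ 2 *
        (inner ℂ (w k) (nsRhs ν S (u t) k - nsRhs 0 S (v t) k)).re < _
    rw [hsum]
    calc _ ≤ 2 * τ' t * G' ^ 2 + 2 * (ν / 4 * R ^ 2 +
            c * (R * (G ^ 2 + τ t * G' ^ 2) + (R * G ^ 2 + τ t * (R * G' ^ 2))) +
            2 ^ q * embConst * (2 * R * G ^ 2)) := by linarith
      _ = 2 * (τ' t * G' ^ 2 + 2 * c * τ t * R * G' ^ 2) + A * G ^ 2 + ν * R ^ 2 / 2 := by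
          rw [hA']; ring
      _ < (A + 1) * G ^ 2 := by linarith
      _ = _ := by rw [hB]; ring

/-! ### Solvability of the Galerkin system -/

/-- An ordinary differential equation whose solutions satisfy an a priori bound, uniformly for
nonnegative time-dependent multiples of the vector field, can be solved on any time interval. -/
theorem exists_ode_solution {E : Type*} [NormedAddCommGroup E] [NormedSpace ℝ E]
    [FiniteDimensional ℝ E] {F : E → E} (hF : ContDiff ℝ 1 F) {R T : ℝ} (hR : 0 < R)
    (hT : 0 ≤ T) (x₀ : E)
    (hbound : ∀ (c : ℝ → ℝ) (x : ℝ → E), (∀ t, 0 ≤ c t) → x 0 = x₀ →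
      (∀ t ∈ Icc 0 T, HasDerivWithinAt x (c t • F (x t)) (Icc 0 T) t) →
      ∀ t ∈ Icc 0 T, ‖x t‖ ≤ R) :
    ∃ x : ℝ → E, x 0 = x₀ ∧ ∀ t ∈ Icc 0 T, HasDerivWithinAt x (F (x t)) (Icc 0 T) t := by
  -- the vector field is cut off outside the ball of radius `R`; by the a priori bound the solution
  -- of the truncated equation never sees the cut-off
  let χ : ContDiffBump (0 : E) := ⟨R, R + 1, hR, by linarith⟩
  have hg : ContDiff ℝ 1 fun x => χ x • F x := χ.contDiff.smul hF
  have hc : HasCompactSupport fun x => χ x • F x := χ.hasCompactSupport.smul_right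
  obtain ⟨K, hK⟩ := hg.lipschitzWith_of_hasCompactSupport hc one_ne_zero
  obtain ⟨L, hL⟩ := hc.exists_bound_of_continuous hg.continuous
  have hPL : IsPicardLindelof (fun _ x => χ x • F x) (⟨0, le_refl 0, hT⟩ : Icc (0 : ℝ) T) x₀
      (L.toNNReal * T.toNNReal) 0 L.toNNReal K :=
    { lipschitzOnWith := fun _ _ => hK.lipschitzOnWith
      continuousOn := fun _ _ => continuousOn_const
      norm_le := fun _ _ x _ => (hL x).trans (Real.le_coe_toNNReal L)
      mul_max_le := by simp [hT] }
  obtain ⟨x, hx0, hx⟩ := hPL.exists_eq_forall_mem_Icc_hasDerivWithinAt₀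
  have hle := hbound (fun t => χ (x t)) x (fun t => χ.nonneg) hx0 hx
  refine ⟨x, hx0, fun t ht => ?_⟩
  have h1 : χ (x t) = 1 := χ.one_of_mem_closedBall (by simpa using hle t ht)
  have h2 := hx t ht
  rwa [h1, one_smul] at h2

/-- Componentwise complex conjugation. -/
def cj (z : C3) : C3 := WithLp.toLp 2 fun i => (starRingEnd ℂ) (z i)

@[simp] lemma cj_apply (z : C3) (i : Fin 3) : cj z i = (starRingEnd ℂ) (z i) := rfl

@[simp] lemma cj_cj (z : C3) : cj (cj z) = z := by ext i; simp
lemma cj_sub (z w : C3) : cj (z - w) = cj z - cj w := by ext i; simp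
lemma cj_neg (z : C3) : cj (-z) = -cj z := by ext i; simp
lemma cj_smul (a : ℂ) (z : C3) : cj (a • z) = (starRingEnd ℂ) a • cj z := by ext i; simp
lemma cj_freqVecC (k : Freq) : cj (freqVecC k) = freqVecC k := by
  ext i; simp [freqVecC]
lemma cj_sum {ι : Type*} (s : Finset ι) (z : ι → C3) : cj (∑ i ∈ s, z i) = ∑ i ∈ s, cj (z i) := by
  ext j; simp

lemma dot_cj (k : Freq) (z : C3) : dot k (cj z) = (starRingEnd ℂ) (dot k z) := by
  simp [dot]

lemma leray_cj (k : Freq) (z : C3) : leray k (cj z) = cj (leray k z) := by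
  simp [leray, cj_sub, cj_smul, cj_freqVecC, dot_cj]

lemma leray_neg (k : Freq) (z : C3) : leray k (-z) = -leray k z := by
  simp only [leray, dot_neg, neg_div, neg_smul]; abel

lemma leray_neg_freq (k : Freq) (z : C3) : leray (-k) z = leray k z := by
  have : freqVecC (-k) = -freqVecC k := by ext i; simp [freqVecC]
  simp [leray, neg_dot, this, neg_div]

lemma conv_neg_freq {S : Finset Freq} (hS : ∀ k ∈ S, -k ∈ S) {v : Freq → C3}
    (hv : ∀ k, v (-k) = cj (v k)) (k : Freq) : conv S v v (-k) = -cj (conv S v v k) := by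
  rw [conv, conv, cj_sum, ← Finset.sum_neg_distrib]
  refine Finset.sum_nbij' (fun l => -l) (fun l => -l) hS hS (by simp) (by simp) fun l _ => ?_
  rw [cj_smul, ← dot_cj, ← hv (k - -l), hv l, cj_cj, neg_dot, neg_smul, neg_neg]
  congr 3; abel

lemma nsRhs_neg_freq {S : Finset Freq} (hS : ∀ k ∈ S, -k ∈ S) {ν : ℝ} {v : Freq → C3}
    (hv : ∀ k, v (-k) = cj (v k)) (k : Freq) : nsRhs ν S v (-k) = cj (nsRhs ν S v k) := by
  simp only [nsRhs, freqNorm_neg, hv, leray_neg_freq, conv_neg_freq hS hv, leray_neg, leray_cj,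
    cj_sub, cj_neg, cj_smul, Complex.conj_ofReal, Complex.conj_I, smul_neg, neg_smul]

lemma dot_nsRhs {S : Finset Freq} {ν : ℝ} {v : Freq → C3} {k : Freq} (hk : k ≠ 0)
    (hv : dot k (v k) = 0) : dot k (nsRhs ν S v k) = 0 := by
  simp [nsRhs, dot_sub, dot_neg, dot_smul, hv, dot_leray hk]

/-- Extension by zero of a finite family of Fourier coefficients. -/
def extendZero (S : Finset Freq) (u : S → C3) (k : Freq) : C3 :=
  if h : k ∈ S then u ⟨k, h⟩ else 0

lemma extendZero_coe {S : Finset Freq} (u : S → C3) (k : S) : extendZero S u k = u k := by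
  simp [extendZero]

lemma extendZero_of_notMem {S : Finset Freq} (u : S → C3) {k : Freq} (hk : k ∉ S) :
    extendZero S u k = 0 := by
  simp [extendZero, hk]

/-- Fourier coefficients of real divergence-free fields, as a real vector space. -/
def fieldSpace (S : Finset Freq) : Submodule ℝ (S → C3) where
  carrier := {u | (∀ k, dot k (extendZero S u k) = 0) ∧
    ∀ k, extendZero S u (-k) = cj (extendZero S u k)}
  zero_mem' := by
    have : extendZero S 0 = 0 := by ext k; simp [extendZero]
    refine ⟨by simp [this], fun k => ?_⟩
    ext i; simp [this]
  add_mem' := by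
    intro u v hu hv
    have h : ∀ k, extendZero S (u + v) k = extendZero S u k + extendZero S v k := by
      intro k; unfold extendZero; split_ifs <;> simp
    refine ⟨fun k => by rw [h, dot_add, hu.1, hv.1, add_zero], fun k => ?_⟩
    rw [h, h, hu.2, hv.2]
    ext i; simp
  smul_mem' := by
    intro c u hu
    have h : ∀ k, extendZero S (c • u) k = (c : ℂ) • extendZero S u k := by
      intro k; unfold extendZero; split_ifs
      · ext i; simp
      · simp
    refine ⟨fun k => by rw [h, dot_smul, hu.1, mul_zero], fun k => ?_⟩
    rw [h, h, hu.2, cj_smul, Complex.conj_ofReal]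

lemma isField_extendZero {S : Finset Freq} {u : S → C3} (hu : u ∈ fieldSpace S) :
    IsField S (extendZero S u) where
  supp _ hk := extendZero_of_notMem u hk
  div := hu.1
  real k i := by rw [hu.2]; rfl

lemma nsRhs_mem_fieldSpace {S : Finset Freq} (hS : ∀ k ∈ S, -k ∈ S) (h0 : (0 : Freq) ∉ S)
    (ν : ℝ) {u : S → C3} (hu : u ∈ fieldSpace S) :
    (fun k : S => nsRhs ν S (extendZero S u) k) ∈ fieldSpace S := by
  have h1 : ∀ k ∈ S, extendZero S (fun k : S => nsRhs ν S (extendZero S u) k) k =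
      nsRhs ν S (extendZero S u) k := fun k hk => extendZero_coe _ ⟨k, hk⟩
  refine ⟨fun k => ?_, fun k => ?_⟩
  · by_cases hk : k ∈ S
    · rw [h1 k hk, dot_nsRhs (fun h => h0 (h ▸ hk)) (hu.1 k)]
    · rw [extendZero_of_notMem _ hk, dot_zero]
  · by_cases hk : k ∈ S
    · rw [h1 k hk, h1 _ (hS k hk), nsRhs_neg_freq hS hu.2]
    · have hk' : -k ∉ S := fun h => hk (by simpa using hS _ h)
      rw [extendZero_of_notMem _ hk, extendZero_of_notMem _ hk']
      ext i; simp

lemma contDiff_dot {E : Type*} [NormedAddCommGroup E] [NormedSpace ℝ E] (k : Freq) {f : E → C3}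
    (hf : ContDiff ℝ 1 f) : ContDiff ℝ 1 fun x => dot k (f x) := by
  let L : C3 →ₗ[ℝ] ℂ :=
    { toFun := dot k
      map_add' := dot_add k
      map_smul' := fun c z => by
        have : c • z = (c : ℂ) • z := by ext i; simp
        rw [this, dot_smul]; simp }
  exact (LinearMap.toContinuousLinearMap L).contDiff.comp hf

lemma contDiff_nsRhs (S : Finset Freq) (ν : ℝ) :
    ContDiff ℝ 1 fun u : S → C3 => fun k : S => nsRhs ν S (extendZero S u) k := by
  have hext : ∀ k, ContDiff ℝ 1 fun u : S → C3 => extendZero S u k := by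
    intro k
    by_cases hk : k ∈ S
    · simp only [extendZero, hk, dite_true]
      exact contDiff_apply ℝ C3 (⟨k, hk⟩ : S)
    · simp only [extendZero, hk, dite_false]
      exact contDiff_const
  have hconv : ∀ k, ContDiff ℝ 1 fun u : S → C3 => conv S (extendZero S u) (extendZero S u) k :=
    fun k => ContDiff.sum fun l _ => (contDiff_dot l (hext (k - l))).smul (hext l)
  refine contDiff_pi.mpr fun k => ?_
  unfold nsRhs leray
  refine ((hext k).const_smul _).neg.sub (ContDiff.const_smul _ ?_)
  exact (hconv k).sub (((contDiff_dot _ (hconv k)).div_const _).smul contDiff_const)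

/-- The Galerkin system has a solution on every time interval, for every datum: the `L²` norm does
not increase, as the transport term is skew-symmetric. -/
theorem exists_isGalerkin {S : Finset Freq} (hS : ∀ k ∈ S, -k ∈ S) (h0 : (0 : Freq) ∉ S)
    {ν T : ℝ} (hν : 0 ≤ ν) (hT : 0 ≤ T) {a : Freq → C3} (hdiv : ∀ k, dot k (a k) = 0)
    (hreal : ∀ k, a (-k) = cj (a k)) : ∃ u, IsGalerkin ν T S a u := by
  let V := fieldSpace S
  obtain ⟨P, hP⟩ := V.subtype.exists_leftInverse_of_injective (by simp)
  let Pc := LinearMap.toContinuousLinearMap P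
  let F : V → V := fun u => Pc fun k : S => nsRhs ν S (extendZero S u) k
  have hFcoe : ∀ u : V, (F u : S → C3) = fun k : S => nsRhs ν S (extendZero S u) k := by
    intro u
    have h1 := LinearMap.congr_fun hP ⟨_, nsRhs_mem_fieldSpace hS h0 ν u.2⟩
    exact congrArg Subtype.val h1
  have hF : ContDiff ℝ 1 F :=
    Pc.contDiff.comp ((contDiff_nsRhs S ν).comp V.subtypeL.contDiff)
  let x₀' : S → C3 := fun k => a k
  have hx₀ : x₀' ∈ V := by
    have h1 : ∀ k ∈ S, extendZero S x₀' k = a k := fun k hk => extendZero_coe _ ⟨k, hk⟩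
    refine ⟨fun k => ?_, fun k => ?_⟩
    · by_cases hk : k ∈ S
      · rw [h1 k hk, hdiv]
      · rw [extendZero_of_notMem _ hk, dot_zero]
    · by_cases hk : k ∈ S
      · rw [h1 k hk, h1 _ (hS k hk), hreal]
      · have hk' : -k ∉ S := fun h => hk (by simpa using hS _ h)
        rw [extendZero_of_notMem _ hk, extendZero_of_notMem _ hk']
        ext i; simp
  have hcomp : ∀ {x : ℝ → V} {x' : V} {s : Set ℝ} {t : ℝ}, HasDerivWithinAt x x' s t →
      ∀ k (hk : k ∈ S), HasDerivWithinAt (fun t => extendZero S (x t) k)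
        ((x' : S → C3) ⟨k, hk⟩) s t := by
    intro x x' s t h k hk
    have h1 := (V.subtypeL.hasFDerivAt.comp_hasDerivWithinAt t h)
    have h2 := hasDerivWithinAt_pi.mp h1 ⟨k, hk⟩
    simp only [extendZero, hk, dite_true]
    exact h2
  have hbound : ∀ (c : ℝ → ℝ) (x : ℝ → V), (∀ t, 0 ≤ c t) → x 0 = ⟨x₀', hx₀⟩ →
      (∀ t ∈ Icc 0 T, HasDerivWithinAt x (c t • F (x t)) (Icc 0 T) t) →
      ∀ t ∈ Icc 0 T, ‖x t‖ ≤ √(∑ k ∈ S, ‖a k‖ ^ 2) + 1 := by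
    intro c x hc hx0 hx
    have hder : ∀ t ∈ Icc 0 T, HasDerivWithinAt
        (fun t => ∑ k ∈ S, ‖extendZero S (x t) k‖ ^ 2)
        (∑ k ∈ S, 2 * (inner ℂ (extendZero S (x t) k)
          ((c t : ℂ) • nsRhs ν S (extendZero S (x t)) k)).re) (Icc 0 T) t := by
      intro t ht
      refine HasDerivWithinAt.fun_sum fun k hk => hasDerivWithinAt_norm_sq ?_
      refine (hcomp (hx t ht) k hk).congr_deriv ?_
      have : ((c t • F (x t) : V) : S → C3) = c t • (F (x t) : S → C3) := rfl
      rw [this, hFcoe]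
      ext i; simp
    have hneg : ∀ t ∈ Icc 0 T, ∑ k ∈ S, 2 * (inner ℂ (extendZero S (x t) k)
          ((c t : ℂ) • nsRhs ν S (extendZero S (x t)) k)).re ≤ 0 := by
      intro t ht
      have hf := isField_extendZero (x t).2
      set v := extendZero S (x t) with hv
      have htr := abs_re_transport_le S hf.div hf.real v (fun _ => 1) (fun _ => zero_le_one)
      simp only [sub_self, abs_zero, mul_zero, zero_mul, Finset.sum_const_zero, one_pow,
        one_mul] at htr
      have htr' := abs_nonpos_iff.mp htr
      have e : ∀ k ∈ S, 2 * (inner ℂ (v k) ((c t : ℂ) • nsRhs ν S v k)).re =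
          2 * c t * (-(ν * freqNorm k ^ 2 * ‖v k‖ ^ 2)) -
          2 * c t * (Complex.I * inner ℂ (v k) (conv S v v k)).re := by
        intro k _
        rw [inner_smul_right, Complex.re_ofReal_mul, re_inner_nsRhs (hf.div k)]
        have : (inner ℂ (v k) (v k)).re = ‖v k‖ ^ 2 :=
          (norm_sq_eq_re_inner (𝕜 := ℂ) (v k)).symm
        rw [this]; ring
      rw [Finset.sum_congr rfl e, Finset.sum_sub_distrib, ← Finset.mul_sum, ← Finset.mul_sum,
        htr', mul_zero, sub_zero]
      refine mul_nonpos_of_nonneg_of_nonpos (by have := hc t; positivity)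
        (Finset.sum_nonpos fun k _ => ?_)
      have : 0 ≤ ν * freqNorm k ^ 2 * ‖v k‖ ^ 2 := by positivity
      linarith
    intro t ht
    have hle := image_le_of_deriv_right_le_deriv_boundary
      (f := fun t => ∑ k ∈ S, ‖extendZero S (x t) k‖ ^ 2)
      (B := fun _ => ∑ k ∈ S, ‖a k‖ ^ 2) (B' := fun _ => 0)
      (fun t ht => (hder t ht).continuousWithinAt)
      (fun t ht => (hder t ⟨ht.1, ht.2.le⟩).mono_of_mem_nhdsWithin
        (Filter.mem_of_superset (Icc_mem_nhdsGE ht.2) (Icc_subset_Icc_left ht.1)))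
      (le_of_eq (Finset.sum_congr rfl fun k hk => by
        simp [hx0, extendZero, hk, x₀'])) continuousOn_const
      (fun t _ => (hasDerivAt_const t _).hasDerivWithinAt)
      (fun t ht => hneg t ⟨ht.1, ht.2.le⟩) ht
    have h1 : ‖(x t : S → C3)‖ ≤ √(∑ k ∈ S, ‖a k‖ ^ 2) := by
      refine (pi_norm_le_iff_of_nonneg (Real.sqrt_nonneg _)).mpr fun k => ?_
      refine Real.le_sqrt_of_sq_le (le_trans ?_ hle)
      rw [← extendZero_coe (x t : S → C3) k]
      exact Finset.single_le_sum (f := fun k => ‖extendZero S (x t) k‖ ^ 2)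
        (fun _ _ => sq_nonneg _) k.2
    have h2 : ‖x t‖ = ‖(x t : S → C3)‖ := rfl
    rw [h2]; linarith
  obtain ⟨x, hx0, hx⟩ := exists_ode_solution hF (R := √(∑ k ∈ S, ‖a k‖ ^ 2) + 1)
    (by positivity) hT ⟨x₀', hx₀⟩ hbound
  refine ⟨fun t => extendZero S (x t), fun t _ => isField_extendZero (x t).2,
    fun t ht k hk => ?_, fun k hk => ?_⟩
  · refine (hcomp (hx t ht) k hk).congr_deriv ?_
    rw [hFcoe]
  · simp [hx0, extendZero, hk, x₀']

/-! ### Passage to the limit in the Galerkin system -/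

open Filter Topology

/-- The nonzero frequencies all of whose components are at most `N` in absolute value. -/
def box (N : ℕ) : Finset Freq := (Finset.Icc (fun _ => -(N : ℤ)) (fun _ => (N : ℤ))).erase 0

lemma zero_notMem_box (N : ℕ) : (0 : Freq) ∉ box N := Finset.notMem_erase _ _

lemma neg_mem_box {N : ℕ} : ∀ k ∈ box N, -k ∈ box N := by
  intro k hk
  simp only [box, Finset.mem_erase, Finset.mem_Icc, Pi.le_def, Pi.neg_apply, ne_eq,
    neg_eq_zero] at hk ⊢
  exact ⟨hk.1, fun i => by linarith [hk.2.2 i], fun i => by linarith [hk.2.1 i]⟩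

lemma eventually_mem_box {k : Freq} (hk : k ≠ 0) : ∀ᶠ N in atTop, k ∈ box N := by
  filter_upwards [eventually_ge_atTop (∑ i, (k i).natAbs)] with N hN
  have h : ∀ i, (k i).natAbs ≤ N := fun i =>
    (Finset.single_le_sum (f := fun i => (k i).natAbs) (fun _ _ => Nat.zero_le _)
      (Finset.mem_univ i)).trans hN
  simp only [box, Finset.mem_erase, Finset.mem_Icc, Pi.le_def]
  exact ⟨hk, fun i => by have := h i; omega, fun i => by have := h i; omega⟩

lemma eventually_subset_box {J : Finset Freq} (hJ : (0 : Freq) ∉ J) :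
    ∀ᶠ N in atTop, J ⊆ box N := by
  have : ∀ᶠ N in atTop, ∀ k ∈ J, k ∈ box N := by
    rw [eventually_all_finset]
    exact fun k hk => eventually_mem_box fun h => hJ (h ▸ hk)
  exact this

/-- The Fourier coefficient of `(v · ∇) w` at `k`, up to the factor `i`. -/
def convInf (v w : Freq → C3) (k : Freq) : C3 := ∑' l, dot l (v (k - l)) • w l

/-- The right-hand side of the Navier-Stokes system in Fourier variables. -/
def limRhs (ν : ℝ) (v : Freq → C3) (k : Freq) : C3 :=
  -(((ν * freqNorm k ^ 2 : ℝ) : ℂ) • v k) - Complex.I • leray k (convInf v v k)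

/-- The majorant of the convolution term for coefficients bounded by `b` and `d`. -/
def convBound (b d : Freq → ℝ) (k : Freq) : ℝ := ∑' l, |b (k - l)| * |freqNorm l * d l|

lemma Rapid.freqNorm_mul {d : Freq → ℝ} (hd : Rapid d) : Rapid fun l => freqNorm l * d l := by
  refine hd.of_le 1 1 fun k => ?_
  have := freqNorm_nonneg k
  rw [norm_mul, Real.norm_of_nonneg this]
  gcongr
  linarith

lemma Rapid.convBound {b d : Freq → ℝ} (hb : Rapid b) (hd : Rapid d) : Rapid (convBound b d) :=
  hb.conv hd.freqNorm_mul

lemma convBound_nonneg (b d : Freq → ℝ) (k : Freq) : 0 ≤ convBound b d k :=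
  tsum_nonneg fun _ => by positivity

lemma summable_convBound {b d : Freq → ℝ} (hb : Rapid b) (hd : Rapid d) (k : Freq) :
    Summable fun l => |b (k - l)| * |freqNorm l * d l| :=
  summable_conv (b := fun k => |b k|) (d := fun l => |freqNorm l * d l|)
    (by simpa using hb.summable_norm) (by simpa using hd.freqNorm_mul.summable_norm) k

lemma norm_dot_smul_le {b d : Freq → ℝ} {v w : Freq → C3}
    (hv : ∀ k, ‖v k‖ ≤ b k) (hw : ∀ k, ‖w k‖ ≤ d k) (k l : Freq) :
    ‖dot l (v (k - l)) • w l‖ ≤ |b (k - l)| * |freqNorm l * d l| := by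
  have hl := freqNorm_nonneg l
  rw [norm_smul, abs_mul, abs_of_nonneg hl]
  calc ‖dot l (v (k - l))‖ * ‖w l‖ ≤ (freqNorm l * ‖v (k - l)‖) * ‖w l‖ := by
        gcongr; exact norm_dot_le _ _
    _ ≤ (freqNorm l * |b (k - l)|) * |d l| := by
        gcongr
        · exact (hv _).trans (le_abs_self _)
        · exact (hw _).trans (le_abs_self _)
    _ = _ := by ring

lemma norm_conv_le {b d : Freq → ℝ} (hb : Rapid b) (hd : Rapid d) {v w : Freq → C3}
    (hv : ∀ k, ‖v k‖ ≤ b k) (hw : ∀ k, ‖w k‖ ≤ d k) (S : Finset Freq) (k : Freq) :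
    ‖conv S v w k‖ ≤ convBound b d k :=
  (norm_sum_le _ _).trans <|
    (Finset.sum_le_sum fun l _ => norm_dot_smul_le hv hw k l).trans <|
      (summable_convBound hb hd k).sum_le_tsum S fun _ _ => by positivity

lemma norm_convInf_le {b d : Freq → ℝ} (hb : Rapid b) (hd : Rapid d) {v w : Freq → C3}
    (hv : ∀ k, ‖v k‖ ≤ b k) (hw : ∀ k, ‖w k‖ ≤ d k) (k : Freq) :
    ‖convInf v w k‖ ≤ convBound b d k :=
  tsum_of_norm_bounded (summable_convBound hb hd k).hasSum fun l => norm_dot_smul_le hv hw k l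

/-- The majorant of the time derivative of coefficients bounded by `b`. -/
def rhsBound (ν : ℝ) (b : Freq → ℝ) (k : Freq) : ℝ :=
  ν * freqNorm k ^ 2 * b k + 2 * convBound b b k

lemma rapid_rhsBound {ν : ℝ} {b : Freq → ℝ} (hb : Rapid b) : Rapid (rhsBound ν b) := by
  have h1 : Rapid fun k => ν * freqNorm k ^ 2 * b k := by
    refine hb.of_le |ν| 2 fun k => ?_
    have := freqNorm_nonneg k
    rw [norm_mul, norm_mul, norm_pow, Real.norm_of_nonneg this, Real.norm_eq_abs ν]
    gcongr
    linarith
  have h2 : Rapid fun k => 2 * convBound b b k := by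
    refine (hb.convBound hb).of_le 2 0 fun k => ?_
    rw [norm_mul]; simp
  exact h1.add h2

lemma norm_smul_sub_leray_le {ν : ℝ} (hν : 0 ≤ ν) (k : Freq) (z y : C3) :
    ‖-(((ν * freqNorm k ^ 2 : ℝ) : ℂ) • z) - Complex.I • leray k y‖ ≤
      ν * freqNorm k ^ 2 * ‖z‖ + 2 * ‖y‖ := by
  refine (norm_sub_le _ _).trans ?_
  rw [norm_neg, norm_smul, norm_smul, Complex.norm_I, one_mul, Complex.norm_real,
    Real.norm_of_nonneg (by positivity)]
  gcongr
  exact norm_leray_le _ _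

lemma norm_nsRhs_le {ν : ℝ} (hν : 0 ≤ ν) {b : Freq → ℝ} (hb : Rapid b) {v : Freq → C3}
    (hv : ∀ k, ‖v k‖ ≤ b k) (S : Finset Freq) (k : Freq) : ‖nsRhs ν S v k‖ ≤ rhsBound ν b k := by
  refine (norm_smul_sub_leray_le hν _ _ _).trans ?_
  unfold rhsBound
  gcongr
  · exact hv k
  · exact norm_conv_le hb hb hv hv S k

lemma norm_limRhs_le {ν : ℝ} (hν : 0 ≤ ν) {b : Freq → ℝ} (hb : Rapid b) {v : Freq → C3}
    (hv : ∀ k, ‖v k‖ ≤ b k) (k : Freq) : ‖limRhs ν v k‖ ≤ rhsBound ν b k := by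
  refine (norm_smul_sub_leray_le hν _ _ _).trans ?_
  unfold rhsBound
  gcongr
  · exact hv k
  · exact norm_convInf_le hb hb hv hv k

lemma norm_nsRhs_sub_le {ν : ℝ} (hν : 0 ≤ ν) {b d : Freq → ℝ} (hb : Rapid b) (hd : Rapid d)
    {v w : Freq → C3} (hv : ∀ k, ‖v k‖ ≤ b k) (hw : ∀ k, ‖w k‖ ≤ b k)
    (hvw : ∀ k, ‖v k - w k‖ ≤ d k) (S : Finset Freq) (k : Freq) :
    ‖nsRhs ν S v k - nsRhs ν S w k‖ ≤
      ν * freqNorm k ^ 2 * d k + 2 * (convBound b d k + convBound d b k) := by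
  have e : nsRhs ν S v k - nsRhs ν S w k = -(((ν * freqNorm k ^ 2 : ℝ) : ℂ) • (v k - w k)) -
      Complex.I • leray k (conv S v (fun j => v j - w j) k + conv S (fun j => v j - w j) w k) := by
    rw [← conv_sub_conv, leray_sub, smul_sub, smul_sub, nsRhs, nsRhs]; abel
  rw [e]
  refine (norm_smul_sub_leray_le hν _ _ _).trans ?_
  gcongr
  · exact hvw k
  · exact (norm_add_le _ _).trans (add_le_add (norm_conv_le hb hd hv hvw S k)
      (norm_conv_le hd hb hvw hw S k))

lemma IsGalerkin.lipschitz {ν T : ℝ} {S : Finset Freq} {a : Freq → C3} {u : ℝ → Freq → C3}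
    (hu : IsGalerkin ν T S a u) (hν : 0 ≤ ν) {b : Freq → ℝ} (hb : Rapid b)
    (hub : ∀ t ∈ Icc 0 T, ∀ k, ‖u t k‖ ≤ b k) {t t' : ℝ} (ht : t ∈ Icc 0 T) (ht' : t' ∈ Icc 0 T)
    (k : Freq) : ‖u t' k - u t k‖ ≤ rhsBound ν b k * |t' - t| := by
  by_cases hk : k ∈ S
  · exact Convex.norm_image_sub_le_of_norm_hasDerivWithin_le (fun s hs => hu.ode s hs k hk)
      (fun s hs => norm_nsRhs_le hν hb (hub s hs) S k) (convex_Icc 0 T) ht ht'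
  · rw [(hu.field t ht).supp k hk, (hu.field t' ht').supp k hk, sub_self, norm_zero]
    exact mul_nonneg ((norm_nonneg _).trans (norm_nsRhs_le hν hb (hub t ht) S k)) (abs_nonneg _)

/-- A second order Taylor bound in time which is uniform in the truncation. It passes to the limit,
and there it implies the differential equation. -/
lemma IsGalerkin.taylor {ν T : ℝ} {S : Finset Freq} {a : Freq → C3} {u : ℝ → Freq → C3}
    (hu : IsGalerkin ν T S a u) (hν : 0 ≤ ν) {b : Freq → ℝ} (hb : Rapid b)
    (hub : ∀ t ∈ Icc 0 T, ∀ k, ‖u t k‖ ≤ b k) {t t' : ℝ} (ht : t ∈ Icc 0 T) (ht' : t' ∈ Icc 0 T)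
    {k : Freq} (hk : k ∈ S) :
    ‖u t' k - u t k - (t' - t) • nsRhs ν S (u t) k‖ ≤
      (ν * freqNorm k ^ 2 * rhsBound ν b k +
        2 * (convBound b (rhsBound ν b) k + convBound (rhsBound ν b) b k)) * |t' - t| ^ 2 := by
  set d := rhsBound ν b with hd
  have hdr : Rapid d := rapid_rhsBound hb
  have hd0 : ∀ k, 0 ≤ d k := fun k =>
    (norm_nonneg _).trans (norm_nsRhs_le hν hb (hub t ht) S k)
  set A := ν * freqNorm k ^ 2 * d k + 2 * (convBound b d k + convBound d b k) with hA
  have hA0 : 0 ≤ A := by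
    have := hd0 k
    have := convBound_nonneg b d k
    have := convBound_nonneg d b k
    positivity
  have hsub : uIcc t t' ⊆ Icc 0 T := uIcc_subset_Icc ht ht'
  have hder : ∀ s ∈ uIcc t t', HasDerivWithinAt
      (fun s => u s k - s • nsRhs ν S (u t) k)
      (nsRhs ν S (u s) k - (1 : ℝ) • nsRhs ν S (u t) k) (uIcc t t') s := fun s hs =>
    ((hu.ode s (hsub hs) k hk).mono hsub).sub
      ((hasDerivWithinAt_id s _).smul_const (nsRhs ν S (u t) k))
  have hbd : ∀ s ∈ uIcc t t', ‖nsRhs ν S (u s) k - (1 : ℝ) • nsRhs ν S (u t) k‖ ≤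
      A * |t' - t| := by
    intro s hs
    rw [one_smul]
    have hst : |s - t| ≤ |t' - t| := abs_sub_left_of_mem_uIcc hs
    have hlip : ∀ j, ‖u s j - u t j‖ ≤ |s - t| * d j := fun j => by
      rw [mul_comm]; exact hu.lipschitz hν hb hub ht (hsub hs) j
    have hdr' : Rapid fun j => |s - t| * d j := hdr.of_le |s - t| 0 fun j => by
      rw [norm_mul]; simp
    have h1 := norm_nsRhs_sub_le hν hb hdr' (hub s (hsub hs)) (hub t ht) hlip S k
    have e1 : convBound b (fun j => |s - t| * d j) k = |s - t| * convBound b d k := by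
      unfold convBound
      rw [← tsum_mul_left]
      refine tsum_congr fun l => ?_
      simp only [abs_mul, abs_abs]; ring
    have e2 : convBound (fun j => |s - t| * d j) b k = |s - t| * convBound d b k := by
      unfold convBound
      rw [← tsum_mul_left]
      refine tsum_congr fun l => ?_
      simp only [abs_mul, abs_abs]; ring
    calc _ ≤ _ := h1
      _ = A * |s - t| := by rw [e1, e2, hA]; ring
      _ ≤ _ := by gcongr
  have h2 := Convex.norm_image_sub_le_of_norm_hasDerivWithin_le hder hbd (convex_uIcc t t')
    left_mem_uIcc right_mem_uIcc
  calc _ = ‖(u t' k - t' • nsRhs ν S (u t) k) - (u t k - t • nsRhs ν S (u t) k)‖ := by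
        congr 1; rw [sub_smul]; abel
    _ ≤ A * |t' - t| * ‖t' - t‖ := h2
    _ = _ := by rw [Real.norm_eq_abs]; ring

/-- The ultrafilter along which all limits are taken; it makes every bounded sequence converge. -/
def limFilter : Filter ℕ := (hyperfilter ℕ : Filter ℕ)

instance : limFilter.NeBot := inferInstanceAs (hyperfilter ℕ : Filter ℕ).NeBot

lemma limFilter_le : limFilter ≤ atTop := Nat.hyperfilter_le_atTop

lemma exists_tendsto_limFilter {x : ℕ → C3} {R : ℝ} (h : ∀ N, ‖x N‖ ≤ R) :
    ∃ y, Tendsto x limFilter (𝓝 y) := by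
  obtain ⟨y, -, hy⟩ := (isCompact_closedBall (0 : C3) R).ultrafilter_le_nhds
    ((hyperfilter ℕ).map x) (by
      rw [le_principal_iff]
      exact Filter.mem_map.mpr (Filter.mem_of_superset Filter.univ_mem fun N _ => by
        simpa using h N))
  exact ⟨y, hy⟩

lemma tendsto_conv {v w : ℕ → Freq → C3} {V W : Freq → C3} {b d : Freq → ℝ} (hb : Rapid b)
    (hd : Rapid d) (hv : ∀ N k, ‖v N k‖ ≤ b k) (hw : ∀ N k, ‖w N k‖ ≤ d k)
    (hwS : ∀ N, ∀ k ∉ box N, w N k = 0)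
    (hV : ∀ k, Tendsto (fun N => v N k) limFilter (𝓝 (V k)))
    (hW : ∀ k, Tendsto (fun N => w N k) limFilter (𝓝 (W k))) (k : Freq) :
    Tendsto (fun N => conv (box N) (v N) (w N) k) limFilter (𝓝 (convInf V W k)) := by
  have e : ∀ N, conv (box N) (v N) (w N) k = ∑' l, dot l (v N (k - l)) • w N l := fun N =>
    (tsum_eq_sum fun l hl => by rw [hwS N l hl, smul_zero]).symm
  simp only [e]
  refine tendsto_tsum_of_dominated_convergence (summable_convBound hb hd k) (fun l => ?_)
    (Eventually.of_forall fun N l => norm_dot_smul_le (hv N) (hw N) k l)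
  exact (((continuous_dot l).tendsto _).comp (hV (k - l))).smul (hW l)

/-- A solution `U` on `[0, T]`, with datum `a`, of the Navier-Stokes system in Fourier variables.
The coefficients are bounded by a rapidly decaying family `b`, uniformly in time. -/
structure IsSpectralSol (ν T : ℝ) (a : Freq → C3) (b : Freq → ℝ) (U : ℝ → Freq → C3) :
    Prop where
  rapid : Rapid b
  zero : ∀ t ∈ Icc 0 T, U t 0 = 0
  div : ∀ t ∈ Icc 0 T, ∀ k, dot k (U t k) = 0
  real : ∀ t ∈ Icc 0 T, ∀ k i, U t (-k) i = (starRingEnd ℂ) (U t k i)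
  bound : ∀ t ∈ Icc 0 T, ∀ k, ‖U t k‖ ≤ b k
  deriv : ∀ t ∈ Icc 0 T, ∀ k,
    HasDerivWithinAt (fun t' => U t' k) (limRhs ν (U t) k) (Icc 0 T) t
  init : U 0 = a

lemma hasDerivWithinAt_of_taylor {f : ℝ → C3} {f' : C3} {s : Set ℝ} {t A : ℝ}
    (h : ∀ t' ∈ s, ‖f t' - f t - (t' - t) • f'‖ ≤ A * |t' - t| ^ 2) :
    HasDerivWithinAt f f' s t := by
  rw [hasDerivWithinAt_iff_isLittleO]
  have h1 : (fun x' => f x' - f t - (x' - t) • f') =O[𝓝[s] t] fun x' => (x' - t) ^ 2 := by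
    refine Asymptotics.IsBigO.of_bound A ?_
    filter_upwards [self_mem_nhdsWithin] with t' ht'
    simpa using h t' ht'
  refine h1.trans_isLittleO ?_
  have h2 : (fun x' : ℝ => (x' - t) ^ 2) =o[𝓝 t] fun x' => x' - t := by
    simpa only [Real.norm_eq_abs, sq_abs] using
      Asymptotics.isLittleO_pow_sub_sub t (m := 2) (by norm_num)
  exact h2.mono nhdsWithin_le_nhds

/-- Limits of Galerkin solutions with uniformly rapidly decaying coefficients. -/
theorem isSpectralSol_of_tendsto {ν T : ℝ} (hν : 0 ≤ ν) (hT : 0 ≤ T) {a : Freq → C3}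
    (ha0 : a 0 = 0) {b : Freq → ℝ} (hb : Rapid b) {u : ℕ → ℝ → Freq → C3}
    (hu : ∀ N, IsGalerkin ν T (box N) a (u N))
    (hub : ∀ N, ∀ t ∈ Icc 0 T, ∀ k, ‖u N t k‖ ≤ b k) {U : ℝ → Freq → C3}
    (hU : ∀ t ∈ Icc 0 T, ∀ k, Tendsto (fun N => u N t k) limFilter (𝓝 (U t k))) :
    IsSpectralSol ν T a b U := by
  have hzero : ∀ t ∈ Icc 0 T, U t 0 = 0 := fun t ht =>
    tendsto_nhds_unique (hU t ht 0) (by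
      simp only [fun N => ((hu N).field t ht).supp 0 (zero_notMem_box N)]
      exact tendsto_const_nhds)
  have hdiv : ∀ t ∈ Icc 0 T, ∀ k, dot k (U t k) = 0 := fun t ht k =>
    tendsto_nhds_unique (((continuous_dot k).tendsto _).comp (hU t ht k)) (by
      simp only [Function.comp_def, fun N => ((hu N).field t ht).div k]
      exact tendsto_const_nhds)
  refine ⟨hb, hzero, hdiv, fun t ht k i => ?_, fun t ht k => ?_, fun t ht k => ?_, ?_⟩
  · have hc : ∀ (k : Freq), Tendsto (fun N => u N t k i) limFilter (𝓝 (U t k i)) := fun k =>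
      (((EuclideanSpace.proj i : C3 →L[ℂ] ℂ).continuous.tendsto _).comp (hU t ht k))
    refine tendsto_nhds_unique (hc (-k)) ?_
    simp only [fun N => ((hu N).field t ht).real k i]
    exact (Complex.continuous_conj.tendsto _).comp (hc k)
  · exact le_of_tendsto ((continuous_norm.tendsto _).comp (hU t ht k))
      (Eventually.of_forall fun N => hub N t ht k)
  · rcases eq_or_ne k 0 with rfl | hk
    · -- the mean value is conserved because the velocity is divergence-free
      have h1 : limRhs ν (U t) 0 = 0 := by
        have h2 : convInf (U t) (U t) 0 = 0 := by
          have h3 : ∀ l, dot l (U t (0 - l)) = 0 := fun l => by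
            have := hdiv t ht (-l)
            rwa [neg_dot, neg_eq_zero, ← zero_sub l] at this
          simp only [convInf, h3, zero_smul, tsum_zero]
        simp [limRhs, hzero t ht, h2, leray]
      rw [h1]
      exact (hasDerivWithinAt_const t (Icc 0 T) (0 : C3)).congr (fun s hs => hzero s hs)
        (hzero t ht)
    · refine hasDerivWithinAt_of_taylor (A := ν * freqNorm k ^ 2 * rhsBound ν b k +
        2 * (convBound b (rhsBound ν b) k + convBound (rhsBound ν b) b k)) fun t' ht' => ?_
      have hrhs : Tendsto (fun N => nsRhs ν (box N) (u N t) k) limFilter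
          (𝓝 (limRhs ν (U t) k)) := by
        have hc := tendsto_conv hb hb (fun N => hub N t ht) (fun N => hub N t ht)
          (fun N => ((hu N).field t ht).supp) (hU t ht) (hU t ht) k
        exact (((hU t ht k).const_smul _).neg).sub
          ((((continuous_leray k).tendsto _).comp hc).const_smul _)
      refine le_of_tendsto ((continuous_norm.tendsto _).comp
        (((hU t' ht' k).sub (hU t ht k)).sub (hrhs.const_smul (t' - t)))) ?_
      filter_upwards [limFilter_le (eventually_mem_box hk)] with N hN
      exact (hu N).taylor hν hb (hub N) ht ht' hN
  · ext1 k
    rcases eq_or_ne k 0 with rfl | hk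
    · rw [hzero 0 ⟨le_rfl, hT⟩, ha0]
    · refine tendsto_nhds_unique (hU 0 ⟨le_rfl, hT⟩ k) ?_
      refine tendsto_const_nhds.congr' ?_
      filter_upwards [limFilter_le (eventually_mem_box hk)] with N hN
      exact ((hu N).init k hN).symm

/-- The Fourier coefficient of the pressure, in terms of that of the convection term. It vanishes
at `k = 0`, by the convention for division by zero, which makes the pressure mean-free. -/
def pres (k : Freq) (z : C3) : ℂ := -(dot k z / (freqNorm k : ℂ) ^ 2)

lemma leray_eq_add_pres (k : Freq) (z : C3) : leray k z = z + pres k z • freqVecC k := by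
  rw [leray, pres, neg_smul, sub_eq_add_neg]

lemma pres_add (k : Freq) (z w : C3) : pres k (z + w) = pres k z + pres k w := by
  simp only [pres, dot_add]; ring

lemma pres_sub (k : Freq) (z w : C3) : pres k (z - w) = pres k z - pres k w := by
  simp only [pres, dot_sub]; ring

lemma continuous_pres (k : Freq) : Continuous (pres k) := by
  unfold pres
  have := continuous_dot k
  fun_prop

/-- The pressure is one derivative smoother than the velocity: for divergence-free fields its source
`∇ · ((v · ∇) w)` is a sum of products of first derivatives, without second ones. -/
lemma pres_conv_le {S : Finset Freq} (h0 : (0 : Freq) ∉ S) {q σ τ : ℝ} (hq : 7 / 2 ≤ q)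
    (hσ0 : 0 ≤ σ) (hσ : σ ≤ 1) (hτ : 0 ≤ τ) {v w : Freq → C3} (hv : ∀ k ∉ S, v k = 0)
    (hw : ∀ k, dot k (w k) = 0) :
    √(∑ k ∈ S, (gevW (q + 1) σ τ (freqNorm k) * ‖pres k (conv S v w k)‖) ^ 2) ≤
      2 ^ q * embConst * (2 * gnorm S q σ τ v * gnorm S q σ τ w) := by
  refine le_trans (Real.sqrt_le_sqrt (Finset.sum_le_sum fun k hk => ?_))
    (product_sum_le h0 hq hσ0 hσ hτ hv)
  have hk0 : 0 < freqNorm k := freqNorm_pos fun h => h0 (h ▸ hk)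
  have h1 : ‖dot k (conv S v w k)‖ ≤
      ∑ l ∈ S, freqNorm (k - l) * ‖v (k - l)‖ * (freqNorm l * ‖w l‖) := by
    rw [conv, dot_sum]
    refine (norm_sum_le _ _).trans (Finset.sum_le_sum fun l _ => ?_)
    have h2 : dot k (w l) = dot (k - l) (w l) := by rw [sub_dot, hw l, sub_zero]
    rw [dot_smul, norm_mul, h2]
    have := freqNorm_nonneg l
    calc _ ≤ (freqNorm l * ‖v (k - l)‖) * (freqNorm (k - l) * ‖w l‖) := by
          gcongr <;> exact norm_dot_le _ _
      _ = _ := by ring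
  have h3 : ‖pres k (conv S v w k)‖ = ‖dot k (conv S v w k)‖ / freqNorm k ^ 2 := by
    rw [pres, norm_neg, norm_div, norm_pow, Complex.norm_real, Real.norm_of_nonneg hk0.le]
  have h4 : gevW (q + 1) σ τ (freqNorm k) = gevW (q - 1) σ τ (freqNorm k) * freqNorm k ^ 2 := by
    have : q + 1 = (q - 1) + (2 : ℝ) := by ring
    rw [this, ← rpow_mul_gevW hk0, mul_comm]
    norm_num
  have h5 : 0 ≤ gevW (q - 1) σ τ (freqNorm k) := gevW_nonneg hk0.le
  have h6 : gevW (q + 1) σ τ (freqNorm k) * ‖pres k (conv S v w k)‖ =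
      gevW (q - 1) σ τ (freqNorm k) * ‖dot k (conv S v w k)‖ := by
    rw [h3, h4]; field_simp
  rw [h6]
  gcongr

/-- Weighted sums of squares over finite sets pass to the limit. -/
lemma sum_sq_le_of_tendsto {F : Type*} [NormedAddCommGroup F] {x : ℕ → Freq → F} {X : Freq → F}
    {ω : Freq → ℝ} (hω : ω 0 = 0) {B : ℝ}
    (hX : ∀ k ≠ 0, Tendsto (fun N => x N k) limFilter (𝓝 (X k)))
    (h : ∀ N, ∑ k ∈ box N, (ω k * ‖x N k‖) ^ 2 ≤ B) (J : Finset Freq) :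
    ∑ k ∈ J, (ω k * ‖X k‖) ^ 2 ≤ B := by
  have h1 : ∑ k ∈ J, (ω k * ‖X k‖) ^ 2 = ∑ k ∈ J.erase 0, (ω k * ‖X k‖) ^ 2 := by
    refine (Finset.sum_subset (Finset.erase_subset _ _) fun k hk hk' => ?_).symm
    have : k = 0 := by simpa [hk] using hk'
    simp [this, hω]
  rw [h1]
  refine le_of_tendsto (f := fun N => ∑ k ∈ J.erase 0, (ω k * ‖x N k‖) ^ 2) (x := limFilter)
    (tendsto_finsetSum _ fun k hk => ?_) ?_
  · exact (((continuous_norm.tendsto _).comp (hX k (Finset.ne_of_mem_erase hk))).const_mul _).pow 2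
  · filter_upwards [limFilter_le (eventually_subset_box (Finset.notMem_erase 0 J))] with N hN
    exact (Finset.sum_le_sum_of_subset_of_nonneg hN fun _ _ _ => sq_nonneg _).trans (h N)

/-! ### The Gevrey radius and solutions in Fourier variables -/

/-- The radius of Gevrey regularity, the solution of `τ' = -C₁ τ - C₂ τ²` with value `τ₀` at time
zero. -/
def gevRadius (C₁ C₂ τ₀ t : ℝ) : ℝ :=
  1 / (Real.exp (C₁ * t) * (1 / τ₀) + C₂ / C₁ * (Real.exp (C₁ * t) - 1))

section Radius
variable {C₁ C₂ τ₀ t : ℝ}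

lemma gevRadius_denom_pos (h1 : 0 < C₁) (h2 : 0 < C₂) (h0 : 0 < τ₀) (ht : 0 ≤ t) :
    0 < Real.exp (C₁ * t) * (1 / τ₀) + C₂ / C₁ * (Real.exp (C₁ * t) - 1) := by
  have : 0 ≤ Real.exp (C₁ * t) - 1 := sub_nonneg.mpr (Real.one_le_exp (by positivity))
  positivity

lemma gevRadius_pos (h1 : 0 < C₁) (h2 : 0 < C₂) (h0 : 0 < τ₀) (ht : 0 ≤ t) :
    0 < gevRadius C₁ C₂ τ₀ t :=
  one_div_pos.mpr (gevRadius_denom_pos h1 h2 h0 ht)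

lemma gevRadius_zero : gevRadius C₁ C₂ τ₀ 0 = τ₀ := by simp [gevRadius]

lemma hasDerivAt_gevRadius (h1 : 0 < C₁) (h2 : 0 < C₂) (h0 : 0 < τ₀) (ht : 0 ≤ t) :
    HasDerivAt (gevRadius C₁ C₂ τ₀)
      (-C₁ * gevRadius C₁ C₂ τ₀ t - C₂ * gevRadius C₁ C₂ τ₀ t ^ 2) t := by
  have hd := gevRadius_denom_pos h1 h2 h0 ht
  have he : HasDerivAt (fun t => Real.exp (C₁ * t)) (Real.exp (C₁ * t) * (C₁ * 1)) t :=
    ((hasDerivAt_id t).const_mul C₁).exp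
  have hD := (he.mul_const (1 / τ₀)).add ((he.sub_const 1).const_mul (C₂ / C₁))
  have := hD.inv hd.ne'
  have e : gevRadius C₁ C₂ τ₀ = ((fun t => Real.exp (C₁ * t) * (1 / τ₀)) +
      fun t => C₂ / C₁ * (Real.exp (C₁ * t) - 1))⁻¹ := by
    ext t; simp [gevRadius]
  rw [e]
  refine this.congr_deriv ?_
  simp only [Pi.add_apply, Pi.inv_apply]
  field_simp
  ring

lemma gevRadius_strictAntiOn (h1 : 0 < C₁) (h2 : 0 < C₂) (h0 : 0 < τ₀) (T : ℝ) :
    StrictAntiOn (gevRadius C₁ C₂ τ₀) (Icc 0 T) := by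
  intro x hx y hy hxy
  have he : Real.exp (C₁ * x) < Real.exp (C₁ * y) := by gcongr
  refine one_div_lt_one_div_of_lt (gevRadius_denom_pos h1 h2 h0 hx.1) ?_
  gcongr

end Radius

lemma gnorm_le_of_sum_le {S : Finset Freq} {q σ τ M : ℝ} (hM : 0 ≤ M) {v : Freq → C3}
    (h : ∑ k ∈ S, (gevW q σ τ (freqNorm k) * ‖v k‖) ^ 2 ≤ M ^ 2) : gnorm S q σ τ v ≤ M :=
  (Real.sqrt_le_sqrt h).trans_eq (Real.sqrt_sq hM)

/-- A bounded Gevrey norm forces exponential decay of the coefficients. -/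
lemma norm_le_of_gnorm_le {S : Finset Freq} (h0 : (0 : Freq) ∉ S) {q σ τ τ₁ R : ℝ} (hq : 0 ≤ q)
    (hτ : τ₁ ≤ τ) (hR : 0 ≤ R) {v : Freq → C3} (hv : ∀ k ∉ S, v k = 0)
    (h : gnorm S q σ τ v ≤ R) (k : Freq) : ‖v k‖ ≤ R * Real.exp (-(τ₁ * freqNorm k ^ σ)) := by
  by_cases hk : k ∈ S
  · have hk1 : 1 ≤ freqNorm k := one_le_freqNorm fun h => h0 (h ▸ hk)
    have h1 : (gevW q σ τ (freqNorm k) * ‖v k‖) ^ 2 ≤ R ^ 2 := by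
      calc _ ≤ gnorm S q σ τ v ^ 2 := by
            rw [gnorm_sq]
            exact Finset.single_le_sum
              (f := fun k => (gevW q σ τ (freqNorm k) * ‖v k‖) ^ 2)
              (fun _ _ => sq_nonneg _) hk
        _ ≤ _ := by
            have := gnorm_nonneg S q σ τ v
            gcongr
    have h2 : gevW q σ τ (freqNorm k) * ‖v k‖ ≤ R := le_of_abs_le (abs_le_of_sq_le_sq h1 hR)
    have h3 : Real.exp (τ₁ * freqNorm k ^ σ) * ‖v k‖ ≤ R := by
      refine le_trans ?_ h2
      gcongr
      have hn := freqNorm_nonneg k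
      calc Real.exp (τ₁ * freqNorm k ^ σ) ≤ 1 * Real.exp (τ * freqNorm k ^ σ) := by
            rw [one_mul]; gcongr
        _ ≤ _ := by
            unfold gevW
            gcongr
            exact Real.one_le_rpow hk1 hq
    rw [Real.exp_neg, ← div_eq_mul_inv, le_div_iff₀ (Real.exp_pos _), mul_comm]
    exact h3
  · rw [hv k hk, norm_zero]; positivity

lemma gevW_zero {q σ τ : ℝ} (hq : q ≠ 0) : gevW q σ τ (freqNorm 0) = 0 := by
  simp [gevW, Real.zero_rpow hq]

/-- Solutions in Fourier variables, uniformly in the viscosity, with the Gevrey bounds and the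
rate of convergence. The family `U` is indexed by the viscosity first and by time second. -/
theorem exists_spectral_solutions {r σ τ₀ M : ℝ} (hr : 9 / 2 < r) (hσ0 : 0 < σ) (hσ : σ ≤ 1)
    (hτ₀ : 0 < τ₀) (hM : 0 < M) {a : Freq → C3} (ha0 : a 0 = 0) (hdiv : ∀ k, dot k (a k) = 0)
    (hreal : ∀ k, a (-k) = cj (a k))
    (haM : ∀ J : Finset Freq, ∑ k ∈ J, (gevW r σ τ₀ (freqNorm k) * ‖a k‖) ^ 2 ≤ M ^ 2) :
    ∃ C₁ T : ℝ, 0 < C₁ ∧ 0 < T ∧ ∃ (b : Freq → ℝ) (U : ℝ → ℝ → Freq → C3) (R R' C : ℝ),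
      (∀ ν, 0 ≤ ν → IsSpectralSol ν T a b (U ν)) ∧
      (∀ ν, 0 ≤ ν → ∀ t ∈ Icc 0 T, ∀ J : Finset Freq,
        ∑ k ∈ J, (gevW r σ (gevRadius C₁ 1 τ₀ t) (freqNorm k) * ‖U ν t k‖) ^ 2 ≤ R ^ 2) ∧
      (∀ ν, 0 ≤ ν → ∀ t ∈ Icc 0 T, ∀ J : Finset Freq,
        ∑ k ∈ J, (gevW (r + 1) σ (gevRadius C₁ 1 τ₀ t) (freqNorm k) *
          ‖pres k (convInf (U ν t) (U ν t) k)‖) ^ 2 ≤ R' ^ 2) ∧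
      (∀ ν, 0 < ν → ∀ t ∈ Icc 0 T, ∀ J : Finset Freq,
        ∑ k ∈ J, (gevW (r - 1) σ (gevRadius C₁ 1 τ₀ t) (freqNorm k) *
          ‖U ν t k - U 0 t k‖) ^ 2 ≤ (C * √ν) ^ 2) ∧
      (∀ ν, 0 < ν → ∀ t ∈ Icc 0 T, ∀ J : Finset Freq,
        ∑ k ∈ J, (gevW r σ (gevRadius C₁ 1 τ₀ t) (freqNorm k) *
          ‖pres k (convInf (U ν t) (U ν t) k) - pres k (convInf (U 0 t) (U 0 t) k)‖) ^ 2 ≤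
          (2 ^ (r - 1) * embConst * (8 * M) * (C * √ν)) ^ 2) := by
  have hcr : 0 ≤ commConst r := commConst_nonneg (by linarith)
  have hcq : 0 ≤ commConst (r - 1) := commConst_nonneg (by linarith)
  have hK := embConst_nonneg
  -- `C₁` is large enough to absorb the loss of derivatives in both energy estimates
  set C₁ := 2 * (commConst r + commConst (r - 1)) * embConst * (2 * M) + 1 with hC₁
  have hC₁0 : 0 < C₁ := by positivity
  have hC₁r : 2 * commConst r * embConst * (2 * M) ≤ C₁ := by
    have : 0 ≤ 2 * commConst (r - 1) * embConst * (2 * M) := by positivity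
    rw [hC₁]; linarith
  have hC₁q : 2 * commConst (r - 1) * embConst * (2 * M) ≤ C₁ := by
    have : 0 ≤ 2 * commConst r * embConst * (2 * M) := by positivity
    rw [hC₁]; linarith
  have hD : 0 < 4 * commConst r * embConst * (2 * M) ^ 3 + 1 := by positivity
  set T := 3 * M ^ 2 / (4 * commConst r * embConst * (2 * M) ^ 3 + 1) with hTdef
  have hT : 0 < T := by positivity
  have hT' : (4 * commConst r * embConst * (2 * M) ^ 3 + 1) * T ≤ 3 * M ^ 2 := by
    rw [hTdef]; exact le_of_eq (by field_simp)
  set τ := gevRadius C₁ 1 τ₀ with hτ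
  have hτpos : ∀ t ∈ Icc 0 T, 0 < τ t := fun t ht => gevRadius_pos hC₁0 one_pos hτ₀ ht.1
  have hτder := fun t (ht : t ∈ Icc 0 T) => hasDerivAt_gevRadius hC₁0 one_pos hτ₀ ht.1
  have hτ' : ∀ t ∈ Icc 0 T, -C₁ * τ t - 1 * τ t ^ 2 ≤ -C₁ * τ t := fun t _ => by
    nlinarith [sq_nonneg (τ t)]
  -- the Galerkin solutions for all viscosities `ν ≥ 0` and all truncations `N`
  choose u hu using fun (ν : {ν : ℝ // 0 ≤ ν}) (N : ℕ) =>
    exists_isGalerkin neg_mem_box (zero_notMem_box N) ν.2 hT.le hdiv hreal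
  have hbd : ∀ ν N, ∀ t ∈ Icc 0 T, gnorm (box N) r σ (τ t) (u ν N t) ≤ 2 * M := fun ν N =>
    galerkin_gnorm_le (zero_notMem_box N) (by linarith) hσ0.le hσ ν.2 hM hτder
      (fun t ht => (hτpos t ht).le) hτ' hC₁r hT' (hu ν N)
      (by rw [gevRadius_zero]; exact gnorm_le_of_sum_le hM.le (haM _))
  set b : Freq → ℝ := fun k => 2 * M * Real.exp (-(τ T * freqNorm k ^ σ)) with hb
  have hbr : Rapid b := (rapid_exp (hτpos T ⟨hT.le, le_rfl⟩) hσ0).of_le (2 * M) 0 fun k => by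
    rw [hb, norm_mul, Real.norm_of_nonneg (show 0 ≤ 2 * M by positivity)]; simp
  have hub : ∀ ν N, ∀ t ∈ Icc 0 T, ∀ k, ‖u ν N t k‖ ≤ b k := fun ν N t ht k =>
    norm_le_of_gnorm_le (zero_notMem_box N) (by linarith)
      ((gevRadius_strictAntiOn hC₁0 one_pos hτ₀ T).antitoneOn ht ⟨hT.le, le_rfl⟩ ht.2)
      (by positivity) ((hu ν N).field t ht).supp (hbd ν N t ht) k
  -- the guard `t ∈ Icc 0 T` makes the choice of the limits total in `t`
  have hlim : ∀ (ν : {ν : ℝ // 0 ≤ ν}) (t : ℝ) (k : Freq), ∃ z, t ∈ Icc 0 T →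
      Tendsto (fun N => u ν N t k) limFilter (𝓝 z) := by
    intro ν t k
    by_cases ht : t ∈ Icc 0 T
    · obtain ⟨z, hz⟩ := exists_tendsto_limFilter (fun N => hub ν N t ht k)
      exact ⟨z, fun _ => hz⟩
    · exact ⟨0, fun h => absurd h ht⟩
  choose U' hU' using hlim
  have hU : ∀ ν, ∀ t ∈ Icc 0 T, ∀ k, Tendsto (fun N => u ν N t k) limFilter (𝓝 (U' ν t k)) :=
    fun ν t ht k => hU' ν t k ht
  have hconv : ∀ ν, ∀ t ∈ Icc 0 T, ∀ k, Tendsto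
      (fun N => pres k (conv (box N) (u ν N t) (u ν N t) k)) limFilter
      (𝓝 (pres k (convInf (U' ν t) (U' ν t) k))) := fun ν t ht k =>
    ((continuous_pres k).tendsto _).comp (tendsto_conv hbr hbr (fun N => hub ν N t ht)
      (fun N => hub ν N t ht) (fun N => ((hu ν N).field t ht).supp) (hU ν t ht) (hU ν t ht) k)
  let E : ℝ → {ν : ℝ // 0 ≤ ν} := fun ν => ⟨max ν 0, le_max_right _ _⟩
  have hE : ∀ ν, 0 ≤ ν → (E ν : ℝ) = ν := fun ν h => max_eq_left h
  set C := √((2 * M) ^ 2 * Real.exp ((diffRate (r - 1) (2 * M) + 1) * T)) with hC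
  have hrate : 0 ≤ diffRate (r - 1) (2 * M) := by unfold diffRate; positivity
  have hdiff : ∀ ν, 0 < ν → ∀ N, ∀ t ∈ Icc 0 T,
      gnorm (box N) (r - 1) σ (τ t) (fun k => u (E ν) N t k - u (E 0) N t k) ≤ C * √ν := by
    intro ν hν N t ht
    have h1 := hu (E ν) N
    have h2 := hu (E 0) N
    rw [hE ν hν.le] at h1
    rw [hE 0 le_rfl] at h2
    have h3 := galerkin_sub_gnorm_le (zero_notMem_box N) (q := r - 1) (σ := σ) (by linarith)
      hσ0.le hσ hν (show 0 < 2 * M by positivity) hτder (fun t ht => (hτpos t ht).le) hτ' hC₁q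
      h1 h2 (by simpa using hbd (E ν) N) (by simpa using hbd (E 0) N) t ht
    rw [← Real.sqrt_sq (gnorm_nonneg _ _ _ _ _), hC, ← Real.sqrt_mul (by positivity)]
    refine Real.sqrt_le_sqrt (h3.trans ?_)
    rw [mul_comm ν]
    have := ht.2
    gcongr
  refine ⟨C₁, T, hC₁0, hT, b, fun ν => U' (E ν), 2 * M,
    2 ^ r * embConst * (2 * (2 * M) * (2 * M)), C, fun ν hν => ?_, fun ν hν t ht => ?_,
    fun ν hν t ht => ?_, fun ν hν t ht => ?_, fun ν hν t ht => ?_⟩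
  · have h1 := hu (E ν)
    rw [hE ν hν] at h1
    exact isSpectralSol_of_tendsto hν hT.le ha0 hbr h1 (hub (E ν)) (hU (E ν))
  · refine sum_sq_le_of_tendsto (gevW_zero (by linarith)) (fun k _ => hU (E ν) t ht k) fun N => ?_
    rw [← gnorm_sq]
    have := gnorm_nonneg (box N) r σ (τ t) (u (E ν) N t)
    have := hbd (E ν) N t ht
    gcongr
  · refine sum_sq_le_of_tendsto (gevW_zero (by linarith)) (fun k _ => hconv (E ν) t ht k)
      fun N => ?_
    have h1 := pres_conv_le (zero_notMem_box N) (q := r) (σ := σ) (by linarith) hσ0.le hσ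
      (hτpos t ht).le ((hu (E ν) N).field t ht).supp ((hu (E ν) N).field t ht).div
    refine (Real.sqrt_le_left (by positivity)).mp (h1.trans ?_)
    have := hbd (E ν) N t ht
    have := gnorm_nonneg (box N) r σ (τ t) (u (E ν) N t)
    gcongr
  · refine sum_sq_le_of_tendsto (gevW_zero (by linarith))
      (fun k _ => (hU (E ν) t ht k).sub (hU (E 0) t ht k)) fun N => ?_
    rw [← gnorm_sq (box N) (r - 1) σ (τ t) (fun k => u (E ν) N t k - u (E 0) N t k)]
    have := gnorm_nonneg (box N) (r - 1) σ (τ t) (fun k => u (E ν) N t k - u (E 0) N t k)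
    have := hdiff ν hν N t ht
    gcongr
  · refine sum_sq_le_of_tendsto (gevW_zero (by linarith))
      (fun k _ => (hconv (E ν) t ht k).sub (hconv (E 0) t ht k)) fun N => ?_
    set S := box N
    set v := u (E ν) N t with hv
    set v₀ := u (E 0) N t with hv₀
    set w : Freq → C3 := fun k => v k - v₀ k with hw
    have fv := (hu (E ν) N).field t ht
    have fv₀ := (hu (E 0) N).field t ht
    have hwS : ∀ k ∉ S, w k = 0 := fun k hk => by simp [hw, hv, hv₀, fv.supp k hk, fv₀.supp k hk]
    have hwdiv : ∀ k, dot k (w k) = 0 := fun k => by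
      simp [hw, hv, hv₀, dot_sub, fv.div k, fv₀.div k]
    have p1 := pres_conv_le (zero_notMem_box N) (q := r - 1) (σ := σ) (by linarith) hσ0.le hσ
      (hτpos t ht).le fv.supp hwdiv
    have p2 := pres_conv_le (zero_notMem_box N) (q := r - 1) (σ := σ) (by linarith) hσ0.le hσ
      (hτpos t ht).le hwS fv₀.div
    rw [sub_add_cancel] at p1 p2
    have g1 : gnorm S (r - 1) σ (τ t) v ≤ 2 * M :=
      (gnorm_mono (zero_notMem_box N) (by linarith) _).trans (hbd (E ν) N t ht)
    have g2 : gnorm S (r - 1) σ (τ t) v₀ ≤ 2 * M :=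
      (gnorm_mono (zero_notMem_box N) (by linarith) _).trans (hbd (E 0) N t ht)
    have g3 : gnorm S (r - 1) σ (τ t) w ≤ C * √ν := hdiff ν hν N t ht
    have n1 := gnorm_nonneg S (r - 1) σ (τ t) v
    have n2 := gnorm_nonneg S (r - 1) σ (τ t) v₀
    have n3 := gnorm_nonneg S (r - 1) σ (τ t) w
    have hCν : 0 ≤ C * √ν := by positivity
    -- convexity of the square, `(x + y)² ≤ 2 x² + 2 y²`
    have hsplit : ∀ k ∈ S, (gevW r σ (τ t) (freqNorm k) *
        ‖pres k (conv S v v k) - pres k (conv S v₀ v₀ k)‖) ^ 2 ≤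
        2 * (gevW r σ (τ t) (freqNorm k) * ‖pres k (conv S v w k)‖) ^ 2 +
        2 * (gevW r σ (τ t) (freqNorm k) * ‖pres k (conv S w v₀ k)‖) ^ 2 := by
      intro k _
      rw [← pres_sub, conv_sub_conv, pres_add]
      have hW : 0 ≤ gevW r σ (τ t) (freqNorm k) := gevW_nonneg (freqNorm_nonneg k)
      calc _ ≤ (gevW r σ (τ t) (freqNorm k) *
            (‖pres k (conv S v w k)‖ + ‖pres k (conv S w v₀ k)‖)) ^ 2 := by
            gcongr; exact norm_add_le _ _
        _ ≤ _ := by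
            nlinarith [sq_nonneg (gevW r σ (τ t) (freqNorm k) *
              (‖pres k (conv S v w k)‖ - ‖pres k (conv S w v₀ k)‖))]
    refine (Finset.sum_le_sum hsplit).trans ?_
    rw [Finset.sum_add_distrib, ← Finset.mul_sum, ← Finset.mul_sum]
    set B := 2 ^ (r - 1) * embConst * (4 * M) * (C * √ν) with hB
    have hB0 : 0 ≤ B := by positivity
    have s1 := (Real.sqrt_le_left hB0).mp (p1.trans (show _ ≤ B by
      rw [hB]
      calc _ ≤ 2 ^ (r - 1) * embConst * (2 * (2 * M) * (C * √ν)) := by gcongr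
        _ = _ := by ring))
    have s2 := (Real.sqrt_le_left hB0).mp (p2.trans (show _ ≤ B by
      rw [hB]
      calc _ ≤ 2 ^ (r - 1) * embConst * (2 * (C * √ν) * (2 * M)) := by gcongr
        _ = _ := by ring))
    calc _ ≤ 2 * B ^ 2 + 2 * B ^ 2 := by linarith
      _ = _ := by rw [hB]; ring

/-! ### Rapidly convergent Fourier series -/

/-- The sum of a Fourier series. -/
def fser (c : Freq → ℂ) (x : E3) : ℂ := ∑' k, c k * Complex.exp (Complex.I * (phase k x : ℂ))

/-- The Fourier coefficients of the partial derivative in the direction `i`. -/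
def dcoef (i : Fin 3) (c : Freq → ℂ) (k : Freq) : ℂ := Complex.I * (k i : ℂ) * c k

lemma phase_eq_inner (k : Freq) (x : E3) : phase k x = inner ℝ (freqVec k) x := by
  simp [phase, freqVec, PiLp.inner_apply, mul_comm]

@[simp] lemma norm_exp_phase (k : Freq) (x : E3) :
    ‖Complex.exp (Complex.I * (phase k x : ℂ))‖ = 1 := by
  rw [mul_comm]; exact Complex.norm_exp_ofReal_mul_I _

lemma Rapid.dcoef {c : Freq → ℂ} (hc : Rapid c) (i : Fin 3) : Rapid (dcoef i c) := by
  refine hc.of_le 1 1 fun k => ?_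
  have h1 : |(k i : ℝ)| ≤ freqNorm k := abs_coe_le_freqNorm k i
  have h2 : ‖((k i : ℤ) : ℂ)‖ = |(k i : ℝ)| := by
    rw [← Complex.ofReal_intCast, Complex.norm_real, Real.norm_eq_abs]
  rw [GevreyNS.dcoef, norm_mul, norm_mul, Complex.norm_I, one_mul, one_mul, pow_one, h2]
  gcongr
  linarith

lemma Rapid.summable_fser {c : Freq → ℂ} (hc : Rapid c) (x : E3) :
    Summable fun k => c k * Complex.exp (Complex.I * (phase k x : ℂ)) := by
  refine Summable.of_norm ?_
  simpa using hc.summable_norm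

lemma fser_add {c d : Freq → ℂ} (hc : Rapid c) (hd : Rapid d) (x : E3) :
    fser (fun k => c k + d k) x = fser c x + fser d x := by
  simp only [fser, add_mul]
  exact (hc.summable_fser x).tsum_add (hd.summable_fser x)

lemma fser_const_mul (a : ℂ) (c : Freq → ℂ) (x : E3) :
    fser (fun k => a * c k) x = a * fser c x := by
  simp only [fser, mul_assoc, tsum_mul_left]

lemma fser_sum {ι : Type*} (s : Finset ι) {c : ι → Freq → ℂ} (hc : ∀ i ∈ s, Rapid (c i))
    (x : E3) : fser (fun k => ∑ i ∈ s, c i k) x = ∑ i ∈ s, fser (c i) x := by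
  simp only [fser, Finset.sum_mul]
  exact Summable.tsum_finsetSum fun i hi => (hc i hi).summable_fser x

lemma exp_phase_add (k l : Freq) (x : E3) :
    Complex.exp (Complex.I * (phase (k + l) x : ℂ)) =
      Complex.exp (Complex.I * (phase k x : ℂ)) * Complex.exp (Complex.I * (phase l x : ℂ)) := by
  have : phase (k + l) x = phase k x + phase l x := by
    simp [phase_eq_inner, freqVec_add, inner_add_left]
  rw [← Complex.exp_add, this]; push_cast; ring_nf

/-- The product of two Fourier series is the series of the convolution. -/
lemma fser_mul {c d : Freq → ℂ} (hc : Rapid c) (hd : Rapid d) (x : E3) :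
    fser c x * fser d x = fser (fun k => ∑' l, c (k - l) * d l) x := by
  unfold fser
  rw [tsum_mul_tsum_conv (by simpa using hc.summable_norm) (by simpa using hd.summable_norm)]
  refine tsum_congr fun k => ?_
  rw [← tsum_mul_right]
  refine tsum_congr fun l => ?_
  have := exp_phase_add (k - l) l x
  rw [sub_add_cancel] at this
  rw [this]; ring

lemma phase_neg (k : Freq) (x : E3) : phase (-k) x = -phase k x := by simp [phase]

lemma fser_conj {c : Freq → ℂ} (hc : ∀ k, c (-k) = (starRingEnd ℂ) (c k)) (x : E3) :
    (starRingEnd ℂ) (fser c x) = fser c x := by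
  unfold fser
  rw [Complex.conj_tsum, ← (Equiv.neg Freq).tsum_eq]
  refine tsum_congr fun k => ?_
  rw [map_mul, ← Complex.exp_conj, map_mul, Complex.conj_I, Complex.conj_ofReal]
  simp [hc, phase_neg]

lemma ofReal_re_fser {c : Freq → ℂ} (hc : ∀ k, c (-k) = (starRingEnd ℂ) (c k)) (x : E3) :
    (((fser c x).re : ℝ) : ℂ) = fser c x :=
  Complex.conj_eq_iff_re.mp (fser_conj hc x)

lemma isPeriodic_fser (c : Freq → ℂ) : IsPeriodic (fser c) := by
  intro i x
  unfold fser
  refine tsum_congr fun k => ?_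
  have h1 : phase k (x + EuclideanSpace.single i (2 * π)) = phase k x + k i * (2 * π) := by
    rw [phase_eq_inner, phase_eq_inner, inner_add_right]
    congr 1
    rw [EuclideanSpace.inner_single_right]
    simp [freqVec, mul_comm]
  rw [h1]
  congr 1
  have h2 : Complex.I * ((phase k x + k i * (2 * π) : ℝ) : ℂ) =
      Complex.I * (phase k x : ℂ) + (k i : ℤ) * (2 * π * Complex.I) := by push_cast; ring
  rw [h2, Complex.exp_add, Complex.exp_int_mul_two_pi_mul_I, mul_one]

/-- A coordinate of `ℝ³` as a complex valued functional. -/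
def coordC (i : Fin 3) : E3 →L[ℝ] ℂ := Complex.ofRealCLM.comp (EuclideanSpace.proj i)

lemma coordC_apply (i : Fin 3) (v : E3) : coordC i v = (v i : ℂ) := rfl

lemma hasFDerivAt_fser {c : Freq → ℂ} (hc : Rapid c) (x : E3) :
    HasFDerivAt (fser c) (∑ i, fser (dcoef i c) x • coordC i) x := by
  let g' : Freq → E3 → E3 →L[ℝ] ℂ := fun k x =>
    (c k * (Complex.exp (Complex.I * (phase k x : ℂ)) * Complex.I)) •
      Complex.ofRealCLM.comp (innerSL ℝ (freqVec k))
  have hg : ∀ k x, HasFDerivAt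
      (fun x => c k * Complex.exp (Complex.I * (phase k x : ℂ))) (g' k x) x := by
    intro k x
    have h1 : HasFDerivAt (fun x => (phase k x : ℂ))
        (Complex.ofRealCLM.comp (innerSL ℝ (freqVec k))) x := by
      simp only [phase_eq_inner]
      exact (Complex.ofRealCLM.comp (innerSL ℝ (freqVec k))).hasFDerivAt
    have h2 := ((h1.const_mul Complex.I).cexp).const_mul (c k)
    refine h2.congr_fderiv ?_
    ext v
    simp [g', mul_assoc]
  have hb : ∀ k x, ‖g' k x‖ ≤ (1 + freqNorm k) ^ 1 * ‖c k‖ := by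
    intro k x
    have h1 : ‖Complex.ofRealCLM.comp (innerSL ℝ (freqVec k))‖ ≤ freqNorm k := by
      refine ContinuousLinearMap.opNorm_le_bound _ (freqNorm_nonneg k) fun v => ?_
      rw [freqNorm_eq]
      simpa using! norm_inner_le_norm (𝕜 := ℝ) (freqVec k) v
    simp only [g', norm_smul, norm_mul, norm_exp_phase, Complex.norm_I, mul_one, pow_one]
    rw [mul_comm]
    gcongr
    linarith
  have hmain := hasFDerivAt_tsum (hc 1) hg hb (hc.summable_fser 0) x
  refine hmain.congr_fderiv ?_
  have hsum : Summable fun k => g' k x := Summable.of_norm_bounded (hc 1) fun k => hb k x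
  ext v
  have h1 : (∑' k, g' k x) v = ∑' k, g' k x v :=
    (ContinuousLinearMap.apply ℝ ℂ v).map_tsum hsum
  rw [h1]
  simp only [_root_.sum_apply, _root_.smul_apply, coordC_apply,
    smul_eq_mul, fser]
  simp_rw [← tsum_mul_right]
  rw [← Summable.tsum_finsetSum fun i _ => ((hc.dcoef i).summable_fser x).mul_right _]
  refine tsum_congr fun k => ?_
  have h2 : g' k x v = (c k * (Complex.exp (Complex.I * (phase k x : ℂ)) * Complex.I)) *
      ((phase k v : ℝ) : ℂ) := by
    simp [g', phase_eq_inner]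
  have h3 : phase k v = ∑ i, (k i : ℝ) * v i := rfl
  rw [h2, h3, Complex.ofReal_sum, Finset.mul_sum]
  refine Finset.sum_congr rfl fun i _ => ?_
  rw [dcoef]; push_cast; ring

lemma contDiff_fser_nat (n : ℕ) : ∀ {c : Freq → ℂ}, Rapid c → ContDiff ℝ n (fser c) := by
  induction n with
  | zero =>
    intro c hc
    exact contDiff_zero.mpr (continuous_iff_continuousAt.mpr fun x =>
      (hasFDerivAt_fser hc x).continuousAt)
  | succ n ih =>
    intro c hc
    refine contDiff_succ_iff_hasFDerivAt.mpr ⟨_, ?_, hasFDerivAt_fser hc⟩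
    exact ContDiff.sum fun i _ => (ih (hc.dcoef i)).smul contDiff_const

lemma continuous_fser {c : Freq → ℂ} (hc : Rapid c) : Continuous (fser c) :=
  (contDiff_fser_nat 0 hc).continuous

lemma laplacian_fser {c : Freq → ℂ} (hc : Rapid c) (x : E3) :
    Laplacian.laplacian (fser c) x = fser (fun k => -((freqNorm k : ℂ) ^ 2) * c k) x := by
  have h1 : fderiv ℝ (fser c) = fun y => ∑ i, fser (dcoef i c) y • coordC i :=
    funext fun y => (hasFDerivAt_fser hc y).fderiv
  have h2 : HasFDerivAt (fun y => ∑ i, fser (dcoef i c) y • coordC i)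
      (∑ i, (∑ j, fser (dcoef j (dcoef i c)) x • coordC j).smulRight (coordC i)) x :=
    HasFDerivAt.fun_sum fun i _ => (hasFDerivAt_fser (hc.dcoef i) x).smul_const (coordC i)
  rw [InnerProductSpace.laplacian_eq_iteratedFDeriv_orthonormalBasis _
    (EuclideanSpace.basisFun (Fin 3) ℝ)]
  simp only [iteratedFDeriv_two_apply, h1, h2.fderiv]
  have h3 : ∀ i, (∑ i', (∑ j, fser (dcoef j (dcoef i' c)) x • coordC j).smulRight (coordC i'))
      (EuclideanSpace.single i (1 : ℝ)) (EuclideanSpace.single i (1 : ℝ)) =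
      fser (dcoef i (dcoef i c)) x := by
    intro i
    simp only [_root_.sum_apply, ContinuousLinearMap.smulRight_apply,
      _root_.smul_apply, coordC_apply, smul_eq_mul]
    rw [Finset.sum_eq_single i, Finset.sum_eq_single i]
    · simp
    · intro j _ hj; simp [hj]
    · simp
    · intro j _ hj; simp [hj]
    · simp
  simp only [EuclideanSpace.basisFun_apply, Matrix.cons_val_zero, Matrix.cons_val_one, h3]
  rw [← fser_sum _ fun i _ => (hc.dcoef i).dcoef i]
  refine congrArg (fun c => fser c x) (funext fun k => ?_)
  rw [← Complex.ofReal_pow, freqNorm_sq]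
  push_cast
  rw [neg_mul, Finset.sum_mul, ← Finset.sum_neg_distrib]
  refine Finset.sum_congr rfl fun i _ => ?_
  simp only [dcoef]
  linear_combination (k i : ℂ) ^ 2 * c k * Complex.I_mul_I

/-- Termwise differentiation of a Fourier series in time. -/
lemma hasDerivWithinAt_fser {c : ℝ → Freq → ℂ} {c' : Freq → ℂ} {L : Freq → ℝ} (hL : Rapid L)
    {s : Set ℝ} {t : ℝ} (ht : t ∈ s) (hc : ∀ t ∈ s, Rapid (c t))
    (hlip : ∀ t' ∈ s, ∀ k, ‖c t' k - c t k‖ ≤ L k * |t' - t|)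
    (hd : ∀ k, HasDerivWithinAt (fun t' => c t' k) (c' k) s t) (x : E3) :
    HasDerivWithinAt (fun t' => fser (c t') x) (fser c' x) s t := by
  rw [hasDerivWithinAt_iff_tendsto_slope]
  have hten : Tendsto (fun t' => ∑' k, slope (fun t' => c t' k) t t' *
      Complex.exp (Complex.I * (phase k x : ℂ))) (𝓝[s \ {t}] t) (𝓝 (fser c' x)) := by
    refine tendsto_tsum_of_dominated_convergence (bound := L) hL.summable (fun k => ?_) ?_
    · exact (hasDerivWithinAt_iff_tendsto_slope.mp (hd k)).mul_const _
    · filter_upwards [self_mem_nhdsWithin] with t' ht' k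
      have hne : 0 < |t' - t| := abs_pos.mpr (sub_ne_zero.mpr ht'.2)
      rw [norm_mul, norm_exp_phase, mul_one, slope_def_module, norm_smul, norm_inv,
        Real.norm_eq_abs, inv_mul_le_iff₀ hne, mul_comm]
      exact hlip t' ht'.1 k
  refine hten.congr' ?_
  filter_upwards [self_mem_nhdsWithin] with t' ht'
  rw [slope_def_module, fser, fser, ← ((hc t' ht'.1).summable_fser x).tsum_sub
    ((hc t ht).summable_fser x), ← tsum_const_smul'']
  refine tsum_congr fun k => ?_
  rw [slope_def_module, ← sub_mul, smul_mul_assoc]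

/-! ### Fourier coefficients and the torus -/

lemma IsPeriodic.add_int {F : Type*} {f : E3 → F} (hf : IsPeriodic f) (k : Freq) (x : E3) :
    f (x + (2 * π) • freqVec k) = f x := by
  have h1 : ∀ (i : Fin 3) (n : ℤ) (x : E3),
      f (x + (n : ℝ) • EuclideanSpace.single i (2 * π)) = f x := by
    intro i n x
    have := (show Function.Periodic f (EuclideanSpace.single i (2 * π)) from hf i).zsmul n x
    rwa [← Int.cast_smul_eq_zsmul ℝ] at this
  have h2 : (2 * π) • freqVec k = ((k 0 : ℤ) : ℝ) • EuclideanSpace.single 0 (2 * π) +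
      ((k 1 : ℤ) : ℝ) • EuclideanSpace.single 1 (2 * π) +
      ((k 2 : ℤ) : ℝ) • EuclideanSpace.single 2 (2 * π) := by
    ext i
    fin_cases i <;> simp [freqVec, mul_comm]
  rw [h2, ← add_assoc, ← add_assoc, h1, h1, h1]

/-- The half-open cube `(-π, π]³`. -/
def cubeIoc : Set E3 := {x | ∀ i, x i ∈ Ioc (-π) π}

lemma measurableSet_cubeIoc : MeasurableSet cubeIoc := by
  have : cubeIoc = (WithLp.ofLp : E3 → Fin 3 → ℝ) ⁻¹' (univ.pi fun _ => Ioc (-π) π) := by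
    ext x; simp [cubeIoc]
  rw [this]
  exact (PiLp.volume_preserving_ofLp (Fin 3)).measurable
    (MeasurableSet.univ_pi fun _ => measurableSet_Ioc)

lemma cube_ae_eq_cubeIoc : cube =ᵐ[volume] cubeIoc := by
  have h1 : cube = (WithLp.ofLp : E3 → Fin 3 → ℝ) ⁻¹' (univ.pi fun _ => Ioo (-π) π) := by
    ext x; simp [cube]
  have h2 : cubeIoc = (WithLp.ofLp : E3 → Fin 3 → ℝ) ⁻¹' (univ.pi fun _ => Ioc (-π) π) := by
    ext x; simp [cubeIoc]
  rw [h1, h2]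
  exact (PiLp.volume_preserving_ofLp (Fin 3)).quasiMeasurePreserving.preimage_ae_eq
    Measure.pi_Ioo_ae_eq_pi_Ioc

/-- A periodic function which vanishes almost everywhere on the cube vanishes almost everywhere. -/
lemma IsPeriodic.ae_eq_zero {f : E3 → ℝ} (hf : IsPeriodic f)
    (h : f =ᵐ[volume.restrict cube] 0) : f =ᵐ[volume] 0 := by
  rw [Measure.restrict_congr_set cube_ae_eq_cubeIoc, EventuallyEq,
    ae_restrict_iff' measurableSet_cubeIoc] at h
  have h1 : ∀ k : Freq, ∀ᵐ x : E3, x + (2 * π) • freqVec k ∈ cubeIoc →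
      f (x + (2 * π) • freqVec k) = 0 := fun k =>
    (measurePreserving_add_right volume ((2 * π) • freqVec k)).quasiMeasurePreserving.ae h
  filter_upwards [ae_all_iff.mpr h1] with x hx
  have h2π : 0 < 2 * π := by positivity
  have := hx (fun i => -toIocDiv h2π (-π) (x i)) fun i => by
    have h3 := toIocMod_mem_Ioc h2π (-π) (x i)
    have h4 : (x + (2 * π) • freqVec fun i => -toIocDiv h2π (-π) (x i)) i =
        toIocMod h2π (-π) (x i) := by
      change x i + (2 * π) * ((-toIocDiv h2π (-π) (x i) : ℤ) : ℝ) = _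
      rw [← self_sub_toIocDiv_zsmul, zsmul_eq_mul]
      push_cast; ring
    rw [show -π + 2 * π = π by ring] at h3
    rw [h4]
    exact h3
  rwa [hf.add_int] at this

section Torus

-- The normalised Haar measure, the measure for which Mathlib states Fourier theory on the torus.
attribute [local instance] instMeasureSpaceUnitAddCircle instIsAddHaarMeasureUnitAddCircleVolume
  instIsProbabilityMeasureUnitAddCircleVolume

/-- The torus `(ℝ/ℤ)³` as a subset of Euclidean space, through its fundamental cube. -/
def torusEmb (θ : UnitAddTorus (Fin 3)) : E3 :=
  WithLp.toLp 2 ((2 * π) • (UnitAddTorus.measurableEquivPiIoc (fun _ => -(1 / 2 : ℝ)) θ).1)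

lemma mem_unitBox_iff (y : Fin 3 → ℝ) :
    (∀ i, y i ∈ Ioc (-(1 / 2 : ℝ)) (-(1 / 2) + 1)) ↔
      (WithLp.toLp 2 ((2 * π) • y) : E3) ∈ cubeIoc := by
  have := Real.pi_pos
  simp only [cubeIoc, mem_ofPred_eq, Pi.smul_apply, smul_eq_mul, mem_Ioc]
  refine forall_congr' fun i => and_congr ⟨fun h => ?_, fun h => ?_⟩ ⟨fun h => ?_, fun h => ?_⟩ <;>
    nlinarith

lemma measurableEmbedding_scale :
    MeasurableEmbedding fun y : Fin 3 → ℝ => (WithLp.toLp 2 ((2 * π) • y) : E3) :=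
  (MeasurableEquiv.toLp 2 (Fin 3 → ℝ)).measurableEmbedding.comp
    (measurableEmbedding_const_smul₀ (by positivity))

lemma measurableEmbedding_torusEmb : MeasurableEmbedding torusEmb :=
  measurableEmbedding_scale.comp ((MeasurableEmbedding.subtype_coe
    (MeasurableSet.univ_pi' fun _ => measurableSet_Ioc)).comp
      (UnitAddTorus.measurableEquivPiIoc _).measurableEmbedding)

lemma map_torusEmb : Measure.map torusEmb volume =
    ENNReal.ofReal (1 / (2 * π) ^ 3) • volume.restrict cube := by
  have hbox : MeasurableSet {y : Fin 3 → ℝ | ∀ i, y i ∈ Ioc (-(1 / 2 : ℝ)) (-(1 / 2) + 1)} :=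
    MeasurableSet.univ_pi' fun _ => measurableSet_Ioc
  have h1 : Measure.map (fun θ : UnitAddTorus (Fin 3) =>
      (UnitAddTorus.measurableEquivPiIoc (fun _ => -(1 / 2 : ℝ)) θ).1) volume =
      volume.restrict {y : Fin 3 → ℝ | ∀ i, y i ∈ Ioc (-(1 / 2 : ℝ)) (-(1 / 2) + 1)} := by
    have := (UnitAddTorus.measurePreserving_equivPiIoc (d := Fin 3) fun _ => -(1 / 2 : ℝ)).map_eq
    rw [← map_comap_subtype_coe hbox]
    exact (Measure.map_map measurable_subtype_coe (MeasurableEquiv.measurable _)).symm.trans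
      (congrArg (Measure.map Subtype.val) this)
  have h2 : {y : Fin 3 → ℝ | ∀ i, y i ∈ Ioc (-(1 / 2 : ℝ)) (-(1 / 2) + 1)} =
      (fun y : Fin 3 → ℝ => (WithLp.toLp 2 ((2 * π) • y) : E3)) ⁻¹' cubeIoc := by
    ext y; exact mem_unitBox_iff y
  have h3 : Measure.map (fun y : Fin 3 → ℝ => (WithLp.toLp 2 ((2 * π) • y) : E3)) volume =
      ENNReal.ofReal (1 / (2 * π) ^ 3) • volume := by
    have e : (fun y : Fin 3 → ℝ => (WithLp.toLp 2 ((2 * π) • y) : E3)) =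
        (WithLp.toLp 2 : (Fin 3 → ℝ) → E3) ∘ fun y => (2 * π) • y := rfl
    rw [e, ← Measure.map_map (PiLp.volume_preserving_toLp (Fin 3)).measurable
      (measurable_const_smul _), Measure.map_addHaar_smul volume (by positivity),
      Measure.map_smul, (PiLp.volume_preserving_toLp (Fin 3)).map_eq]
    congr 2
    rw [abs_of_pos (by positivity)]
    simp
  have e : torusEmb = (fun y : Fin 3 → ℝ => (WithLp.toLp 2 ((2 * π) • y) : E3)) ∘
      fun θ => (UnitAddTorus.measurableEquivPiIoc (fun _ => -(1 / 2 : ℝ)) θ).1 := rfl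
  have hmeas : Measurable fun θ : UnitAddTorus (Fin 3) =>
      (UnitAddTorus.measurableEquivPiIoc (fun _ => -(1 / 2 : ℝ)) θ).1 :=
    measurable_subtype_coe.comp (MeasurableEquiv.measurable _)
  rw [e, ← Measure.map_map measurableEmbedding_scale.measurable hmeas, h1, h2,
    ← Measure.restrict_map measurableEmbedding_scale.measurable measurableSet_cubeIoc, h3,
    Measure.restrict_smul, Measure.restrict_congr_set cube_ae_eq_cubeIoc]

lemma mFourier_eq_exp (k : Freq) (θ : UnitAddTorus (Fin 3)) :
    UnitAddTorus.mFourier k θ = Complex.exp (Complex.I * (phase k (torusEmb θ) : ℂ)) := by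
  set y := (UnitAddTorus.measurableEquivPiIoc (fun _ => -(1 / 2 : ℝ)) θ) with hy
  have h1 : θ = fun i => ((y.1 i : ℝ) : UnitAddCircle) := by
    have := (UnitAddTorus.measurableEquivPiIoc (fun _ => -(1 / 2 : ℝ))).symm_apply_apply θ
    rw [UnitAddTorus.coe_symm_measurableEquivPiIoc_apply] at this
    exact this.symm
  have h2 : torusEmb θ = WithLp.toLp 2 ((2 * π) • y.1) := rfl
  rw [h2]
  conv_lhs => rw [h1]
  simp only [UnitAddTorus.mFourier, ContinuousMap.coe_mk, fourier_coe_apply, phase]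
  rw [← Complex.exp_sum]
  congr 1
  simp only [Pi.smul_apply, smul_eq_mul]
  push_cast
  rw [Finset.mul_sum]
  refine Finset.sum_congr rfl fun i _ => ?_
  ring

lemma fourierCoef_eq (f : E3 → ℝ) (k : Freq) :
    fourierCoef f k = UnitAddTorus.mFourierCoeff (fun θ => (f (torusEmb θ) : ℂ)) k := by
  unfold fourierCoef UnitAddTorus.mFourierCoeff
  have h1 : ∀ θ, UnitAddTorus.mFourier (-k) θ • ((f (torusEmb θ) : ℝ) : ℂ) =
      (fun x => (f x : ℂ) * Complex.exp (-(Complex.I * (phase k x : ℂ)))) (torusEmb θ) := by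
    intro θ
    rw [mFourier_eq_exp, smul_eq_mul, mul_comm, phase_neg]
    push_cast
    rw [mul_neg]
  simp_rw [h1]
  refine Eq.trans ?_ (measurableEmbedding_torusEmb.integral_map
    (fun x => (f x : ℂ) * Complex.exp (-(Complex.I * (phase k x : ℂ)))))
  rw [map_torusEmb, integral_smul_measure, ENNReal.toReal_ofReal (by positivity),
    Complex.real_smul]

/-- The Fourier coefficients of the sum of a Fourier series. -/
lemma fourierCoef_fser {c : Freq → ℂ} (hc : Rapid c)
    (hreal : ∀ k, c (-k) = (starRingEnd ℂ) (c k)) (k : Freq) :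
    fourierCoef (fun x => (fser c x).re) k = c k := by
  rw [fourierCoef_eq]
  simp only [ofReal_re_fser hreal]
  have hs : Summable fun k => c k • (UnitAddTorus.mFourier k : C(UnitAddTorus (Fin 3), ℂ)) := by
    refine Summable.of_norm ?_
    simpa [norm_smul, UnitAddTorus.mFourier_norm] using hc.summable_norm
  set F := ∑' k, c k • (UnitAddTorus.mFourier k : C(UnitAddTorus (Fin 3), ℂ)) with hF
  have h1 : (fun θ => fser c (torusEmb θ)) = F := by
    ext θ
    have := (ContinuousMap.evalCLM ℂ θ).map_tsum hs
    rw [hF]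
    refine Eq.trans ?_ this.symm
    refine tsum_congr fun k => ?_
    simp [mFourier_eq_exp]
  rw [h1, ← UnitAddTorus.mFourierCoeff_toLp, ← UnitAddTorus.mFourierBasis_repr,
    HilbertBasis.repr_apply_apply]
  have h2 := (innerSL ℂ (UnitAddTorus.mFourierBasis (d := Fin 3) k)).hasSum
    ((ContinuousMap.toLp 2 volume ℂ : C(UnitAddTorus (Fin 3), ℂ) →L[ℂ] _).hasSum hs.hasSum)
  have h3 : ∀ l, innerSL ℂ (UnitAddTorus.mFourierBasis (d := Fin 3) k)
      (ContinuousMap.toLp 2 volume ℂ (c l • UnitAddTorus.mFourier l)) =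
      if l = k then c k else 0 := by
    intro l
    have h4 : ContinuousMap.toLp 2 volume ℂ (UnitAddTorus.mFourier l) =
        UnitAddTorus.mFourierBasis (d := Fin 3) l := by
      rw [UnitAddTorus.coe_mFourierBasis]
    rw [map_smul, h4, innerSL_apply_apply, inner_smul_right,
      orthonormal_iff_ite.mp UnitAddTorus.mFourierBasis.orthonormal k l]
    by_cases h : l = k
    · simp [h]
    · simp [h, Ne.symm h]
  simp only [h3] at h2
  exact h2.unique (hasSum_ite_eq k (c k))

/-- Completeness of the trigonometric system. -/
lemma ae_eq_zero_of_fourierCoef {f : E3 → ℝ} (hf : MemLp f 2 (volume.restrict cube))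
    (h : ∀ k, fourierCoef f k = 0) : f =ᵐ[volume.restrict cube] 0 := by
  have hc : ENNReal.ofReal (1 / (2 * π) ^ 3) ≠ 0 := by
    simp only [ne_eq, ENNReal.ofReal_eq_zero, not_le]; positivity
  have hfC : MemLp (fun x => (f x : ℂ)) 2 (Measure.map torusEmb volume) := by
    rw [map_torusEmb]
    exact (hf.ofReal).smul_measure ENNReal.ofReal_ne_top
  have hF : MemLp (fun θ => (f (torusEmb θ) : ℂ)) 2 volume :=
    (measurableEmbedding_torusEmb.memLp_map_measure_iff).mp hfC
  have h0 : hF.toLp _ = 0 := by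
    refine (UnitAddTorus.mFourierBasis (d := Fin 3)).repr.injective ?_
    ext k
    rw [UnitAddTorus.mFourierBasis_repr, map_zero]
    have : UnitAddTorus.mFourierCoeff (hF.toLp _) k =
        UnitAddTorus.mFourierCoeff (fun θ => (f (torusEmb θ) : ℂ)) k := by
      refine integral_congr_ae ?_
      filter_upwards [hF.coeFn_toLp] with θ hθ
      rw [hθ]
    rw [this, ← fourierCoef_eq, h]
    rfl
  have h1 : ∀ᵐ θ : UnitAddTorus (Fin 3), f (torusEmb θ) = 0 := by
    have h2 := hF.coeFn_toLp
    rw [h0] at h2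
    filter_upwards [h2, Lp.coeFn_zero ℂ 2 (volume : Measure (UnitAddTorus (Fin 3)))] with θ ha hb
    rw [hb] at ha
    simpa using ha.symm
  have h2 : ∀ᵐ x ∂(Measure.map torusEmb volume), f x = 0 :=
    (measurableEmbedding_torusEmb.ae_map_iff).mpr h1
  rw [map_torusEmb] at h2
  exact (Measure.ae_ennreal_smul_measure_iff hc).mp h2

lemma volume_cube_lt_top : volume cube < ⊤ := by
  have h1 := congrArg (fun μ : Measure E3 => μ univ) map_torusEmb
  simp only [Measure.smul_apply, Measure.restrict_apply_univ, smul_eq_mul] at h1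
  rw [Measure.map_apply measurableEmbedding_torusEmb.measurable MeasurableSet.univ] at h1
  by_contra hcon
  rw [not_lt, top_le_iff] at hcon
  rw [hcon, ENNReal.mul_top (by simp only [ne_eq, ENNReal.ofReal_eq_zero, not_le]; positivity)]
    at h1
  exact (measure_ne_top _ _) h1

end Torus

lemma norm_fser_le {c : Freq → ℂ} (hc : Rapid c) (x : E3) : ‖fser c x‖ ≤ ∑' k, ‖c k‖ :=
  tsum_of_norm_bounded hc.summable_norm.hasSum fun k => by simp

lemma memLp_re_fser {c : Freq → ℂ} (hc : Rapid c) :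
    MemLp (fun x => (fser c x).re) 2 (volume.restrict cube) := by
  have : IsFiniteMeasure (volume.restrict cube) := ⟨by simpa using volume_cube_lt_top⟩
  refine MemLp.of_bound
    (Complex.continuous_re.comp (continuous_fser hc)).aestronglyMeasurable _
    (Eventually.of_forall fun x => (Complex.abs_re_le_norm _).trans (norm_fser_le hc x))

/-! ### From spectral to classical solutions -/

/-- The real vector field with Fourier coefficients `v`. -/
def vfield (v : Freq → C3) (x : E3) : E3 := WithLp.toLp 2 fun i => (fser (fun k => v k i) x).re

lemma vfield_apply (v : Freq → C3) (x : E3) (i : Fin 3) :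
    vfield v x i = (fser (fun k => v k i) x).re := rfl

lemma Rapid.coord {v : Freq → C3} (hv : Rapid v) (i : Fin 3) : Rapid fun k => v k i :=
  hv.mono fun k => PiLp.norm_apply_le (v k) i

lemma IsPeriodic.re {f : E3 → ℂ} (hf : IsPeriodic f) : IsPeriodic fun x => (f x).re :=
  fun i x => congrArg Complex.re (hf i x)

lemma isPeriodic_vfield (v : Freq → C3) : IsPeriodic (vfield v) := fun i x => by
  ext j; exact (isPeriodic_fser _).re i x

lemma contDiff_re_fser (n : ℕ) {c : Freq → ℂ} (hc : Rapid c) :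
    ContDiff ℝ n fun x => (fser c x).re :=
  Complex.reCLM.contDiff.comp (contDiff_fser_nat n hc)

lemma contDiff_vfield (n : ℕ) {v : Freq → C3} (hv : Rapid v) : ContDiff ℝ n (vfield v) :=
  contDiff_euclidean.mpr fun i => contDiff_re_fser n (hv.coord i)

lemma fderiv_re_fser {c : Freq → ℂ} (hc : Rapid c) (x w : E3) :
    fderiv ℝ (fun x => (fser c x).re) x w = ∑ j, w j * (fser (dcoef j c) x).re := by
  have h := (Complex.reCLM.hasFDerivAt.comp x (hasFDerivAt_fser hc x)).fderiv
  have e : (fun x => (fser c x).re) = (Complex.reCLM : ℂ → ℝ) ∘ fser c := rfl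
  rw [e, h]
  simp [coordC_apply, mul_comm]

lemma gradient_re_fser {c : Freq → ℂ} (hc : Rapid c) (x : E3) (i : Fin 3) :
    gradient (fun x => (fser c x).re) x i = (fser (dcoef i c) x).re := by
  have h1 : gradient (fun x => (fser c x).re) x i =
      inner ℝ (gradient (fun x => (fser c x).re) x) (EuclideanSpace.single i (1 : ℝ)) := by
    rw [EuclideanSpace.inner_single_right]; simp
  rw [h1, gradient, InnerProductSpace.toDual_symm_apply, fderiv_re_fser hc,
    Finset.sum_eq_single i] <;> simp +contextual

lemma fderiv_vfield {v : Freq → C3} (hv : Rapid v) (x w : E3) (i : Fin 3) :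
    fderiv ℝ (vfield v) x w i = ∑ j, w j * (fser (dcoef j fun k => v k i) x).re := by
  rw [← fderiv_re_fser (hv.coord i)]
  have h := ((contDiff_vfield 1 hv).differentiable (by simp) x).hasFDerivAt
  have h2 := ((EuclideanSpace.proj (𝕜 := ℝ) i).hasFDerivAt.comp x h).fderiv
  have e : (fun x => (fser (fun k => v k i) x).re) =
      (EuclideanSpace.proj (𝕜 := ℝ) i : E3 → ℝ) ∘ vfield v := rfl
  rw [e, h2]
  rfl

lemma laplacian_vfield {v : Freq → C3} (hv : Rapid v) (x : E3) (i : Fin 3) :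
    Laplacian.laplacian (vfield v) x i =
      (fser (fun k => -((freqNorm k : ℂ) ^ 2) * v k i) x).re := by
  rw [← laplacian_fser (hv.coord i)]
  have h1 := ((contDiff_vfield 2 hv).contDiffAt (x := x)).laplacian_CLM_comp_left
    (l := (EuclideanSpace.proj (𝕜 := ℝ) i : E3 →L[ℝ] ℝ))
  have h2 := ((contDiff_fser_nat 2 (hv.coord i)).contDiffAt (x := x)).laplacian_CLM_comp_left
    (l := Complex.reCLM)
  exact h1.symm.trans h2

lemma Rapid.conv_complex {c d : Freq → ℂ} (hc : Rapid c) (hd : Rapid d) :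
    Rapid fun k => ∑' l, c (k - l) * d l := by
  have hc' : Rapid fun k => ‖c k‖ := hc.mono fun k => by simp
  have hd' : Rapid fun k => ‖d k‖ := hd.mono fun k => by simp
  refine (hc'.conv hd').mono fun k => ?_
  rw [Real.norm_of_nonneg (tsum_nonneg fun _ => by positivity)]
  have hs : Summable fun l => ‖c (k - l)‖ * ‖d l‖ :=
    summable_conv (b := fun k => ‖c k‖) (d := fun l => ‖d l‖)
      (by simpa using hc.summable_norm) (by simpa using hd.summable_norm) k
  simp only [abs_norm]
  exact tsum_of_norm_bounded hs.hasSum fun l => (norm_mul_le _ _)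

lemma summable_convInf {b : Freq → ℝ} (hb : Rapid b) {v w : Freq → C3}
    (hv : ∀ k, ‖v k‖ ≤ b k) (hw : ∀ k, ‖w k‖ ≤ b k) (k : Freq) :
    Summable fun l => dot l (v (k - l)) • w l :=
  Summable.of_norm_bounded (summable_convBound hb hb k) fun l => norm_dot_smul_le hv hw k l

lemma convInf_apply {b : Freq → ℝ} (hb : Rapid b) {v w : Freq → C3}
    (hv : ∀ k, ‖v k‖ ≤ b k) (hw : ∀ k, ‖w k‖ ≤ b k) (k : Freq) (i : Fin 3) :
    convInf v w k i = ∑' l, dot l (v (k - l)) * w l i :=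
  (EuclideanSpace.proj i : C3 →L[ℂ] ℂ).map_tsum (summable_convInf hb hv hw k)

/-- The convection term `(u · ∇) u` as a Fourier series. -/
lemma sum_fser_mul_dcoef {b : Freq → ℝ} (hb : Rapid b) {v : Freq → C3} (hv : ∀ k, ‖v k‖ ≤ b k)
    (x : E3) (i : Fin 3) :
    ∑ j, fser (fun k => v k j) x * fser (dcoef j fun k => v k i) x =
      fser (fun k => Complex.I * convInf v v k i) x := by
  have hr : Rapid v := hb.mono fun k => (hv k).trans (le_abs_self _)
  simp_rw [fser_mul (hr.coord _) ((hr.coord i).dcoef _)]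
  rw [← fser_sum _ fun j _ => (hr.coord j).conv_complex ((hr.coord i).dcoef j)]
  refine congrArg (fun c => fser c x) (funext fun k => ?_)
  rw [convInf_apply hb hv hv, ← tsum_mul_left, ← Summable.tsum_finsetSum]
  · refine tsum_congr fun l => ?_
    simp only [dot, dcoef, Finset.sum_mul, Finset.mul_sum]
    exact Finset.sum_congr rfl fun j _ => by ring
  · intro j _
    exact summable_conv (b := fun k => v k j) (hr.coord j).summable_norm
      ((hr.coord i).dcoef j).summable_norm k

lemma convInf_neg_freq {v : Freq → C3} (hv : ∀ k, v (-k) = cj (v k)) (k : Freq) :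
    convInf v v (-k) = -cj (convInf v v k) := by
  let e : C3 ≃L[ℝ] C3 := (LinearEquiv.toContinuousLinearEquiv
    { toFun := cj, invFun := cj, left_inv := cj_cj, right_inv := cj_cj
      map_add' := fun z w => by ext i; simp
      map_smul' := fun c z => by ext i; simp })
  have h1 : cj (convInf v v k) = ∑' l, cj (dot l (v (k - l)) • v l) := e.map_tsum
  rw [h1, convInf, ← (Equiv.neg Freq).tsum_eq, ← tsum_neg]
  refine tsum_congr fun l => ?_
  rw [cj_smul, ← dot_cj, ← hv, ← hv, Equiv.neg_apply, neg_dot, neg_smul]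
  congr 4
  abel

/-- The Fourier coefficients of the pressure belonging to the velocity coefficients `v`. -/
def presCoef (v : Freq → C3) (k : Freq) : ℂ := pres k (convInf v v k)

lemma norm_pres_le (k : Freq) (z : C3) : ‖pres k z‖ ≤ ‖z‖ := by
  rcases eq_or_ne k 0 with rfl | hk
  · simp [pres]
  · have h1 := one_le_freqNorm hk
    have h2 := norm_dot_le k z
    rw [pres, norm_neg, norm_div, norm_pow, Complex.norm_real,
      Real.norm_of_nonneg (freqNorm_nonneg k), div_le_iff₀ (by positivity)]
    nlinarith [norm_nonneg z, mul_nonneg (norm_nonneg z) (sub_nonneg.mpr h1)]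

lemma rapid_presCoef {b : Freq → ℝ} (hb : Rapid b) {v : Freq → C3} (hv : ∀ k, ‖v k‖ ≤ b k) :
    Rapid (presCoef v) :=
  (hb.convBound hb).mono fun k => (norm_pres_le k _).trans
    ((norm_convInf_le hb hb hv hv k).trans (le_abs_self _))

lemma presCoef_neg {v : Freq → C3} (hv : ∀ k, v (-k) = cj (v k)) (k : Freq) :
    presCoef v (-k) = (starRingEnd ℂ) (presCoef v k) := by
  simp [presCoef, pres, convInf_neg_freq hv, dot_neg, neg_dot, dot_cj]

lemma presCoef_zero (v : Freq → C3) : presCoef v 0 = 0 := by simp [presCoef, pres]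

namespace IsSpectralSol

variable {ν T : ℝ} {a : Freq → C3} {b : Freq → ℝ} {U : ℝ → Freq → C3}

lemma rapid_apply (h : IsSpectralSol ν T a b U) {t : ℝ} (ht : t ∈ Icc 0 T) : Rapid (U t) :=
  h.rapid.mono fun k => (h.bound t ht k).trans (le_abs_self _)

lemma real_cj (h : IsSpectralSol ν T a b U) {t : ℝ} (ht : t ∈ Icc 0 T) (k : Freq) :
    U t (-k) = cj (U t k) := by
  ext i; exact h.real t ht k i

lemma hasDerivWithinAt_vfield (h : IsSpectralSol ν T a b U) (hν : 0 ≤ ν) {t : ℝ}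
    (ht : t ∈ Icc 0 T) (x : E3) :
    HasDerivWithinAt (fun t' => vfield (U t') x) (vfield (limRhs ν (U t)) x) (Icc 0 T) t := by
  have hi : ∀ i, HasDerivWithinAt (fun t' => vfield (U t') x i)
      (vfield (limRhs ν (U t)) x i) (Icc 0 T) t := by
    intro i
    have h1 := hasDerivWithinAt_fser (c := fun t k => U t k i)
      (c' := fun k => limRhs ν (U t) k i) (rapid_rhsBound (ν := ν) h.rapid) ht
      (fun t ht => (h.rapid_apply ht).coord i) (fun t' ht' k => ?_) (fun k => ?_) x
    · exact Complex.reCLM.hasFDerivAt.comp_hasDerivWithinAt t h1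
    · refine (PiLp.norm_apply_le (U t' k - U t k) i).trans ?_
      exact Convex.norm_image_sub_le_of_norm_hasDerivWithin_le (fun s hs => h.deriv s hs k)
        (fun s hs => norm_limRhs_le hν h.rapid (h.bound s hs) k) (convex_Icc 0 T) ht ht'
    · exact ((EuclideanSpace.proj i : C3 →L[ℂ] ℂ).restrictScalars
        ℝ).hasFDerivAt.comp_hasDerivWithinAt t (h.deriv t ht k)
  exact (PiLp.continuousLinearEquiv 2 ℝ
    fun _ : Fin 3 => ℝ).symm.toContinuousLinearMap.hasFDerivAt.comp_hasDerivWithinAt t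
      (hasDerivWithinAt_pi.mpr hi)

/-- A solution of the system for the Fourier coefficients is a classical solution. -/
theorem isNavierStokesSolution (h : IsSpectralSol ν T a b U) (hν : 0 ≤ ν) {a' : E3 → E3}
    (ha' : vfield a =ᵐ[volume] a') :
    IsNavierStokesSolution ν T a' (fun t => vfield (U t))
      (fun t x => (fser (presCoef (U t)) x).re) where
  periodic_u t _ := isPeriodic_vfield _
  periodic_p t _ := (isPeriodic_fser _).re
  contDiff_u t ht := contDiff_vfield 2 (h.rapid_apply ht)
  contDiff_p t ht := contDiff_re_fser 1 (rapid_presCoef h.rapid (h.bound t ht))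
  initial := by rw [h.init]; exact ha'
  incompressible t ht x := by
    have hr := h.rapid_apply ht
    have h1 : ∀ i, fderiv ℝ (vfield (U t)) x (EuclideanSpace.single i 1) i =
        (fser (dcoef i fun k => U t k i) x).re := by
      intro i
      rw [fderiv_vfield hr, Finset.sum_eq_single i] <;> simp +contextual
    simp only [h1]
    rw [← Complex.re_sum, ← fser_sum _ fun i _ => (hr.coord i).dcoef i]
    have h2 : (fun k => ∑ i, dcoef i (fun k => U t k i) k) = fun k => Complex.I * 0 := by
      funext k
      rw [← h.div t ht k, dot, Finset.mul_sum]
      exact Finset.sum_congr rfl fun i _ => by rw [dcoef, mul_assoc]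
    rw [h2, fser_const_mul Complex.I fun _ => 0]
    simp [fser]
  momentum t ht x := by
    refine ⟨_, h.hasDerivWithinAt_vfield hν ht x, ?_⟩
    have hb := h.bound t ht
    have hr := h.rapid_apply ht
    have hp := rapid_presCoef h.rapid hb
    ext i
    have hreal : ∀ j, ((vfield (U t) x j : ℝ) : ℂ) = fser (fun k => U t k j) x := fun j =>
      ofReal_re_fser (fun k => h.real t ht k j) x
    -- the first factor of each product is real, so the real part of the series can be taken last
    have hconv : fderiv ℝ (vfield (U t)) x (vfield (U t) x) i =
        (fser (fun k => Complex.I * convInf (U t) (U t) k i) x).re := by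
      rw [fderiv_vfield hr, ← sum_fser_mul_dcoef h.rapid hb, Complex.re_sum]
      refine Finset.sum_congr rfl fun j _ => ?_
      rw [← hreal j, Complex.re_ofReal_mul]
    have hconvr : Rapid fun k => Complex.I * convInf (U t) (U t) k i :=
      (h.rapid.convBound h.rapid).mono fun k => by
        rw [norm_mul, Complex.norm_I, one_mul]
        exact (PiLp.norm_apply_le _ i).trans
          ((norm_convInf_le h.rapid h.rapid hb hb k).trans (le_abs_self _))
    have hlapr : Rapid fun k => -((freqNorm k : ℂ) ^ 2) * U t k i :=
      (hr.coord i).of_le 1 2 fun k => by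
        have := freqNorm_nonneg k
        rw [norm_mul, norm_neg, norm_pow, Complex.norm_real, Real.norm_of_nonneg this, one_mul]
        gcongr
        linarith
    have hrhs : fser (fun k => limRhs ν (U t) k i) x =
        ν * fser (fun k => -((freqNorm k : ℂ) ^ 2) * U t k i) x +
          ((-1) * fser (fun k => Complex.I * convInf (U t) (U t) k i) x +
            (-1) * fser (dcoef i (presCoef (U t))) x) := by
      have hneg : ∀ {c : Freq → ℂ} (z : ℂ), Rapid c → Rapid fun k => z * c k := fun z hc =>
        hc.of_le ‖z‖ 0 fun k => by simp
      rw [← fser_const_mul, ← fser_const_mul, ← fser_const_mul,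
        ← fser_add (hneg _ hconvr) (hneg _ (hp.dcoef i)),
        ← fser_add (hneg _ hlapr) ((hneg _ hconvr).add (hneg _ (hp.dcoef i)))]
      refine congrArg (fun c => fser c x) (funext fun k => ?_)
      rw [limRhs, leray_eq_add_pres]
      simp only [PiLp.sub_apply, PiLp.neg_apply, PiLp.smul_apply, PiLp.add_apply, smul_eq_mul,
        freqVecC_apply, dcoef, presCoef]
      push_cast
      ring
    simp only [PiLp.add_apply, PiLp.sub_apply, PiLp.smul_apply, PiLp.zero_apply, smul_eq_mul]
    rw [hconv, laplacian_vfield hr, gradient_re_fser hp, vfield_apply, hrhs]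
    simp only [Complex.add_re, Complex.re_ofReal_mul, neg_mul, one_mul, Complex.neg_re]
    ring

end IsSpectralSol

/-! ### Gevrey norms of real functions and their Fourier coefficients -/

lemma isFiniteMeasure_cube : IsFiniteMeasure (volume.restrict cube) :=
  ⟨by simpa using volume_cube_lt_top⟩

lemma norm_exp_neg_phase (k : Freq) (x : E3) :
    ‖Complex.exp (-(Complex.I * (phase k x : ℂ)))‖ = 1 := by
  have := norm_exp_phase (-k) x
  rw [phase_neg] at this
  simpa using this

lemma continuous_phase (k : Freq) : Continuous (phase k) := by
  unfold phase; fun_prop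

lemma integrable_mul_exp {f : E3 → ℝ} (hf : MemLp f 2 (volume.restrict cube)) (k : Freq) :
    Integrable (fun x => (f x : ℂ) * Complex.exp (-(Complex.I * (phase k x : ℂ))))
      (volume.restrict cube) := by
  have := isFiniteMeasure_cube
  have := continuous_phase k
  refine (hf.integrable (by norm_num)).ofReal.mul_bdd (c := 1)
    (Continuous.aestronglyMeasurable (by fun_prop))
    (Eventually.of_forall fun x => (norm_exp_neg_phase k x).le)

lemma fourierCoef_sub {f g : E3 → ℝ} (hf : MemLp f 2 (volume.restrict cube))
    (hg : MemLp g 2 (volume.restrict cube)) (k : Freq) :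
    fourierCoef (fun x => f x - g x) k = fourierCoef f k - fourierCoef g k := by
  unfold fourierCoef
  rw [← mul_sub, ← integral_sub (integrable_mul_exp hf k) (integrable_mul_exp hg k)]
  simp [sub_mul]

lemma fourierCoef_neg_freq (f : E3 → ℝ) (k : Freq) :
    fourierCoef f (-k) = (starRingEnd ℂ) (fourierCoef f k) := by
  unfold fourierCoef
  rw [map_mul, Complex.conj_ofReal, ← integral_conj]
  congr 2
  funext x
  rw [map_mul, Complex.conj_ofReal, ← Complex.exp_conj]
  simp [phase_neg]

lemma memLp_coord {v : E3 → E3} (hv : MemLp v 2 (volume.restrict cube)) (i : Fin 3) :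
    MemLp (fun x => v x i) 2 (volume.restrict cube) :=
  (EuclideanSpace.proj i : E3 →L[ℝ] ℝ).comp_memLp' hv

lemma memLp_vfield {v : Freq → C3} (hv : Rapid v) : MemLp (vfield v) 2 (volume.restrict cube) := by
  have := isFiniteMeasure_cube
  refine MemLp.of_bound (contDiff_vfield 0 hv).continuous.aestronglyMeasurable
    (√(∑ i, (∑' k, ‖v k i‖) ^ 2)) (Eventually.of_forall fun x => ?_)
  rw [EuclideanSpace.norm_eq]
  refine Real.sqrt_le_sqrt (Finset.sum_le_sum fun i _ => ?_)
  gcongr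
  exact (Complex.abs_re_le_norm _).trans (norm_fser_le (hv.coord i) x)

lemma vecFourierCoef_vfield {v : Freq → C3} (hv : Rapid v) (hreal : ∀ k, v (-k) = cj (v k))
    (k : Freq) (i : Fin 3) : vecFourierCoef (vfield v) k i = v k i :=
  fourierCoef_fser (hv.coord i) (fun k => by rw [hreal, cj_apply]) k

lemma gevreyWeight_eq (s r τ : ℝ) (k : Freq) :
    gevreyWeight s r τ k = gevW r (1 / s) τ (freqNorm k) ^ 2 := by
  rw [gevreyWeight, gevW, mul_pow, ← Real.exp_nat_mul, ← Real.rpow_natCast (freqNorm k ^ r),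
    ← Real.rpow_mul (freqNorm_nonneg k)]
  push_cast
  ring_nf

/-- A weighted norm is bounded as soon as its finite partial sums are. -/
lemma weightedNorm_le {w A g : Freq → ℝ} {B : ℝ} (hB : 0 ≤ B) (hg : ∀ k, w k * A k = g k ^ 2)
    (hJ : ∀ J : Finset Freq, ∑ k ∈ J, g k ^ 2 ≤ B ^ 2) : weightedNorm w A ≤ ENNReal.ofReal B := by
  have h1 : ∑' k, ENNReal.ofReal (w k * A k) ≤ ENNReal.ofReal (B ^ 2) := by
    rw [ENNReal.tsum_eq_iSup_sum]
    refine iSup_le fun J => ?_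
    simp only [hg]
    rw [← ENNReal.ofReal_sum_of_nonneg fun _ _ => sq_nonneg _]
    exact ENNReal.ofReal_le_ofReal (hJ J)
  refine (ENNReal.rpow_le_rpow h1 (by norm_num)).trans_eq ?_
  rw [ENNReal.ofReal_rpow_of_nonneg (sq_nonneg _) (by norm_num), ← Real.sqrt_eq_rpow,
    Real.sqrt_sq hB]

lemma weightedNorm_lt_top_iff {w A : Freq → ℝ} :
    weightedNorm w A < ⊤ ↔ ∑' k, ENNReal.ofReal (w k * A k) < ⊤ :=
  ENNReal.rpow_lt_top_iff_of_pos (by norm_num)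

lemma exists_sum_le_of_weightedNorm {w A : Freq → ℝ} (h0 : ∀ k, 0 ≤ w k * A k)
    (h : weightedNorm w A < ⊤) :
    ∃ M : ℝ, 0 < M ∧ ∀ J : Finset Freq, ∑ k ∈ J, w k * A k ≤ M ^ 2 := by
  rw [weightedNorm_lt_top_iff] at h
  set S := ∑' k, ENNReal.ofReal (w k * A k) with hS
  have hS0 : 0 ≤ S.toReal := ENNReal.toReal_nonneg
  refine ⟨S.toReal + 1, by linarith, fun J => ?_⟩
  have h1 : ∑ k ∈ J, w k * A k ≤ S.toReal := by
    rw [← ENNReal.ofReal_le_iff_le_toReal h.ne, ENNReal.ofReal_sum_of_nonneg fun k _ => h0 k]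
    exact ENNReal.sum_le_tsum J
  nlinarith

lemma sobolevWeight_le {s r τ : ℝ} (hr : 0 ≤ r) (hτ : 0 ≤ τ) {k : Freq} (hk : k ≠ 0) :
    sobolevWeight r k ≤ 2 ^ r * gevreyWeight s r τ k := by
  have h1 := one_le_freqNorm hk
  have h2 : (1 + freqNorm k ^ 2) ^ r ≤ (2 * freqNorm k ^ 2) ^ r := by
    refine Real.rpow_le_rpow (by positivity) ?_ hr
    nlinarith
  rw [Real.mul_rpow (by norm_num) (by positivity), ← Real.rpow_natCast_mul (by linarith)] at h2
  refine h2.trans ?_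
  rw [gevreyWeight]
  push_cast
  have h3 : 1 ≤ Real.exp (2 * τ * freqNorm k ^ (1 / s)) :=
    Real.one_le_exp (mul_nonneg (by linarith) (Real.rpow_nonneg (by linarith) _))
  have h4 : 0 ≤ (2 : ℝ) ^ r * freqNorm k ^ (2 * r) := by positivity
  nlinarith

/-- For mean-free functions the Gevrey norm dominates the Sobolev norm. -/
lemma sobolev_lt_top_of_gevrey {s r τ : ℝ} (hr : 0 ≤ r) (hτ : 0 ≤ τ) {A : Freq → ℝ}
    (hA : ∀ k, 0 ≤ A k) (hA0 : A 0 = 0) (h : weightedNorm (gevreyWeight s r τ) A < ⊤) :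
    weightedNorm (sobolevWeight r) A < ⊤ := by
  rw [weightedNorm_lt_top_iff] at h ⊢
  have h1 : ∀ k, ENNReal.ofReal (sobolevWeight r k * A k) ≤
      ENNReal.ofReal (2 ^ r) * ENNReal.ofReal (gevreyWeight s r τ k * A k) := by
    intro k
    rw [← ENNReal.ofReal_mul (by positivity), ← mul_assoc]
    refine ENNReal.ofReal_le_ofReal ?_
    rcases eq_or_ne k 0 with rfl | hk
    · simp [hA0]
    · exact mul_le_mul_of_nonneg_right (sobolevWeight_le hr hτ hk) (hA k)
  refine (ENNReal.tsum_le_tsum h1).trans_lt ?_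
  rw [ENNReal.tsum_mul_left]
  exact ENNReal.mul_lt_top ENNReal.ofReal_lt_top h

lemma gevreyNorm_le {s r τ B : ℝ} (hB : 0 ≤ B) {v : E3 → E3} {c : Freq → C3}
    (hc : ∀ k i, vecFourierCoef v k i = c k i)
    (hJ : ∀ J : Finset Freq, ∑ k ∈ J, (gevW r (1 / s) τ (freqNorm k) * ‖c k‖) ^ 2 ≤ B ^ 2) :
    gevreyNorm s r τ v ≤ ENNReal.ofReal B := by
  refine weightedNorm_le hB (fun k => ?_) hJ
  simp only [hc]
  rw [← EuclideanSpace.norm_sq_eq, gevreyWeight_eq, mul_pow]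

lemma gevreyNormScalar_le {s r τ B : ℝ} (hB : 0 ≤ B) {q : E3 → ℝ} {c : Freq → ℂ}
    (hc : ∀ k, fourierCoef q k = c k)
    (hJ : ∀ J : Finset Freq, ∑ k ∈ J, (gevW r (1 / s) τ (freqNorm k) * ‖c k‖) ^ 2 ≤ B ^ 2) :
    gevreyNormScalar s r τ q ≤ ENNReal.ofReal B := by
  refine weightedNorm_le hB (fun k => ?_) hJ
  simp only [hc]
  rw [gevreyWeight_eq, mul_pow]

namespace IsSpectralSol

variable {ν T : ℝ} {a : Freq → C3} {b : Freq → ℝ} {U : ℝ → Freq → C3}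

lemma vecFourierCoef_eq (h : IsSpectralSol ν T a b U) {t : ℝ} (ht : t ∈ Icc 0 T) (k : Freq)
    (i : Fin 3) : vecFourierCoef (vfield (U t)) k i = U t k i :=
  vecFourierCoef_vfield (h.rapid_apply ht) (h.real_cj ht) k i

lemma fourierCoef_eq (h : IsSpectralSol ν T a b U) {t : ℝ} (ht : t ∈ Icc 0 T) (k : Freq) :
    fourierCoef (fun x => (fser (presCoef (U t)) x).re) k = presCoef (U t) k :=
  fourierCoef_fser (rapid_presCoef h.rapid (h.bound t ht)) (presCoef_neg (h.real_cj ht)) k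

lemma continuousOn (h : IsSpectralSol ν T a b U) (k : Freq) :
    ContinuousOn (fun t => U t k) (Icc 0 T) := fun t ht =>
  (h.deriv t ht k).continuousWithinAt

lemma continuousOn_presCoef (h : IsSpectralSol ν T a b U) (k : Freq) :
    ContinuousOn (fun t => presCoef (U t) k) (Icc 0 T) := by
  refine (continuous_pres k).comp_continuousOn ?_
  refine continuousOn_tsum (fun l => ?_) (summable_convBound h.rapid h.rapid k)
    fun l t ht => norm_dot_smul_le (h.bound t ht) (h.bound t ht) k l
  exact ((continuous_dot l).comp_continuousOn (h.continuousOn _)).smul (h.continuousOn l)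

/-- The velocity field with coefficients `U` belongs to `L^∞([0,T]; G^s_{r,τ(·)})`. -/
lemma memLinftyGevrey (h : IsSpectralSol ν T a b U) {s r R : ℝ} (hr : 0 ≤ r) {τ : ℝ → ℝ}
    (hτ : ∀ t ∈ Icc 0 T, 0 < τ t)
    (hR : ∀ t ∈ Icc 0 T, ∀ J : Finset Freq,
      ∑ k ∈ J, (gevW r (1 / s) (τ t) (freqNorm k) * ‖U t k‖) ^ 2 ≤ R ^ 2) :
    MemLinftyGevrey s r T τ fun t => vfield (U t) := by
  have hbd : ∀ t ∈ Icc 0 T, gevreyNorm s r (τ t) (vfield (U t)) ≤ ENNReal.ofReal |R| :=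
    fun t ht => gevreyNorm_le (abs_nonneg R) (h.vecFourierCoef_eq ht) fun J => by
      rw [sq_abs]; exact hR t ht J
  refine ⟨fun k i => ?_, fun t ht => ?_, |R|, hbd⟩
  · refine AEStronglyMeasurable.congr (f := fun t => U t k i) ?_ ?_
    · exact ((EuclideanSpace.proj i : C3 →L[ℂ] ℂ).continuous.comp_continuousOn
        (h.continuousOn k)).aestronglyMeasurable measurableSet_Icc
    · filter_upwards [ae_restrict_mem measurableSet_Icc] with t ht
      exact (h.vecFourierCoef_eq ht k i).symm
  · have h0 : vecFourierCoef (vfield (U t)) 0 = 0 := by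
      funext i; rw [h.vecFourierCoef_eq ht, h.zero t ht]; rfl
    have hfin := (hbd t ht).trans_lt ENNReal.ofReal_lt_top
    refine ⟨⟨isPeriodic_vfield _, memLp_vfield (h.rapid_apply ht), h0, fun k => ?_, ?_⟩, hfin⟩
    · simp only [h.vecFourierCoef_eq ht]
      exact h.div t ht k
    · refine sobolev_lt_top_of_gevrey hr (hτ t ht).le (fun k => by positivity) ?_ hfin
      simp [h0]

/-- The pressure belonging to `U` lies in `L^∞([0,T]; G^s_{r,τ(·)})`. -/
lemma memLinftyGevreyScalar (h : IsSpectralSol ν T a b U) {s r R : ℝ} (hr : 0 ≤ r) {τ : ℝ → ℝ}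
    (hτ : ∀ t ∈ Icc 0 T, 0 < τ t)
    (hR : ∀ t ∈ Icc 0 T, ∀ J : Finset Freq,
      ∑ k ∈ J, (gevW r (1 / s) (τ t) (freqNorm k) * ‖presCoef (U t) k‖) ^ 2 ≤ R ^ 2) :
    MemLinftyGevreyScalar s r T τ fun t x => (fser (presCoef (U t)) x).re := by
  have hbd : ∀ t ∈ Icc 0 T, gevreyNormScalar s r (τ t)
      (fun x => (fser (presCoef (U t)) x).re) ≤ ENNReal.ofReal |R| :=
    fun t ht => gevreyNormScalar_le (abs_nonneg R) (h.fourierCoef_eq ht) fun J => by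
      rw [sq_abs]; exact hR t ht J
  refine ⟨fun k => ?_, fun t ht => ?_, |R|, hbd⟩
  · refine AEStronglyMeasurable.congr (f := fun t => presCoef (U t) k) ?_ ?_
    · exact (h.continuousOn_presCoef k).aestronglyMeasurable measurableSet_Icc
    · filter_upwards [ae_restrict_mem measurableSet_Icc] with t ht
      exact (h.fourierCoef_eq ht k).symm
  · have h0 : fourierCoef (fun x => (fser (presCoef (U t)) x).re) 0 = 0 := by
      rw [h.fourierCoef_eq ht, presCoef_zero]
    have hfin := (hbd t ht).trans_lt ENNReal.ofReal_lt_top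
    refine ⟨(isPeriodic_fser _).re, memLp_re_fser (rapid_presCoef h.rapid (h.bound t ht)), h0, ?_,
      hfin⟩
    exact sobolev_lt_top_of_gevrey hr (hτ t ht).le (fun k => by positivity) (by simp [h0]) hfin

end IsSpectralSol

/-- A field in `H^r` with rapidly decaying Fourier coefficients is almost everywhere the sum of its
Fourier series. -/
lemma MemSobolev.vfield_ae_eq {r : ℝ} {a : E3 → E3} (ha : MemSobolev r a)
    (hr : Rapid fun k => (WithLp.toLp 2 (vecFourierCoef a k) : C3)) :
    vfield (fun k => WithLp.toLp 2 (vecFourierCoef a k)) =ᵐ[volume] a := by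
  set c : Freq → C3 := fun k => WithLp.toLp 2 (vecFourierCoef a k) with hc
  have hcr : ∀ k, c (-k) = cj (c k) := fun k => by
    ext i; exact fourierCoef_neg_freq _ k
  have h1 : ∀ i, ∀ᵐ x : E3, vfield c x i - a x i = 0 := by
    intro i
    refine IsPeriodic.ae_eq_zero (f := fun x => vfield c x i - a x i) (fun j x => ?_) ?_
    · simp only [isPeriodic_vfield c j x, ha.periodic j x]
    · have hm1 := memLp_coord (memLp_vfield hr) i
      have hm2 := memLp_coord ha.memLp i
      refine ae_eq_zero_of_fourierCoef (hm1.sub hm2) fun k => ?_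
      refine (fourierCoef_sub hm1 hm2 k).trans ?_
      rw [sub_eq_zero]
      exact vecFourierCoef_vfield hr hcr k i
  filter_upwards [ae_all_iff.mpr h1] with x hx
  ext i
  exact sub_eq_zero.mp (hx i)

end GevreyNS

open GevreyNS in
theorem theorem1p1 (r s τ₀ : ℝ) (hr : 9 / 2 < r) (hs : 1 ≤ s) (hτ₀ : 0 < τ₀)
    (a : GevreyNS.E3 → GevreyNS.E3) (ha : GevreyNS.MemGevrey s r τ₀ a) :
    ∃ (ν₀ T : ℝ) (τ : ℝ → ℝ), 0 < ν₀ ∧ 0 < T ∧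
      (∀ t ∈ Set.Icc 0 T, 0 < τ t) ∧ StrictAntiOn τ (Set.Icc 0 T) ∧
      (∃ C₁ C₂ : ℝ, 0 < C₁ ∧ 0 < C₂ ∧ ∀ t ∈ Set.Icc 0 T,
        τ t = 1 / (Real.exp (C₁ * t) * (1 / τ₀) + C₂ / C₁ * (Real.exp (C₁ * t) - 1))) ∧
      ∃ (u : ℝ → GevreyNS.E3 → GevreyNS.E3) (p : ℝ → GevreyNS.E3 → ℝ) (C : ℝ),
        GevreyNS.IsEulerSolution T a u p ∧
        GevreyNS.MemLinftyGevrey s r T τ u ∧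
        GevreyNS.MemLinftyGevreyScalar s (r + 1) T τ p ∧
        ∀ ν : ℝ, 0 < ν → ν ≤ ν₀ →
          ∃ (uν : ℝ → GevreyNS.E3 → GevreyNS.E3) (pν : ℝ → GevreyNS.E3 → ℝ),
            GevreyNS.IsNavierStokesSolution ν T a uν pν ∧
            GevreyNS.MemLinftyGevrey s r T τ uν ∧
            GevreyNS.MemLinftyGevreyScalar s (r + 1) T τ pν ∧
            ∀ t ∈ Set.Ioc 0 T,
              GevreyNS.gevreyNorm s (r - 1) (τ t) (uν t - u t) ≤ ENNReal.ofReal (C * √ν) ∧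
              GevreyNS.gevreyNormScalar s r (τ t) (pν t - p t) ≤ ENNReal.ofReal (C * √ν) := by
  have hσ0 : 0 < 1 / s := by positivity
  have hσ1 : 1 / s ≤ 1 := by rw [div_le_one (by linarith)]; exact hs
  set c : Freq → C3 := fun k => WithLp.toLp 2 (vecFourierCoef a k) with hc
  have hc0 : c 0 = 0 := by
    ext i; exact congrFun ha.sobolev.mean_zero i
  have hcr : ∀ k, c (-k) = cj (c k) := fun k => by
    ext i; exact fourierCoef_neg_freq _ k
  have hw : ∀ k, gevreyWeight s r τ₀ k * ∑ i, ‖vecFourierCoef a k i‖ ^ 2 =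
      (gevW r (1 / s) τ₀ (freqNorm k) * ‖c k‖) ^ 2 := fun k => by
    rw [mul_pow, EuclideanSpace.norm_sq_eq, gevreyWeight_eq]
  obtain ⟨M, hM, hcM⟩ := exists_sum_le_of_weightedNorm
    (fun k => by rw [hw]; positivity) ha.finite
  simp only [hw] at hcM
  obtain ⟨C₁, T, hC₁, hT, b, U, R, R', C, hU, hR, hR', hC, hC'⟩ :=
    exists_spectral_solutions hr hσ0 hσ1 hτ₀ hM hc0 ha.sobolev.div_free hcr hcM
  have hcrapid : Rapid c := by
    rw [← (hU 0 le_rfl).init]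
    exact (hU 0 le_rfl).rapid_apply ⟨le_rfl, hT.le⟩
  have hinit := ha.sobolev.vfield_ae_eq hcrapid
  have hpos : ∀ t ∈ Icc 0 T, 0 < gevRadius C₁ 1 τ₀ t := fun t ht =>
    gevRadius_pos hC₁ one_pos hτ₀ ht.1
  have hsol := fun ν (hν : 0 ≤ ν) => (hU ν hν).isNavierStokesSolution hν hinit
  have hmem := fun ν (hν : 0 ≤ ν) =>
    (hU ν hν).memLinftyGevrey (by linarith) hpos (hR ν hν)
  have hmem' := fun ν (hν : 0 ≤ ν) =>
    (hU ν hν).memLinftyGevreyScalar (r := r + 1) (by linarith) hpos (hR' ν hν)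
  -- the rate for the pressure has the additional factor `K`
  set K := 2 ^ (r - 1) * embConst * (8 * M) with hK
  have hK0 : 0 ≤ K := by have := embConst_nonneg; positivity
  refine ⟨1, T, gevRadius C₁ 1 τ₀, one_pos, hT, hpos,
    gevRadius_strictAntiOn hC₁ one_pos hτ₀ T, ⟨C₁, 1, hC₁, one_pos, fun t _ => rfl⟩,
    fun t => vfield (U 0 t), fun t x => (fser (presCoef (U 0 t)) x).re, (1 + K) * |C|,
    hsol 0 le_rfl, hmem 0 le_rfl, hmem' 0 le_rfl, fun ν hν _ =>
    ⟨fun t => vfield (U ν t), fun t x => (fser (presCoef (U ν t)) x).re,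
      hsol ν hν.le, hmem ν hν.le, hmem' ν hν.le, fun t ht => ?_⟩⟩
  have ht' : t ∈ Icc 0 T := Ioc_subset_Icc_self ht
  have hUν := hU ν hν.le
  have hU0 := hU 0 le_rfl
  have hsq : 0 ≤ |C| * √ν := by positivity
  constructor
  · refine (gevreyNorm_le (B := |C| * √ν) (c := fun k => U ν t k - U 0 t k) hsq
      (fun k i => ?_) fun J => ?_).trans (ENNReal.ofReal_le_ofReal ?_)
    · refine (fourierCoef_sub (memLp_coord (memLp_vfield (hUν.rapid_apply ht')) i)
        (memLp_coord (memLp_vfield (hU0.rapid_apply ht')) i) k).trans ?_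
      exact congrArg₂ (· - ·) (hUν.vecFourierCoef_eq ht' k i) (hU0.vecFourierCoef_eq ht' k i)
    · refine (hC ν hν t ht' J).trans_eq ?_
      rw [mul_pow, mul_pow, sq_abs]
    · nlinarith [mul_nonneg hK0 hsq]
  · refine (gevreyNormScalar_le (B := K * (|C| * √ν))
      (c := fun k => presCoef (U ν t) k - presCoef (U 0 t) k) (by positivity)
      (fun k => ?_) fun J => ?_).trans (ENNReal.ofReal_le_ofReal ?_)
    · refine (fourierCoef_sub (memLp_re_fser (rapid_presCoef hUν.rapid (hUν.bound t ht')))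
        (memLp_re_fser (rapid_presCoef hU0.rapid (hU0.bound t ht'))) k).trans ?_
      exact congrArg₂ (· - ·) (hUν.fourierCoef_eq ht' k) (hU0.fourierCoef_eq ht' k)
    · refine (hC' ν hν t ht' J).trans_eq ?_
      rw [mul_pow K, mul_pow C, mul_pow K, mul_pow |C|, sq_abs]
    · nlinarith
end
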